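/- Let $\mathbb{K}$ be a field, $A$ an associative unital $\mathbb{K}$-algebra, $e\in A$ an idempotent and $d\ge 0$ an integer. Modules are left modules, $\mathcal{D}(R)$ is the unbounded derived category of $R$-modules, $\mathrm{D}V=\operatorname{Hom}_{\mathbb{K}}(V,\mathbb{K})$, $\langle e\rangle=AeA$, $\underline{A}=A/\langle e\rangle$, and $A^{\mathrm{e}}=A\otimes_{\mathbb{K}}A^{\mathrm{op}}$, so that $A$-bimodules are $A^{\mathrm{e}}$-modules. Let $\Omega_A=\mathbf{R}\mathrm{Hom}_{A^{\mathrm{e}}}(A,A^{\mathrm{e}})\in\mathcal{D}(A^{\mathrm{e}})$, with bimodule structure induced by the inner multiplication on $A^{\mathrm{e}}$: if $f(m)=u\otimes v$, then $(xfy)(m)=uy\otimes xv$. Let $\mathcal{D}_{\mathrm{fd},\underline{A}}(A)$ be the full subcategory of $\mathcal{D}(A)$ of objects whose total cohomology $\bigoplus_i H^i$ is finite-dimensional over $\mathbb{K}$ and all of whose cohomology groups are $\underline{A}$-modules; define $\mathcal{D}_{\mathrm{fd},\underline{A}^{\mathrm{op}}}(A^{\mathrm{op}})$ in the same way from $A^{\mathrm{op}}$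 and $\underline{A}^{\mathrm{op}}$. Assume that $A$ is bimodule internally $d$-Calabi--Yau with respect to $e$, that is: (i) the projective dimension of $A$ as an $A^{\mathrm{e}}$-module is at most $d$; (ii) $A$ is a perfect object of $\mathcal{D}(A^{\mathrm{e}})$, i.e. it is quasi-isomorphic to a bounded complex of finitely generated projective $A^{\mathrm{e}}$-modules; (iii) there is a distinguished triangle $A\to\Omega_A[d]\to C\to A[1]$ in $\mathcal{D}(A^{\mathrm{e}})$ such that $\mathbf{R}\mathrm{Hom}_A(C,M)=0$ for all $M\in\mathcal{D}_{\mathrm{fd},\underline{A}}(A)$ and $\mathbf{R}\mathrm{Hom}_{A^{\mathrm{op}}}(C,N)=0$ for all $N\in\mathcal{D}_{\mathrm{fd},\underline{A}^{\mathrm{op}}}(A^{\mathrm{op}})$. Then there are $\mathbb{K}$-linear isomorphisms $$\mathrm{D}\operatorname{Hom}_{\mathcal{D}(A)}(M,N)\;\cong\;\operatorname{Hom}_{\mathcal{D}(A)}(N[-d],M)$$ for all $N\in\mathcal{D}(A)$ and all $M\in\mathcal{D}_{\mathrm{fd},\underline{A}}(A)$, natural in both $M$ and $N$. -/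

import Mathlib

open CategoryTheory
open scoped TensorProduct DirectSum ZeroObject

universe u v w w₁ w₂ w₃

namespace BimodCY

noncomputable section

section RestrictionOfScalars

variable {R S : Type v} [Ring R] [Ring S] (f : R →+* S)

lemma restrictScalars_map_exact (T : ShortComplex (ModuleCat.{v} S)) (h : T.Exact) :
    (T.map (ModuleCat.restrictScalars.{v} f)).Exact := by
  rw [ShortComplex.ShortExact.moduleCat_exact_iff_function_exact] at h ⊢
  exact h

instance preservesFiniteLimits_restrictScalars :
    Limits.PreservesFiniteLimits (ModuleCat.restrictScalars.{v} f) := by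
  have := ((Functor.exact_tfae (ModuleCat.restrictScalars.{v} f)).out 1 3).mp
    (restrictScalars_map_exact f)
  exact this.1

instance preservesFiniteColimits_restrictScalars :
    Limits.PreservesFiniteColimits (ModuleCat.restrictScalars.{v} f) := by
  have := ((Functor.exact_tfae (ModuleCat.restrictScalars.{v} f)).out 1 3).mp
    (restrictScalars_map_exact f)
  exact this.2

end RestrictionOfScalars

section DerivedCategoryOfAnAlgebra

/-- An object of `D(R)` is perfect if it is isomorphic in `D(R)` to a bounded complex
of finitely generated projective `R`-modules. -/
def IsPerfect {R : Type v} [Ring R] [HasDerivedCategory.{w} (ModuleCat.{v} R)] :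
    ObjectProperty (DerivedCategory (ModuleCat.{v} R)) := fun X =>
  ∃ P : CochainComplex (ModuleCat.{v} R) ℤ,
    (∃ a : ℤ, P.IsStrictlyGE a) ∧ (∃ b : ℤ, P.IsStrictlyLE b) ∧
    (∀ i : ℤ, Module.Finite R (P.X i) ∧ Module.Projective R (P.X i)) ∧
    Nonempty (DerivedCategory.Q.obj P ≅ X)

/-- The quotient ring `R / ⟨e⟩`, where `⟨e⟩ = ReR` is the two-sided ideal generated by `e`. -/
abbrev StabRing {R : Type v} [Ring R] (e : R) : Type v :=
  (TwoSidedIdeal.span {e}).ringCon.Quotient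

/-- The projection `R → R / ⟨e⟩`. -/
abbrev stabProj {R : Type v} [Ring R] (e : R) : R →+* StabRing e :=
  (TwoSidedIdeal.span {e}).ringCon.mk'

/-- The objects of `D(R)` with finite-dimensional total cohomology, all of whose cohomology
groups are (restrictions of) `R / ⟨e⟩`-modules. -/
def StabFD (K : Type u) [Field K] {R : Type v} [Ring R] [Algebra K R]
    [HasDerivedCategory.{w} (ModuleCat.{v} R)] (e : R) :
    ObjectProperty (DerivedCategory (ModuleCat.{v} R)) := fun X =>
  (∀ i : ℤ, (ModuleCat.restrictScalars.{v} (stabProj e)).essImage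
    ((DerivedCategory.homologyFunctor (ModuleCat.{v} R) i).obj X)) ∧
  FiniteDimensional K (⨁ i : ℤ, (ModuleCat.restrictScalars.{v} (algebraMap K R)).obj
    ((DerivedCategory.homologyFunctor (ModuleCat.{v} R) i).obj X))

end DerivedCategoryOfAnAlgebra

section EnvelopingAlgebra

variable (K : Type u) [Field K] (A : Type v) [Ring A] [Algebra K A]

/-- The enveloping algebra `A ⊗ Aᵒᵖ`; its left modules are the `A`-bimodules on which
`K` acts centrally. -/
abbrev Env : Type v := A ⊗[K] Aᵐᵒᵖ

/-- The algebra `A` as a bimodule over itself: `x ⊗ y` acts by `a ↦ x * a * y`. -/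
def diagBimod : ModuleCat.{v} (Env K A) :=
  (ModuleCat.restrictScalars.{v} (AlgHom.mulLeftRight K A).toRingHom).obj
    (ModuleCat.of (Module.End K A) A)

lemma diagBimod_smul (x y a : A) :
    (x ⊗ₜ MulOpposite.op y : Env K A) • (show diagBimod K A from a) =
      (show diagBimod K A from x * a * y) :=
  AlgHom.mulLeftRight_apply K A x (MulOpposite.op y) a

/-- The isomorphism from the enveloping algebra to its opposite, given by exchanging
the two tensor factors: `x ⊗ y ↦ y ⊗ x`. -/
def swapEnv : Env K A ≃ₐ[K] (Env K A)ᵐᵒᵖ :=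
  ((Algebra.TensorProduct.comm K A Aᵐᵒᵖ).trans
    (Algebra.TensorProduct.congr AlgEquiv.refl (AlgEquiv.opOp K A))).trans
    (Algebra.TensorProduct.opAlgEquiv K K A Aᵐᵒᵖ)

lemma swapEnv_tmul (x y : A) :
    swapEnv K A (x ⊗ₜ MulOpposite.op y) = MulOpposite.op (y ⊗ₜ MulOpposite.op x) := by
  simp [swapEnv]

/-- `Hom_{Aᵉ}(P, Aᵉ)`, where `Aᵉ` carries its outer bimodule structure, as an `A`-bimodule
via the inner multiplication on `Aᵉ`: if `f m = u ⊗ v`, then `((x ⊗ y) • f) m = uy ⊗ xv`,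
which is the product of `u ⊗ v` and `y ⊗ x` in `Aᵉ`. -/
def dualObj (P : ModuleCat.{v} (Env K A)) : ModuleCat.{v} (Env K A) :=
  (ModuleCat.restrictScalars.{v} (swapEnv K A : Env K A →+* (Env K A)ᵐᵒᵖ)).obj
    (ModuleCat.of (Env K A)ᵐᵒᵖ (P →ₗ[Env K A] Env K A))

lemma dualObj_smul (P : ModuleCat.{v} (Env K A)) (x y : A) (f : P →ₗ[Env K A] Env K A) (m : P) :
    (show P →ₗ[Env K A] Env K A from
      (x ⊗ₜ MulOpposite.op y : Env K A) • (show dualObj K A P from f)) m =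
      f m * (y ⊗ₜ MulOpposite.op x) := by
  change (swapEnv K A (x ⊗ₜ MulOpposite.op y)) • f m = _
  rw [swapEnv_tmul]
  rfl

/-- The contravariant functor `Hom_{Aᵉ}(-, Aᵉ)` from `A`-bimodules to `A`-bimodules. -/
def dualFunctor : (ModuleCat.{v} (Env K A))ᵒᵖ ⥤ ModuleCat.{v} (Env K A) where
  obj P := dualObj K A P.unop
  map g := (ModuleCat.restrictScalars.{v} (swapEnv K A : Env K A →+* (Env K A)ᵐᵒᵖ)).map
    (ModuleCat.ofHom (LinearMap.lcomp (Env K A)ᵐᵒᵖ (Env K A) g.unop.hom))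

instance : (dualFunctor K A).Additive where
  map_add {X Y f g} := by
    ext φ
    refine LinearMap.ext fun x => ?_
    exact map_add (show X.unop →ₗ[Env K A] Env K A from φ) (f.unop.hom x) (g.unop.hom x)

/-- The complex `Hom_{Aᵉ}(P, Aᵉ)`, with `Hom_{Aᵉ}(P⁻ⁿ, Aᵉ)` in degree `n`. -/
def dualComplex (P : CochainComplex (ModuleCat.{v} (Env K A)) ℤ) :
    CochainComplex (ModuleCat.{v} (Env K A)) ℤ :=
  ((dualFunctor K A).mapHomologicalComplex (ComplexShape.up ℤ)).obj
    ((CochainComplex.opEquivalence (ModuleCat.{v} (Env K A))).functor.obj (Opposite.op P))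

/-- `RHom_{Aᵉ}(A, Aᵉ)` as an object of `D(Aᵉ)`: the complex `Hom_{Aᵉ}(P, Aᵉ)` for a projective
resolution `P` of the bimodule `A`. -/
def invDual [HasDerivedCategory.{w} (ModuleCat.{v} (Env K A))] :
    DerivedCategory (ModuleCat.{v} (Env K A)) :=
  DerivedCategory.Q.obj (dualComplex K A (projectiveResolution (diagBimod K A)).cochainComplex)

/-- The restriction functor `D(Aᵉ) ⥤ D(A)` to the left module structure. -/
def resLeft [HasDerivedCategory.{w₁} (ModuleCat.{v} A)]
    [HasDerivedCategory.{w} (ModuleCat.{v} (Env K A))] :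
    DerivedCategory (ModuleCat.{v} (Env K A)) ⥤ DerivedCategory (ModuleCat.{v} A) :=
  (ModuleCat.restrictScalars.{v}
    (Algebra.TensorProduct.includeLeft : A →ₐ[K] Env K A).toRingHom).mapDerivedCategory

/-- The restriction functor `D(Aᵉ) ⥤ D(Aᵒᵖ)` to the right module structure. -/
def resRight [HasDerivedCategory.{w₂} (ModuleCat.{v} Aᵐᵒᵖ)]
    [HasDerivedCategory.{w} (ModuleCat.{v} (Env K A))] :
    DerivedCategory (ModuleCat.{v} (Env K A)) ⥤ DerivedCategory (ModuleCat.{v} Aᵐᵒᵖ) :=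
  (ModuleCat.restrictScalars.{v}
    (Algebra.TensorProduct.includeRight : Aᵐᵒᵖ →ₐ[K] Env K A).toRingHom).mapDerivedCategory

end EnvelopingAlgebra

/-- `RHom_R(X, Y) = 0`: all the cohomology groups `Hom_{D(R)}(X, Y[n])` vanish. -/
def RHomVanishes {R : Type v} [Ring R] [HasDerivedCategory.{w} (ModuleCat.{v} R)]
    (X Y : DerivedCategory (ModuleCat.{v} R)) : Prop :=
  ∀ n : ℤ, Subsingleton (X ⟶ Y⟦n⟧)

/-- The algebra `A` is bimodule internally `d`-Calabi--Yau with respect to `e`. -/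
structure IsBimoduleInternallyCY (K : Type u) [Field K] {A : Type v} [Ring A] [Algebra K A]
    [HasDerivedCategory.{w₁} (ModuleCat.{v} A)] [HasDerivedCategory.{w₂} (ModuleCat.{v} Aᵐᵒᵖ)]
    [HasDerivedCategory.{w₃} (ModuleCat.{v} (Env K A))] (e : A) (d : ℕ) : Prop where
  projectiveDimension_le : projectiveDimension (diagBimod K A) ≤ d
  isPerfect : IsPerfect ((DerivedCategory.singleFunctor _ 0).obj (diagBimod K A))
  exists_triangle : ∃ (C : DerivedCategory (ModuleCat.{v} (Env K A)))
    (ψ : (DerivedCategory.singleFunctor _ 0).obj (diagBimod K A) ⟶ (invDual K A)⟦(d : ℤ)⟧)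
    (α : (invDual K A)⟦(d : ℤ)⟧ ⟶ C)
    (β : C ⟶ ((DerivedCategory.singleFunctor _ 0).obj (diagBimod K A))⟦(1 : ℤ)⟧),
    Pretriangulated.Triangle.mk ψ α β ∈ Pretriangulated.distinguishedTriangles ∧
    (∀ M : DerivedCategory (ModuleCat.{v} A), StabFD K e M →
      RHomVanishes ((resLeft K A).obj C) M) ∧
    (∀ N : DerivedCategory (ModuleCat.{v} Aᵐᵒᵖ), StabFD K (MulOpposite.op e) N →
      RHomVanishes ((resRight K A).obj C) N)

end
end BimodCY

/-!
For complexes of `A`-modules `N` and `M`, the complex `Hom_K(N, M)` of `K`-linear maps is a complex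
of bimodules. The duality rests on four facts about it.

* `Hom_{D(A)}(N, M) = Hom_{D(Aᵉ)}(A, Hom_K(N, M))` (`exists_natural_resUnit`). For a complex of
  bimodules `X` there is the adjunction `Hom(X, Hom_K(N, M)) = Hom_A(N, Hom_A(X, M))` (`swapHom`),
  compatible with homotopies. Since `K` is a field, `Hom_K(N, M)` is acyclic when `N` is, so
  `Hom_A(X, M)` is K-injective whenever `X` is K-projective (`rightHomCx_isKInjective`). A bounded
  above projective bimodule resolution `P` of `A` is homotopy equivalent to `A` over the left copy
  of `A`, so `M → Hom_A(P, M)` is a quasi-isomorphism (`quasiIso_coaug`). In particular every object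
  of `D(A)` has the K-injective representative `Hom_A(P, M)`.
* As `A` is perfect, `P` may be chosen bounded with finitely generated projective terms. Then
  `Hom_{D(Aᵉ)}(Ω_A, DY) = D Hom_{D(Aᵉ)}(A, Y)` for every complex of bimodules `Y`, where `Ω_A` is
  represented by `Hom_{Aᵉ}(P, Aᵉ)` (`exists_linearEquiv_dual`).
* If `M` has finite-dimensional total cohomology, then `D Hom_K(M, N)` and `Hom_K(N, M)` are
  isomorphic in `D(Aᵉ)`: both map by quasi-isomorphisms to `Hom_K(N, DDM)` (`quasiIso_kappa`,
  `quasiIso_homCxMap_evalDual`). This is proved with a decomposition of `M` over `K`, in which the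
  identity is homotopic to an operator of finite rank (`FiniteHodge`).
* The cone `C` of `A → Ω_A[d]` satisfies `Hom_{D(Aᵉ)}(C, Hom_K(N, M)[n]) = 0` for all `n` whenever
  `RHom_A(C, M) = 0` (`rHomVanishes_homCx`), because the adjunction turns morphisms from `C` into
  morphisms to the complex `Hom_A(C, M)`, which is acyclic. Hence `A` and `Ω_A[d]` have the same
  morphisms to the shifts of `Hom_K(N, M)` (`bijective_comp_shift`).

For `M` in `D_{fd, A/⟨e⟩}(A)` and arbitrary `N` these combine to

`D Hom_{D(A)}(M, N) = D Hom(A, Hom_K(M, N)) = Hom(Ω_A, D Hom_K(M, N)) = Hom(Ω_A, Hom_K(N, M))`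
`= Hom(A, Hom_K(N, M)[d]) = Hom_{D(A)}(N, M[d]) = Hom_{D(A)}(N[-d], M)`,

with the middle terms taken in `D(Aᵉ)` (`exists_duality_of_comparison`). All steps are natural for
morphisms of K-injective complexes, hence for all morphisms of `D(A)`
(`exists_duality_of_representatives`).

The ground field and `A` may live in different universes. Duals of bimodules are therefore taken
with values in a one-dimensional space `L` in the universe of `A`, with an isomorphism `ι : K ≃ L`.
The image of `K` in `A` serves as `L` if `A` is nontrivial; if `A` is trivial, then `D(A)` is zero.
-/

namespace BimodCY

open scoped ModuleCat

noncomputable section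

/-! ### Linear algebra over a field -/

section LinearAlgebra

variable {K : Type*} [Field K]

/-- Every linear map over a field has a generalized inverse. -/
lemma exists_generalizedInverse {V W : Type*} [AddCommGroup V] [Module K V] [AddCommGroup W]
    [Module K W] (f : V →ₗ[K] W) : ∃ g : W →ₗ[K] V, f ∘ₗ g ∘ₗ f = f := by
  obtain ⟨s, hs⟩ := f.rangeRestrict.exists_rightInverse_of_surjective f.range_rangeRestrict
  obtain ⟨g, hg⟩ := s.exists_extend
  refine ⟨g, LinearMap.ext fun x => ?_⟩
  have h1 : g (f x) = s (f.rangeRestrict x) := LinearMap.congr_fun hg (f.rangeRestrict x)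
  have h2 := congrArg Subtype.val (LinearMap.congr_fun hs (f.rangeRestrict x))
  simpa [h1] using h2

/-- A linear map that vanishes on the kernel of `f` factors through `f`. -/
lemma exists_comp_eq_of_ker_le {V W U : Type*} [AddCommGroup V] [Module K V] [AddCommGroup W]
    [Module K W] [AddCommGroup U] [Module K U] (f : V →ₗ[K] W) (l : V →ₗ[K] U)
    (h : ∀ x, f x = 0 → l x = 0) : ∃ m : W →ₗ[K] U, m ∘ₗ f = l := by
  obtain ⟨g, hg⟩ := exists_generalizedInverse f
  refine ⟨l ∘ₗ g, LinearMap.ext fun x => ?_⟩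
  have h1 := LinearMap.congr_fun hg x
  have h2 : f (g (f x) - x) = 0 := by simpa [sub_eq_zero] using h1
  simpa [sub_eq_zero] using h _ h2

/-- The Hodge decomposition of a complex over a field: the identity is homotopic to an idempotent
`π` ("harmonic projection") that is killed by the differential on both sides. -/
lemma exists_hodge {V : ℤ → Type*} [∀ i, AddCommGroup (V i)] [∀ i, Module K (V i)]
    (d : ∀ i j, V i →ₗ[K] V j) (hd : ∀ i j k (x : V i), d j k (d i j x) = 0) :
    ∃ (π : ∀ i, V i →ₗ[K] V i) (h : ∀ i j, V i →ₗ[K] V j),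
      (∀ i j x, i + 1 = j → d i j (π i x) = 0) ∧ (∀ i j x, i + 1 = j → π j (d i j x) = 0) ∧
      (∀ i x, π i (π i x) = π i x) ∧
      ∀ i j k x, i + 1 = j → j + 1 = k → x = π j x + d i j (h j i x) + h k j (d j k x) := by
  choose g hg using fun i j => exists_generalizedInverse (d i j)
  replace hg : ∀ i j x, d i j (g i j (d i j x)) = d i j x := fun i j x =>
    LinearMap.congr_fun (hg i j) x
  -- `e i = g d` is a projection along the cocycles, and `h = e g (1 - e)` is a generalized
  -- inverse of `d` with `h h = 0`
  let e : ∀ i, V i →ₗ[K] V i := fun i => g i (i + 1) ∘ₗ d i (i + 1)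
  have he : ∀ i j, i + 1 = j → ∀ x, e i x = g i j (d i j x) := by rintro i _ rfl x; rfl
  have hde : ∀ i j x, i + 1 = j → d i j (e i x) = d i j x := by
    rintro i _ x rfl; exact hg _ _ _
  have hed : ∀ i j x, e j (d i j x) = 0 := fun i j x => by simp [e, hd]
  have hee : ∀ i x, e i (e i x) = e i x := fun i x => by simp [e, hg]
  let h : ∀ i j, V i →ₗ[K] V j := fun i j => e j ∘ₗ g j i ∘ₗ (LinearMap.id - e i)
  have hdhd : ∀ i j x, i + 1 = j → d i j (h j i (d i j x)) = d i j x := by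
    intro i j x hij
    simp [h, hde _ _ _ hij, hed, hg]
  have hhh : ∀ i j k x, h j k (h i j x) = 0 := by
    intro i j k x
    simp [h, hee]
  let π : ∀ i, V i →ₗ[K] V i := fun i =>
    LinearMap.id - d (i - 1) i ∘ₗ h i (i - 1) - h (i + 1) i ∘ₗ d i (i + 1)
  have hπ : ∀ i j k x, i + 1 = j → j + 1 = k →
      π j x = x - d i j (h j i x) - h k j (d j k x) := by
    rintro i j _ x hij rfl
    obtain rfl : i = j - 1 := by omega
    rfl
  have hdπ : ∀ i j x, i + 1 = j → d i j (π i x) = 0 := by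
    rintro i j x hij
    rw [hπ (i - 1) i j x (by omega) hij]
    simp [hd, hdhd _ _ _ hij]
  refine ⟨π, h, hdπ, ?_, ?_, ?_⟩
  · rintro i j x hij
    rw [hπ i j (j + 1) _ hij rfl]
    simp [hd, hdhd _ _ _ hij]
  · intro i x
    have h1 := hdπ i (i + 1) x rfl
    have h2 : h i (i - 1) (π i x) = h i (i - 1) (x - d (i - 1) i (h i (i - 1) x)) := by
      rw [hπ (i - 1) i (i + 1) x (by omega) rfl, map_sub, hhh, sub_zero]
    have h3 : d (i - 1) i (h i (i - 1) (π i x)) = 0 := by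
      rw [h2, map_sub, map_sub, hdhd _ _ _ (by omega), sub_self]
    rw [hπ (i - 1) i (i + 1) (π i x) (by omega) rfl, h1, h3]
    simp
  · intro i j k x hij hjk
    rw [hπ i j k x hij hjk]
    abel

/-- Descent of a linear map with the right kernel and image along two surjections. -/
lemma exists_linearEquiv_of_surjective {V V' W W' : Type*} [AddCommGroup V] [Module K V]
    [AddCommGroup V'] [Module K V'] [AddCommGroup W] [Module K W] [AddCommGroup W'] [Module K W']
    (q : V →ₗ[K] V') (hq : Function.Surjective q) (r : W →ₗ[K] W') (f : V →ₗ[K] W)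
    (h : ∀ x, q x = 0 ↔ r (f x) = 0) (hs : ∀ y : W', ∃ x, r (f x) = y) :
    ∃ E : V' ≃ₗ[K] W', ∀ x, E (q x) = r (f x) := by
  obtain ⟨g, hg⟩ := exists_comp_eq_of_ker_le q (r ∘ₗ f) fun x hx => (h x).1 hx
  have hg' : ∀ x, g (q x) = r (f x) := LinearMap.congr_fun hg
  refine ⟨LinearEquiv.ofBijective g ⟨?_, fun y => ?_⟩, hg'⟩
  · rw [injective_iff_map_eq_zero]
    intro y hy
    obtain ⟨x, rfl⟩ := hq y
    rw [h, ← hg', hy]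
  · obtain ⟨x, hx⟩ := hs y
    exact ⟨q x, by rw [hg', hx]⟩

/-- Descent of a bilinear pairing to a duality between quotients. -/
lemma exists_linearEquiv_of_pairing {V V' W W' L : Type*} [AddCommGroup V] [Module K V]
    [AddCommGroup V'] [Module K V'] [AddCommGroup W] [Module K W] [AddCommGroup W'] [Module K W']
    [AddCommGroup L] [Module K L]
    (q : V →ₗ[K] V') (hq : Function.Surjective q) (r : W →ₗ[K] W') (hr : Function.Surjective r)
    (f : V →ₗ[K] W →ₗ[K] L) (h₀ : ∀ x y, r y = 0 → f x y = 0)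
    (h : ∀ x, q x = 0 ↔ f x = 0) (hs : ∀ l : W' →ₗ[K] L, ∃ x, f x = l ∘ₗ r) :
    ∃ E : V' ≃ₗ[K] (W' →ₗ[K] L), ∀ x y, E (q x) (r y) = f x y := by
  obtain ⟨s, hrs⟩ := r.exists_rightInverse_of_surjective (LinearMap.range_eq_top.2 hr)
  have hs' : ∀ x y, f x (s (r y)) = f x y := fun x y => by
    have : r (s (r y) - y) = 0 := by
      have := LinearMap.congr_fun hrs (r y)
      simpa [sub_eq_zero] using this
    simpa [sub_eq_zero] using h₀ x _ this
  obtain ⟨E, hE⟩ := exists_linearEquiv_of_surjective q hq LinearMap.id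
    ((LinearMap.lcomp K L s) ∘ₗ f) (fun x => by
      rw [h]
      refine ⟨fun hx => by ext; simp [hx], fun hx => LinearMap.ext fun y => ?_⟩
      have := LinearMap.congr_fun hx (r y)
      simpa [hs'] using this) (fun l => by
      obtain ⟨x, hx⟩ := hs l
      refine ⟨x, LinearMap.ext fun y => ?_⟩
      change f x (s y) = l y
      rw [hx]
      exact congrArg l (LinearMap.congr_fun hrs y))
  exact ⟨E, fun x y => by rw [hE]; exact hs' x y⟩

end LinearAlgebra

/-! ### Signs -/

/-- The sign `(-1)^(n(n-1)/2)`, which absorbs a factor `(-1)^n` when `n` increases by one. It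
compares a dual complex without signs with a `Hom` complex. -/
def triSign (n : ℤ) : ℤˣ := (n * (n - 1) / 2).negOnePow

lemma triSign_succ (n : ℤ) : triSign (n + 1) = n.negOnePow * triSign n := by
  rw [triSign, triSign, ← Int.negOnePow_add]
  congr 1
  have : (n + 1) * (n + 1 - 1) = n * (n - 1) + n * 2 := by ring
  rw [this, Int.add_mul_ediv_right _ _ (by norm_num), add_comm]

/-! ### The complex of `K`-linear maps between complexes of `A`-modules -/

section Elements

variable {R : Type v} [Ring R] {F G : CochainComplex (ModuleCat.{v} R) ℤ}

lemma hom_d_d (F : CochainComplex (ModuleCat.{v} R) ℤ) (i j k : ℤ) (x : F.X i) :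
    (F.d j k).hom ((F.d i j).hom x) = 0 := by
  have := congrArg (fun f => f.hom x) (F.d_comp_d i j k)
  exact this

lemma hom_comm (f : F ⟶ G) (i j : ℤ) (x : F.X i) :
    (G.d i j).hom ((f.f i).hom x) = (f.f j).hom ((F.d i j).hom x) := by
  have := congrArg (fun f => f.hom x) (f.comm i j)
  exact this

end Elements

section Enveloping

variable {K : Type u} [Field K] {A : Type v} [Ring A] [Algebra K A]

/-- An additive map between `Aᵉ`-modules that commutes with the action of the pure tensors on an
element commutes with the action of all of `Aᵉ` on it. -/
lemma env_smul_induction {V W : Type*} [AddCommGroup V] [AddCommGroup W] [Module (Env K A) V]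
    [Module (Env K A) W] (f : V →+ W) (v : V)
    (h : ∀ x y : A, f ((x ⊗ₜ MulOpposite.op y : Env K A) • v) =
      (x ⊗ₜ MulOpposite.op y : Env K A) • f v) (b : Env K A) : f (b • v) = b • f v := by
  induction b using TensorProduct.induction_on with
  | zero =>
    exact (congrArg f (zero_smul (Env K A) v)).trans
      ((map_zero f).trans (zero_smul (Env K A) (f v)).symm)
  | tmul x y => exact h x y.unop
  | add a b ha hb => simp only [add_smul, map_add, ha, hb]

section

variable (K A) (V W : Type v) [AddCommGroup V] [Module A V] [Module K V] [IsScalarTower K A V]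
  [AddCommGroup W] [Module A W] [Module K W] [IsScalarTower K A W]

/-- The left action of `A` on `Hom_K(V, W)` through `W`. -/
def homLeftAction : A →ₐ[K] Module.End K (V →ₗ[K] W) :=
  AlgHom.ofLinearMap
    { toFun := fun a => LinearMap.compRight K (Algebra.lsmul K K W a)
      map_add' := fun a b => by ext; simp
      map_smul' := fun a b => by ext; simp }
    (by ext; simp) (fun a b => by ext; simp)

/-- The right action of `A` on `Hom_K(V, W)` through `V`. -/
def homRightAction : Aᵐᵒᵖ →ₐ[K] Module.End K (V →ₗ[K] W) :=
  AlgHom.ofLinearMap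
    { toFun := fun a => LinearMap.lcomp K W (Algebra.lsmul K K V a.unop)
      map_add' := fun a b => by ext; simp
      map_smul' := fun a b => by ext; simp }
    (by ext; simp) (fun a b => by ext; simp)

lemma homAction_commute (a : A) (b : Aᵐᵒᵖ) :
    Commute (homLeftAction K A V W a) (homRightAction K A V W b) := rfl

/-- The action of `Aᵉ` on `Hom_K(V, W)`: `x ⊗ y` sends `f` to `m ↦ x • f (y • m)`. -/
def homAction : Env K A →ₐ[K] Module.End K (V →ₗ[K] W) :=
  Algebra.TensorProduct.lift (homLeftAction K A V W) (homRightAction K A V W)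
    (homAction_commute K A V W)

/-- `Hom_K(V, W)` as an `A`-bimodule. -/
instance homBimodule : Module (Env K A) (V →ₗ[K] W) :=
  Module.compHom _ (homAction K A V W).toRingHom

variable {K A V W}

@[simp]
lemma tmul_smul_hom (x : A) (y : Aᵐᵒᵖ) (f : V →ₗ[K] W) (m : V) :
    ((x ⊗ₜ y : Env K A) • f) m = x • f (y.unop • m) := by
  change (homAction K A V W (x ⊗ₜ y) f) m = _
  rw [homAction, Algebra.TensorProduct.lift_tmul]
  rfl

instance : IsScalarTower K (Env K A) (V →ₗ[K] W) where
  smul_assoc k b f := by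
    change homAction K A V W (k • b) f = k • homAction K A V W b f
    rw [map_smul]; rfl

end

/-- Cochains of degree `n` between two complexes of `A`-modules: families of `K`-linear maps. -/
def LC (K : Type u) [Field K] {A : Type v} [Ring A] [Algebra K A]
    (N M : CochainComplex (ModuleCat.{v} A) ℤ) (n : ℤ) : Type v :=
  ∀ T : CochainComplex.HomComplex.Triplet n, (N.X T.p →ₗ[K] M.X T.q)

namespace LC

variable {N M N' M' : CochainComplex (ModuleCat.{v} A) ℤ} {n m : ℤ}

instance : AddCommGroup (LC K N M n) :=
  inferInstanceAs (AddCommGroup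
    (∀ T : CochainComplex.HomComplex.Triplet n, (N.X T.p →ₗ[K] M.X T.q)))

instance : Module K (LC K N M n) :=
  inferInstanceAs (Module K (∀ T : CochainComplex.HomComplex.Triplet n, (N.X T.p →ₗ[K] M.X T.q)))

instance : Module (Env K A) (LC K N M n) :=
  inferInstanceAs (Module (Env K A)
    (∀ T : CochainComplex.HomComplex.Triplet n, (N.X T.p →ₗ[K] M.X T.q)))

instance : IsScalarTower K (Env K A) (LC K N M n) :=
  ⟨fun k b z => funext fun T => smul_assoc k b (z T)⟩

/-- The components of a cochain. -/
def v (z : LC K N M n) (p q : ℤ) (h : p + n = q) : N.X p →ₗ[K] M.X q := z ⟨p, q, h⟩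

/-- The cochain with given components. -/
def mk (f : ∀ p q : ℤ, p + n = q → (N.X p →ₗ[K] M.X q)) : LC K N M n := fun T => f T.p T.q T.hpq

@[simp] lemma mk_v (f : ∀ p q : ℤ, p + n = q → (N.X p →ₗ[K] M.X q)) (p q : ℤ) (h : p + n = q) :
    (mk f).v p q h = f p q h := rfl

@[ext]
lemma ext {z z' : LC K N M n} (h : ∀ p q hpq x, z.v p q hpq x = z'.v p q hpq x) : z = z' :=
  funext fun T => LinearMap.ext (h T.p T.q T.hpq)

@[simp] lemma add_v (z z' : LC K N M n) (p q : ℤ) (h : p + n = q) :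
    (z + z').v p q h = z.v p q h + z'.v p q h := rfl

@[simp] lemma sub_v (z z' : LC K N M n) (p q : ℤ) (h : p + n = q) :
    (z - z').v p q h = z.v p q h - z'.v p q h := rfl

@[simp] lemma zero_v (p q : ℤ) (h : p + n = q) : (0 : LC K N M n).v p q h = 0 := rfl

@[simp] lemma smul_v (k : K) (z : LC K N M n) (p q : ℤ) (h : p + n = q) :
    (k • z).v p q h = k • z.v p q h := rfl

@[simp] lemma env_smul_v (b : Env K A) (z : LC K N M n) (p q : ℤ) (h : p + n = q) :
    (b • z).v p q h = b • z.v p q h := rfl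

variable (K) in
/-- The differential of a complex of `A`-modules, as a `K`-linear map. -/
def diff (N : CochainComplex (ModuleCat.{v} A) ℤ) (p q : ℤ) : N.X p →ₗ[K] N.X q :=
  (N.d p q).hom.restrictScalars K

lemma comp_env_smul {V W U : Type v} [AddCommGroup V] [Module A V] [Module K V]
    [IsScalarTower K A V] [AddCommGroup W] [Module A W] [Module K W] [IsScalarTower K A W]
    [AddCommGroup U] [Module A U] [Module K U] [IsScalarTower K A U]
    (g : W →ₗ[A] U) (b : Env K A) (f : V →ₗ[K] W) :
    g.restrictScalars K ∘ₗ (b • f) = b • (g.restrictScalars K ∘ₗ f) :=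
  env_smul_induction (LinearMap.compRight K (g.restrictScalars K)).toAddMonoidHom f
    (fun x y => by ext m; simp) b

lemma env_smul_comp {V W U : Type v} [AddCommGroup V] [Module A V] [Module K V]
    [IsScalarTower K A V] [AddCommGroup W] [Module A W] [Module K W] [IsScalarTower K A W]
    [AddCommGroup U] [Module A U] [Module K U] [IsScalarTower K A U]
    (g : V →ₗ[A] W) (b : Env K A) (f : W →ₗ[K] U) :
    (b • f) ∘ₗ g.restrictScalars K = b • (f ∘ₗ g.restrictScalars K) :=
  env_smul_induction (LinearMap.lcomp K U (g.restrictScalars K)).toAddMonoidHom f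
    (fun x y => by ext m; simp) b

/-- The differential of the complex of `K`-linear maps. -/
def δ (h : n + 1 = m) : LC K N M n →ₗ[Env K A] LC K N M m where
  toFun z := mk fun p q hpq => diff K M (p + n) q ∘ₗ z.v p (p + n) rfl +
    (m.negOnePow : ℤ) • (z.v (p + 1) q (by omega) ∘ₗ diff K N p (p + 1))
  map_add' z z' := by
    ext p q hpq x
    simp only [mk_v, add_v, LinearMap.add_apply, LinearMap.comp_apply, map_add,
      LinearMap.smul_apply, smul_add]
    abel
  map_smul' b z := by
    refine funext fun T => ?_
    change diff K M _ _ ∘ₗ (b • z).v _ _ _ + (m.negOnePow : ℤ) • ((b • z).v _ _ _ ∘ₗ diff K N _ _) =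
      b • (diff K M _ _ ∘ₗ z.v _ _ _ + (m.negOnePow : ℤ) • (z.v _ _ _ ∘ₗ diff K N _ _))
    rw [env_smul_v, env_smul_v, diff, diff, comp_env_smul, env_smul_comp, smul_add,
      smul_comm b (m.negOnePow : ℤ)]

lemma δ_v (h : n + 1 = m) (z : LC K N M n) (p q : ℤ) (hpq : p + m = q) (p' q' : ℤ)
    (hp : p + 1 = p') (hq : q' + 1 = q) (x : N.X p) :
    (δ h z).v p q hpq x = (M.d q' q).hom (z.v p q' (by omega) x) +
      (m.negOnePow : ℤ) • z.v p' q (by omega) ((N.d p p').hom x) := by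
  obtain rfl : q' = p + n := by omega
  subst hp
  rfl

lemma δ_δ {k : ℤ} (h : n + 1 = m) (h' : m + 1 = k) (z : LC K N M n) : δ h' (δ h z) = 0 := by
  ext p q hpq x
  rw [δ_v h' _ p q hpq (p + 1) (q - 1) rfl (by omega),
    δ_v h _ p (q - 1) _ (p + 1) (q - 1 - 1) rfl (by omega),
    δ_v h _ (p + 1) q _ (p + 1 + 1) (q - 1) rfl (by omega), map_add, hom_d_d, hom_d_d, map_zsmul,
    map_zero, smul_zero, add_zero, zero_add]
  have : (k.negOnePow : ℤ) = -(m.negOnePow : ℤ) := by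
    rw [← h', Int.negOnePow_succ, Units.val_neg]
  rw [this, neg_smul, add_neg_cancel]
  rfl

end LC

end Enveloping

section MkComplex

variable {R : Type v} [Ring R]

/-- The cochain complex of `R`-modules given by its terms and differentials. -/
abbrev mkComplex (X : ℤ → Type v) [∀ n, AddCommGroup (X n)] [∀ n, Module R (X n)]
    (δ : ∀ n m, n + 1 = m → (X n →ₗ[R] X m))
    (hδ : ∀ n m k (h : n + 1 = m) (h' : m + 1 = k) x, δ m k h' (δ n m h x) = 0) :
    CochainComplex (ModuleCat.{v} R) ℤ where
  X n := ModuleCat.of R (X n)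
  d i j := if h : i + 1 = j then ModuleCat.ofHom (δ i j h) else 0
  shape i j h := dif_neg h
  d_comp_d' i j k h h' := by
    rw [dif_pos (show i + 1 = j from h), dif_pos (show j + 1 = k from h'), ← ModuleCat.ofHom_comp]
    exact ModuleCat.hom_ext (LinearMap.ext (hδ i j k h h'))

lemma mkComplex_d (X : ℤ → Type v) [∀ n, AddCommGroup (X n)] [∀ n, Module R (X n)]
    (δ : ∀ n m, n + 1 = m → (X n →ₗ[R] X m))
    (hδ : ∀ n m k (h : n + 1 = m) (h' : m + 1 = k) x, δ m k h' (δ n m h x) = 0)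
    (i j : ℤ) (h : i + 1 = j) :
    ((mkComplex X δ hδ).d i j).hom = δ i j h := by
  have : (mkComplex X δ hδ).d i j = ModuleCat.ofHom (δ i j h) := dif_pos h
  rw [this]
  rfl

/-- A morphism of complexes of modules given by linear maps commuting with the differentials. -/
def mkHom {F G : CochainComplex (ModuleCat.{v} R) ℤ} (f : ∀ n, F.X n →ₗ[R] G.X n)
    (h : ∀ i j, i + 1 = j → ∀ x, (G.d i j).hom (f i x) = f j ((F.d i j).hom x)) : F ⟶ G where
  f n := ModuleCat.ofHom (f n)
  comm' i j hij := ModuleCat.hom_ext (LinearMap.ext (h i j hij))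

/-- A null-homotopy given elementwise. -/
def mkHomotopyZero {F G : CochainComplex (ModuleCat.{v} R) ℤ} (f : F ⟶ G)
    (h : ∀ i j, j + 1 = i → (F.X i →ₗ[R] G.X j))
    (H : ∀ i j k (hij : i + 1 = j) (hjk : j + 1 = k) x, (f.f j).hom x =
      (G.d i j).hom (h j i hij x) + h k j hjk ((F.d j k).hom x)) : Homotopy f 0 where
  hom i j := if hij : j + 1 = i then ModuleCat.ofHom (h i j hij) else 0
  zero i j hij := dif_neg hij
  comm j := by
    rw [dNext_eq _ (show (ComplexShape.up ℤ).Rel j (j + 1) from rfl),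
      prevD_eq _ (show (ComplexShape.up ℤ).Rel (j - 1) j from sub_add_cancel j 1),
      dif_pos rfl, dif_pos (sub_add_cancel j 1)]
    ext x
    refine (H (j - 1) j (j + 1) (by omega) rfl x).trans ?_
    rw [add_comm]
    simp

/-- A null-homotopy in terms of elements. -/
lemma homotopyZero_apply {F G : CochainComplex (ModuleCat.{v} R) ℤ} {f : F ⟶ G}
    (h : Homotopy f 0) (i j k : ℤ) (hij : i + 1 = j) (hjk : j + 1 = k) (x : F.X j) :
    (f.f j).hom x = (G.d i j).hom ((h.hom j i).hom x) + (h.hom k j).hom ((F.d j k).hom x) := by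
  have := h.comm j
  rw [dNext_eq _ (show (ComplexShape.up ℤ).Rel j k from hjk),
    prevD_eq _ (show (ComplexShape.up ℤ).Rel i j from hij)] at this
  rw [this]
  refine Eq.trans ?_ (add_comm _ _)
  simp

end MkComplex

section Enveloping

variable {K : Type u} [Field K] {A : Type v} [Ring A] [Algebra K A]

variable (K) in
/-- The complex `Hom_K(N, M)` of `A`-bimodules. -/
abbrev homCx (N M : CochainComplex (ModuleCat.{v} A) ℤ) :
    CochainComplex (ModuleCat.{v} (Env K A)) ℤ :=
  mkComplex (LC K N M) (fun _ _ h => LC.δ h) (fun _ _ _ h h' z => LC.δ_δ h h' z)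

lemma homCx_d (N M : CochainComplex (ModuleCat.{v} A) ℤ) (i j : ℤ) (h : i + 1 = j)
    (z : LC K N M i) : ((homCx K N M).d i j).hom z = LC.δ h z :=
  LinearMap.congr_fun (mkComplex_d (LC K N M) _ _ i j h) z

/-- Functoriality of cochains in both arguments. -/
def LC.map {N M N' M' : CochainComplex (ModuleCat.{v} A) ℤ} (f : N' ⟶ N) (g : M ⟶ M') (n : ℤ) :
    LC K N M n →ₗ[Env K A] LC K N' M' n where
  toFun z := LC.mk fun p q h =>
    (g.f q).hom.restrictScalars K ∘ₗ z.v p q h ∘ₗ (f.f p).hom.restrictScalars K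
  map_add' z z' := LC.ext fun p q h x => map_add (g.f q).hom _ _
  map_smul' b z := by
    refine funext fun T => ?_
    change (g.f T.q).hom.restrictScalars K ∘ₗ
      ((b • z).v T.p T.q T.hpq ∘ₗ (f.f T.p).hom.restrictScalars K) = _
    rw [LC.env_smul_v, LC.env_smul_comp, LC.comp_env_smul]
    rfl

lemma LC.map_v {N M N' M' : CochainComplex (ModuleCat.{v} A) ℤ} (f : N' ⟶ N) (g : M ⟶ M') (n : ℤ)
    (z : LC K N M n) (p q : ℤ) (h : p + n = q) (x : N'.X p) :
    (LC.map f g n z).v p q h x = (g.f q).hom (z.v p q h ((f.f p).hom x)) := rfl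

lemma LC.δ_map {N M N' M' : CochainComplex (ModuleCat.{v} A) ℤ} (f : N' ⟶ N) (g : M ⟶ M')
    {n m : ℤ} (h : n + 1 = m) (z : LC K N M n) :
    LC.δ h (LC.map f g n z) = LC.map f g m (LC.δ h z) := by
  refine LC.ext fun p q hpq x => ?_
  rw [LC.δ_v h _ p q hpq (p + 1) (q - 1) rfl (by omega), LC.map_v, LC.map_v, LC.map_v,
    LC.δ_v h _ p q hpq (p + 1) (q - 1) rfl (by omega), map_add, map_zsmul, hom_comm, ← hom_comm,
    hom_comm f]

section

variable {N M N' M' N'' M'' : CochainComplex (ModuleCat.{v} A) ℤ}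

variable (K) in
/-- Functoriality of `Hom_K(N, M)` in both arguments. -/
def homCxMap (f : N' ⟶ N) (g : M ⟶ M') : homCx K N M ⟶ homCx K N' M' :=
  mkHom (F := homCx K N M) (G := homCx K N' M') (fun n => LC.map f g n) fun i j hij z => by
    rw [homCx_d _ _ _ _ hij, homCx_d _ _ _ _ hij]
    exact LC.δ_map f g hij z

lemma homCxMap_f (f : N' ⟶ N) (g : M ⟶ M') (n : ℤ) (z : LC K N M n) :
    ((homCxMap K f g).f n).hom z = LC.map f g n z := rfl

lemma homCxMap_comp (f : N' ⟶ N) (g : M ⟶ M') (f' : N'' ⟶ N') (g' : M' ⟶ M'') :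
    homCxMap K f g ≫ homCxMap K f' g' = homCxMap K (f' ≫ f) (g ≫ g') := rfl

end

/-! ### Duals over the ground field -/

section Dual

variable (L : Type v) [AddCommGroup L] [Module K L]

/-- The `K`-dual (with values in `L`) of a bimodule, again a bimodule by exchanging the two
tensor factors of `Aᵉ`. -/
instance dualBimodule (V : Type v) [AddCommGroup V] [Module (Env K A) V] [Module K V]
    [IsScalarTower K (Env K A) V] : Module (Env K A) (V →ₗ[K] L) where
  smul b l := l ∘ₗ Algebra.lsmul K K V (swapEnv K A b).unop
  one_smul l := LinearMap.ext fun x => by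
    change l ((swapEnv K A 1).unop • x) = l x
    simp
  mul_smul b c l := LinearMap.ext fun x => by
    change l ((swapEnv K A (b * c)).unop • x) =
      l ((swapEnv K A c).unop • (swapEnv K A b).unop • x)
    rw [map_mul, MulOpposite.unop_mul, mul_smul]
  smul_zero b := rfl
  smul_add b l l' := rfl
  add_smul b c l := LinearMap.ext fun x => by
    change l ((swapEnv K A (b + c)).unop • x) =
      l ((swapEnv K A b).unop • x) + l ((swapEnv K A c).unop • x)
    rw [map_add, MulOpposite.unop_add, add_smul, map_add]
  zero_smul l := LinearMap.ext fun x => by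
    change l ((swapEnv K A 0).unop • x) = 0
    rw [map_zero, MulOpposite.unop_zero]
    exact (congrArg l (zero_smul (Env K A) x)).trans (map_zero l)

lemma env_smul_dual_apply {L} [AddCommGroup L] [Module K L] {V : Type v} [AddCommGroup V]
    [Module (Env K A) V] [Module K V] [IsScalarTower K (Env K A) V] (b : Env K A) (l : V →ₗ[K] L)
    (x : V) : (b • l) x = l ((swapEnv K A b).unop • x) := rfl

lemma tmul_smul_dual_apply {L} [AddCommGroup L] [Module K L] {V : Type v} [AddCommGroup V]
    [Module (Env K A) V] [Module K V] [IsScalarTower K (Env K A) V] (x y : A) (l : V →ₗ[K] L)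
    (m : V) : ((x ⊗ₜ MulOpposite.op y : Env K A) • l) m =
      l ((y ⊗ₜ MulOpposite.op x : Env K A) • m) := by
  rw [env_smul_dual_apply, swapEnv_tmul]
  rfl

variable (K) in
/-- The transpose of a morphism of bimodules. -/
def transpose {V W : ModuleCat.{v} (Env K A)} (f : V ⟶ W) :
    (W →ₗ[K] L) →ₗ[Env K A] (V →ₗ[K] L) where
  toFun l := l ∘ₗ f.hom.restrictScalars K
  map_add' _ _ := rfl
  map_smul' _ l := LinearMap.ext fun x => congrArg l (f.hom.map_smul _ x).symm

lemma transpose_apply {L} [AddCommGroup L] [Module K L] {V W : ModuleCat.{v} (Env K A)} (f : V ⟶ W)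
    (l : W →ₗ[K] L) (x : V) : transpose K L f l x = l (f.hom x) := rfl

variable (K) in
/-- The `K`-dual of a complex of bimodules, with `D(Y⁻ⁿ)` in degree `n` and no signs. -/
abbrev dualCx (Y : CochainComplex (ModuleCat.{v} (Env K A)) ℤ) :
    CochainComplex (ModuleCat.{v} (Env K A)) ℤ :=
  mkComplex (fun n => Y.X (-n) →ₗ[K] L)
    (fun n m _ => transpose K L (Y.d (-m) (-n)))
    (fun n m k _ _ l => LinearMap.ext fun x =>
      (congrArg l (hom_d_d Y (-k) (-m) (-n) x)).trans (map_zero l))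

lemma dualCx_d (Y : CochainComplex (ModuleCat.{v} (Env K A)) ℤ) (i j : ℤ) (h : i + 1 = j)
    (l : Y.X (-i) →ₗ[K] L) :
    ((dualCx K L Y).d i j).hom l = transpose K L (Y.d (-j) (-i)) l :=
  LinearMap.congr_fun (mkComplex_d (fun n => Y.X (-n) →ₗ[K] L) _ _ i j h) l

variable (K) in
/-- Functoriality of the dual complex. -/
def dualCxMap {Y Y' : CochainComplex (ModuleCat.{v} (Env K A)) ℤ} (f : Y ⟶ Y') :
    dualCx K L Y' ⟶ dualCx K L Y :=
  mkHom (F := dualCx K L Y') (G := dualCx K L Y) (fun n => transpose K L (f.f (-n)))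
    (fun i j hij l => by
      rw [dualCx_d L _ _ _ hij, dualCx_d L _ _ _ hij]
      refine LinearMap.ext fun x => ?_
      simp only [transpose_apply, hom_comm])

/-- The double `K`-dual of an `A`-module is an `A`-module. -/
instance doubleDualModule (V : Type v) [AddCommGroup V] [Module A V] [Module K V]
    [IsScalarTower K A V] : Module A ((V →ₗ[K] L) →ₗ[K] L) where
  smul a s := s ∘ₗ LinearMap.lcomp K L (Algebra.lsmul K K V a)
  one_smul s := LinearMap.ext fun l => congrArg s (LinearMap.ext fun x => congrArg l (one_smul A x))
  mul_smul a b s := LinearMap.ext fun l =>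
    congrArg s (LinearMap.ext fun x => congrArg l (mul_smul a b x))
  smul_zero a := rfl
  smul_add a s s' := rfl
  add_smul a b s := LinearMap.ext fun l => by
    refine Eq.trans (congrArg s (LinearMap.ext fun x => ?_)) (map_add s _ _)
    exact (congrArg l (add_smul a b x)).trans (map_add l _ _)
  zero_smul s := LinearMap.ext fun l => by
    refine Eq.trans (congrArg s (LinearMap.ext fun x => ?_)) (map_zero s)
    exact (congrArg l (zero_smul A x)).trans (map_zero l)

instance (V : Type v) [AddCommGroup V] [Module A V] [Module K V]
    [IsScalarTower K A V] : IsScalarTower K A ((V →ₗ[K] L) →ₗ[K] L) where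
  smul_assoc k a s := LinearMap.ext fun l => by
    refine Eq.trans (congrArg s (LinearMap.ext fun x => ?_)) (map_smul s k _)
    exact (congrArg l (smul_assoc k a x)).trans (map_smul l _ _)

variable (K) in
/-- The double transpose of a morphism of `A`-modules. -/
def doubleTranspose {V W : ModuleCat.{v} A} (f : V ⟶ W) :
    ((V →ₗ[K] L) →ₗ[K] L) →ₗ[A] ((W →ₗ[K] L) →ₗ[K] L) where
  toFun s := s ∘ₗ LinearMap.lcomp K L (f.hom.restrictScalars K)
  map_add' _ _ := rfl
  map_smul' a s := LinearMap.ext fun l =>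
    congrArg s (LinearMap.ext fun x => congrArg l (f.hom.map_smul a x))

variable (K) in
/-- The degreewise double `K`-dual of a complex of `A`-modules. -/
abbrev doubleDualCx (M : CochainComplex (ModuleCat.{v} A) ℤ) :
    CochainComplex (ModuleCat.{v} A) ℤ :=
  mkComplex (fun n => (M.X n →ₗ[K] L) →ₗ[K] L)
    (fun n m _ => doubleTranspose K L (M.d n m))
    (fun n m k _ _ s => LinearMap.ext fun l => by
      refine Eq.trans (congrArg s (LinearMap.ext fun x => ?_)) (map_zero s)
      exact (congrArg l (hom_d_d M n m k x)).trans (map_zero l))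

lemma doubleDualCx_d (M : CochainComplex (ModuleCat.{v} A) ℤ) (i j : ℤ) (h : i + 1 = j)
    (s : (M.X i →ₗ[K] L) →ₗ[K] L) :
    ((doubleDualCx K L M).d i j).hom s = doubleTranspose K L (M.d i j) s :=
  LinearMap.congr_fun (mkComplex_d (fun n => (M.X n →ₗ[K] L) →ₗ[K] L) _ _ i j h) s

variable (K) in
/-- Functoriality of the double dual. -/
def doubleDualMap {M M' : CochainComplex (ModuleCat.{v} A) ℤ} (f : M ⟶ M') :
    doubleDualCx K L M ⟶ doubleDualCx K L M' :=
  mkHom (F := doubleDualCx K L M) (G := doubleDualCx K L M')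
    (fun n => doubleTranspose K L (f.f n))
    (fun i j hij s => by
      rw [doubleDualCx_d L _ _ _ hij, doubleDualCx_d L _ _ _ hij]
      refine LinearMap.ext fun l => congrArg s (LinearMap.ext fun x => ?_)
      exact congrArg l (hom_comm f i j x))

variable (K) in
/-- The evaluation map of an `A`-module to its double dual. -/
def evalDouble (V : ModuleCat.{v} A) : V →ₗ[A] ((V →ₗ[K] L) →ₗ[K] L) where
  toFun x := LinearMap.applyₗ x
  map_add' x y := LinearMap.ext fun l => map_add l x y
  map_smul' _ _ := rfl

variable (K) in
/-- The evaluation map to the double dual. -/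
def evalDual (M : CochainComplex (ModuleCat.{v} A) ℤ) : M ⟶ doubleDualCx K L M :=
  mkHom (F := M) (G := doubleDualCx K L M) (fun n => evalDouble K L (M.X n))
    (fun i j hij _ => doubleDualCx_d L M i j hij _)

end Dual

/-! ### The complex of `A`-linear maps out of a complex of bimodules -/

section RightHom

/-- The left `A`-module underlying a bimodule. -/
instance leftModule (V : ModuleCat.{v} (Env K A)) : Module A V :=
  Module.compHom V (Algebra.TensorProduct.includeLeft : A →ₐ[K] Env K A).toRingHom

lemma leftModule_smul (V : ModuleCat.{v} (Env K A)) (a : A) (x : V) :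
    a • x = (a ⊗ₜ MulOpposite.op 1 : Env K A) • x := rfl

/-- Right multiplication by an element of `A` on a bimodule. -/
def rightMul (V : ModuleCat.{v} (Env K A)) (b : A) : V →ₗ[A] V where
  toFun x := ((1 : A) ⊗ₜ MulOpposite.op b : Env K A) • x
  map_add' x y := smul_add _ x y
  map_smul' a x := by
    simp only [leftModule_smul, smul_smul, RingHom.id_apply]
    simp

lemma rightMul_apply (V : ModuleCat.{v} (Env K A)) (b : A) (x : V) :
    rightMul V b x = ((1 : A) ⊗ₜ MulOpposite.op b : Env K A) • x := rfl

lemma tmul_smul_eq (V : ModuleCat.{v} (Env K A)) (a b : A) (x : V) :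
    (a ⊗ₜ MulOpposite.op b : Env K A) • x = a • rightMul V b x := by
  rw [rightMul_apply, leftModule_smul, smul_smul]
  simp

/-- The left `A`-module of left `A`-linear maps out of a bimodule. -/
instance linearHomModule (V : ModuleCat.{v} (Env K A)) (W : Type v) [AddCommGroup W] [Module A W] :
    Module A (V →ₗ[A] W) where
  smul b f := f ∘ₗ rightMul V b
  one_smul f := LinearMap.ext fun x => congrArg f (one_smul (Env K A) x)
  mul_smul a b f := LinearMap.ext fun x => congrArg f (by
    simp only [rightMul_apply, smul_smul]
    simp)
  smul_zero b := rfl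
  smul_add b f g := rfl
  add_smul a b f := LinearMap.ext fun x => by
    refine Eq.trans (congrArg f ?_) (map_add f _ _)
    rw [rightMul_apply, MulOpposite.op_add, TensorProduct.tmul_add, add_smul]
    rfl
  zero_smul f := LinearMap.ext fun x => by
    refine Eq.trans (congrArg f ?_) (map_zero f)
    rw [rightMul_apply, MulOpposite.op_zero, TensorProduct.tmul_zero]
    exact zero_smul (Env K A) x

lemma smul_linearHom_apply (V : ModuleCat.{v} (Env K A)) (W : Type v) [AddCommGroup W] [Module A W]
    (b : A) (f : V →ₗ[A] W) (x : V) : (b • f) x = f (rightMul V b x) := rfl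

/-- Cochains of degree `n` from a complex of bimodules to a complex of `A`-modules: families of
left `A`-linear maps. -/
def RC (X : CochainComplex (ModuleCat.{v} (Env K A)) ℤ) (M : CochainComplex (ModuleCat.{v} A) ℤ)
    (n : ℤ) : Type v :=
  ∀ T : CochainComplex.HomComplex.Triplet n, (X.X T.p →ₗ[A] M.X T.q)

/-- A morphism of bimodules is left `A`-linear. -/
def leftLinear {V W : ModuleCat.{v} (Env K A)} (f : V ⟶ W) : V →ₗ[A] W where
  toFun := f.hom
  map_add' := map_add f.hom
  map_smul' _ x := map_smul f.hom _ x

namespace RC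

variable {X : CochainComplex (ModuleCat.{v} (Env K A)) ℤ}
  {M : CochainComplex (ModuleCat.{v} A) ℤ} {n m : ℤ}

instance : AddCommGroup (RC X M n) :=
  inferInstanceAs (AddCommGroup
    (∀ T : CochainComplex.HomComplex.Triplet n, (X.X T.p →ₗ[A] M.X T.q)))

instance : Module A (RC X M n) :=
  inferInstanceAs (Module A
    (∀ T : CochainComplex.HomComplex.Triplet n, (X.X T.p →ₗ[A] M.X T.q)))

/-- The components of a cochain. -/
def v (z : RC X M n) (p q : ℤ) (h : p + n = q) : X.X p →ₗ[A] M.X q := z ⟨p, q, h⟩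

/-- The cochain with given components. -/
def mk (f : ∀ p q : ℤ, p + n = q → (X.X p →ₗ[A] M.X q)) : RC X M n := fun T => f T.p T.q T.hpq

@[simp] lemma mk_v (f : ∀ p q : ℤ, p + n = q → (X.X p →ₗ[A] M.X q)) (p q : ℤ) (h : p + n = q) :
    (mk f).v p q h = f p q h := rfl

@[ext]
lemma ext {z z' : RC X M n} (h : ∀ p q hpq x, z.v p q hpq x = z'.v p q hpq x) : z = z' :=
  funext fun T => LinearMap.ext (h T.p T.q T.hpq)

@[simp] lemma add_v (z z' : RC X M n) (p q : ℤ) (h : p + n = q) :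
    (z + z').v p q h = z.v p q h + z'.v p q h := rfl

@[simp] lemma sub_v (z z' : RC X M n) (p q : ℤ) (h : p + n = q) :
    (z - z').v p q h = z.v p q h - z'.v p q h := rfl

@[simp] lemma zero_v (p q : ℤ) (h : p + n = q) : (0 : RC X M n).v p q h = 0 := rfl

/-- The differential of the complex of left `A`-linear maps. -/
def δ (h : n + 1 = m) : RC X M n →ₗ[A] RC X M m where
  toFun z := mk fun p q hpq => (M.d (p + n) q).hom ∘ₗ z.v p (p + n) rfl +
    (m.negOnePow : ℤ) • (z.v (p + 1) q (by omega) ∘ₗ leftLinear (X.d p (p + 1)))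
  map_add' z z' := by
    ext p q hpq x
    simp only [mk_v, add_v, LinearMap.add_apply, LinearMap.comp_apply, map_add,
      LinearMap.smul_apply, smul_add]
    abel
  map_smul' b z := by
    refine RC.ext fun p q hpq x => ?_
    have : leftLinear (X.d p (p + 1)) (rightMul (X.X p) b x) =
        rightMul (X.X (p + 1)) b (leftLinear (X.d p (p + 1)) x) :=
      map_smul (X.d p (p + 1)).hom _ x
    change _ + (m.negOnePow : ℤ) • z.v _ _ _ (rightMul _ b (leftLinear _ x)) =
      _ + (m.negOnePow : ℤ) • z.v _ _ _ (leftLinear _ (rightMul _ b x))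
    rw [this]
    rfl

lemma δ_v (h : n + 1 = m) (z : RC X M n) (p q : ℤ) (hpq : p + m = q) (p' q' : ℤ)
    (hp : p + 1 = p') (hq : q' + 1 = q) (x : X.X p) :
    (δ h z).v p q hpq x = (M.d q' q).hom (z.v p q' (by omega) x) +
      (m.negOnePow : ℤ) • z.v p' q (by omega) ((X.d p p').hom x) := by
  obtain rfl : q' = p + n := by omega
  subst hp
  rfl

lemma δ_δ {k : ℤ} (h : n + 1 = m) (h' : m + 1 = k) (z : RC X M n) : δ h' (δ h z) = 0 := by
  ext p q hpq x
  rw [δ_v h' _ p q hpq (p + 1) (q - 1) rfl (by omega),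
    δ_v h _ p (q - 1) _ (p + 1) (q - 1 - 1) rfl (by omega),
    δ_v h _ (p + 1) q _ (p + 1 + 1) (q - 1) rfl (by omega), map_add, hom_d_d, hom_d_d, map_zsmul,
    map_zero, smul_zero, add_zero, zero_add]
  have : (k.negOnePow : ℤ) = -(m.negOnePow : ℤ) := by
    rw [← h', Int.negOnePow_succ, Units.val_neg]
  rw [this, neg_smul, add_neg_cancel]
  rfl

end RC

/-- The complex `Hom_A(X, M)` of left `A`-modules, for a complex of bimodules `X`. -/
abbrev rightHomCx (X : CochainComplex (ModuleCat.{v} (Env K A)) ℤ)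
    (M : CochainComplex (ModuleCat.{v} A) ℤ) : CochainComplex (ModuleCat.{v} A) ℤ :=
  mkComplex (RC X M) (fun _ _ h => RC.δ h) (fun _ _ _ h h' z => RC.δ_δ h h' z)

lemma rightHomCx_d (X : CochainComplex (ModuleCat.{v} (Env K A)) ℤ)
    (M : CochainComplex (ModuleCat.{v} A) ℤ) (i j : ℤ) (h : i + 1 = j)
    (z : RC X M i) : ((rightHomCx X M).d i j).hom z = RC.δ h z :=
  LinearMap.congr_fun (mkComplex_d (RC X M) _ _ i j h) z

end RightHom

/-! ### Exchanging the arguments: `Hom(X, Hom_K(N, M)) = Hom_A(N, Hom_A(X, M))` -/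

section Swap

section

variable {V : ModuleCat.{v} (Env K A)} {N W : Type v} [AddCommGroup N] [Module A N] [Module K N]
  [IsScalarTower K A N] [AddCommGroup W] [Module A W] [Module K W] [IsScalarTower K A W]

/-- A bimodule map `V → Hom_K(N, W)` as an `A`-linear map `N → Hom_A(V, W)`. -/
def flipLeft (f : V →ₗ[Env K A] (N →ₗ[K] W)) : N →ₗ[A] (V →ₗ[A] W) where
  toFun y :=
    { toFun := fun x => f x y
      map_add' := fun x x' => by rw [map_add]; rfl
      map_smul' := fun a x => by
        rw [leftModule_smul, map_smul, tmul_smul_hom]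
        simp }
  map_add' y y' := LinearMap.ext fun x => map_add (f x) y y'
  map_smul' b y := LinearMap.ext fun x => by
    change f x (b • y) = f (rightMul V b x) y
    rw [rightMul_apply, map_smul f, tmul_smul_hom, one_smul]
    rfl

/-- An `A`-linear map `N → Hom_A(V, W)` as a bimodule map `V → Hom_K(N, W)`. -/
def flipRight (g : N →ₗ[A] (V →ₗ[A] W)) : V →ₗ[Env K A] (N →ₗ[K] W) :=
  let F : V →+ (N →ₗ[K] W) :=
    { toFun := fun x =>
        { toFun := fun y => g y x
          map_add' := fun y y' => by rw [map_add]; rfl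
          map_smul' := fun k y => by
            rw [← algebraMap_smul A k y, map_smul, smul_linearHom_apply, RingHom.id_apply]
            have : rightMul V (algebraMap K A k) x = algebraMap K A k • x := by
              rw [rightMul_apply, leftModule_smul]
              congr 1
              rw [Algebra.algebraMap_eq_smul_one, MulOpposite.op_smul, TensorProduct.tmul_smul,
                TensorProduct.smul_tmul']
            rw [this, map_smul, algebraMap_smul] }
      map_zero' := LinearMap.ext fun y => map_zero (g y)
      map_add' := fun x x' => LinearMap.ext fun y => map_add (g y) x x' }
  { F with
    map_smul' := fun b x => env_smul_induction F x (fun a c => LinearMap.ext fun y => by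
      rw [tmul_smul_hom]
      change g y ((a ⊗ₜ MulOpposite.op c : Env K A) • x) = a • g (c • y) x
      rw [tmul_smul_eq, map_smul, map_smul]
      rfl) b }

end

variable {X X' : CochainComplex (ModuleCat.{v} (Env K A)) ℤ}
  {N N' M M' : CochainComplex (ModuleCat.{v} A) ℤ}

/-- A component of a cochain, as a bimodule map. -/
def LC.proj (n p q : ℤ) (h : p + n = q) : LC K N M n →ₗ[Env K A] (N.X p →ₗ[K] M.X q) :=
  LinearMap.proj (R := Env K A)
    (φ := fun T : CochainComplex.HomComplex.Triplet n => (N.X T.p →ₗ[K] M.X T.q)) ⟨p, q, h⟩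

/-- Bimodule maps into cochains are given by components. -/
def LC.pi {V : ModuleCat.{v} (Env K A)} {n : ℤ}
    (f : ∀ p q : ℤ, p + n = q → (V →ₗ[Env K A] (N.X p →ₗ[K] M.X q))) :
    V →ₗ[Env K A] LC K N M n :=
  LinearMap.pi (R := Env K A)
    (φ := fun T : CochainComplex.HomComplex.Triplet n => (N.X T.p →ₗ[K] M.X T.q))
    fun T => f T.p T.q T.hpq

/-- `A`-linear maps into cochains are given by components. -/
def RC.pi {V : Type v} [AddCommGroup V] [Module A V] {n : ℤ}
    (f : ∀ p q : ℤ, p + n = q → (V →ₗ[A] (X.X p →ₗ[A] M.X q))) :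
    V →ₗ[A] RC X M n :=
  LinearMap.pi (R := A)
    (φ := fun T : CochainComplex.HomComplex.Triplet n => (X.X T.p →ₗ[A] M.X T.q))
    fun T => f T.p T.q T.hpq

/-- A component of a cochain, as an `A`-linear map. -/
def RC.proj (n p q : ℤ) (h : p + n = q) : RC X M n →ₗ[A] (X.X p →ₗ[A] M.X q) :=
  LinearMap.proj (R := A)
    (φ := fun T : CochainComplex.HomComplex.Triplet n => (X.X T.p →ₗ[A] M.X T.q)) ⟨p, q, h⟩

/-- The components of the map `N → Hom_A(X, M)` exchanged with maps `X → Hom_K(N, M)` which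
raise degrees by `k`. -/
def swapLeft {k : ℤ} (f : ∀ p j : ℤ, p + k = j → (X.X p →ₗ[Env K A] LC K N M j)) (n j : ℤ)
    (hj : n + k = j) : N.X n →ₗ[A] RC X M j :=
  RC.pi fun p q h => ((p * n).negOnePow : ℤ) •
    flipLeft (LC.proj (p + k) n q (by omega) ∘ₗ f p (p + k) rfl)

/-- The components of the map `X → Hom_K(N, M)` exchanged with maps `N → Hom_A(X, M)` which
raise degrees by `k`. -/
def swapRight {k : ℤ} (g : ∀ n j : ℤ, n + k = j → (N.X n →ₗ[A] RC X M j)) (p j : ℤ)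
    (hj : p + k = j) : X.X p →ₗ[Env K A] LC K N M j :=
  LC.pi fun n q h => ((p * n).negOnePow : ℤ) •
    flipRight (RC.proj (n + k) p q (by omega) ∘ₗ g n (n + k) rfl)

lemma swapLeft_v {k : ℤ} (f : ∀ p j : ℤ, p + k = j → (X.X p →ₗ[Env K A] LC K N M j)) (n j : ℤ)
    (hj : n + k = j) (p q : ℤ) (h : p + j = q) (i : ℤ) (hi : p + k = i) (y : N.X n) (x : X.X p) :
    (swapLeft f n j hj y).v p q h x =
      ((p * n).negOnePow : ℤ) • (f p i hi x).v n q (by omega) y := by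
  subst hi
  rfl

lemma swapRight_v {k : ℤ} (g : ∀ n j : ℤ, n + k = j → (N.X n →ₗ[A] RC X M j)) (p j : ℤ)
    (hj : p + k = j) (n q : ℤ) (h : n + j = q) (i : ℤ) (hi : n + k = i) (x : X.X p) (y : N.X n) :
    (swapRight g p j hj x).v n q h y =
      ((p * n).negOnePow : ℤ) • (g n i hi y).v p q (by omega) x := by
  subst hi
  rfl

lemma negOnePow_mul_succ (p n : ℤ) :
    ((p * (n + 1)).negOnePow : ℤ) = (p * n).negOnePow * p.negOnePow := by
  rw [mul_add, mul_one, Int.negOnePow_add, Units.val_mul]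

lemma negOnePow_succ_mul (p n : ℤ) :
    (((p + 1) * n).negOnePow : ℤ) = (p * n).negOnePow * n.negOnePow := by
  rw [add_mul, one_mul, Int.negOnePow_add, Units.val_mul]

lemma negOnePow_mul_self_int (p : ℤ) : (p.negOnePow : ℤ) * p.negOnePow = 1 := by
  rw [← Units.val_mul, Int.units_mul_self, Units.val_one]

lemma negOnePow_succ_int (p : ℤ) : ((p + 1).negOnePow : ℤ) = -p.negOnePow := by
  rw [Int.negOnePow_succ, Units.val_neg]

lemma negOnePow_eq_or (p : ℤ) : (p.negOnePow : ℤ) = 1 ∨ (p.negOnePow : ℤ) = -1 := by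
  rcases Int.units_eq_one_or p.negOnePow with h | h <;> simp [h]

/-- Transport of a morphism along an equality of degrees. -/
def homCast {V W : ℤ → Type v} [∀ i, AddCommGroup (V i)] [∀ i, AddCommGroup (W i)]
    {R : Type v} [Ring R] [∀ i, Module R (V i)] [∀ i, Module R (W i)]
    (f : ∀ p, V p →ₗ[R] W p) (p j : ℤ) (h : p + 0 = j) : V p →ₗ[R] W j :=
  have h' : p = j := by omega
  h' ▸ f p

lemma homCast_self {V W : ℤ → Type v} [∀ i, AddCommGroup (V i)] [∀ i, AddCommGroup (W i)]
    {R : Type v} [Ring R] [∀ i, Module R (V i)] [∀ i, Module R (W i)]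
    (f : ∀ p, V p →ₗ[R] W p) (p : ℤ) : homCast f p p (add_zero p) = f p := rfl

lemma LC.congr_v {n : ℤ} {z z' : LC K N M n} (h : z = z') (p q : ℤ) (hpq : p + n = q) (x : N.X p) :
    z.v p q hpq x = z'.v p q hpq x := by rw [h]

lemma RC.congr_v {n : ℤ} {z z' : RC X M n} (h : z = z') (p q : ℤ) (hpq : p + n = q) (x : X.X p) :
    z.v p q hpq x = z'.v p q hpq x := by rw [h]

/-- The components of a morphism to `Hom_K(N, M)`. -/
def toLC (φ : X ⟶ homCx K N M) (p : ℤ) : X.X p →ₗ[Env K A] LC K N M p := (φ.f p).hom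

/-- The components of a morphism to `Hom_A(X, M)`. -/
def toRC (ψ : N ⟶ rightHomCx X M) (n : ℤ) : N.X n →ₗ[A] RC X M n := (ψ.f n).hom

lemma toLC_d (φ : X ⟶ homCx K N M) (p p' n n' q q' : ℤ) (hp : p + 1 = p') (hn : n + 1 = n')
    (hq : q + 1 = q') (h : n + p' = q') (x : X.X p) (y : N.X n) :
    (toLC φ p' ((X.d p p').hom x)).v n q' h y =
      (M.d q q').hom ((toLC φ p x).v n q (by omega) y) +
        (p'.negOnePow : ℤ) • (toLC φ p x).v n' q' (by omega) ((N.d n n').hom y) := by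
  have := hom_comm φ p p' x
  rw [homCx_d _ _ _ _ hp] at this
  rw [← LC.δ_v hp _ n q' h n' q hn hq]
  exact (LC.congr_v this n q' h y).symm

lemma toRC_d (ψ : N ⟶ rightHomCx X M) (p p' n n' q q' : ℤ) (hp : p + 1 = p') (hn : n + 1 = n')
    (hq : q + 1 = q') (h : p + n' = q') (x : X.X p) (y : N.X n) :
    (toRC ψ n' ((N.d n n').hom y)).v p q' h x =
      (M.d q q').hom ((toRC ψ n y).v p q (by omega) x) +
        (n'.negOnePow : ℤ) • (toRC ψ n y).v p' q' (by omega) ((X.d p p').hom x) := by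
  have := hom_comm ψ n n' y
  rw [rightHomCx_d _ _ _ _ hn] at this
  rw [← RC.δ_v hn _ p q' h p' q hp hq]
  exact (RC.congr_v this p q' h x).symm

/-- The morphism `N → Hom_A(X, M)` corresponding to a morphism `X → Hom_K(N, M)`. -/
def swapHom (φ : X ⟶ homCx K N M) : N ⟶ rightHomCx X M :=
  mkHom (F := N) (G := rightHomCx X M)
    (fun n => swapLeft (homCast (V := fun p => X.X p) (W := LC K N M) (toLC φ)) n n (add_zero n))
    (fun i j hij y => by
      rw [rightHomCx_d _ _ _ _ hij]
      refine RC.ext fun p q h x => ?_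
      rw [RC.δ_v hij _ p q h (p + 1) (q - 1) rfl (by omega),
        swapLeft_v _ i i _ p (q - 1) _ p (add_zero p),
        swapLeft_v _ i i _ (p + 1) q _ (p + 1) (add_zero _),
        swapLeft_v _ j j _ p q h p (add_zero p), homCast_self, homCast_self,
        toLC_d φ p (p + 1) i j (q - 1) q rfl hij (by omega) (by omega)]
      subst hij
      rw [negOnePow_mul_succ, negOnePow_succ_mul, negOnePow_succ_int, negOnePow_succ_int, map_zsmul]
      rcases negOnePow_eq_or (p * i) with h1 | h1 <;> rcases negOnePow_eq_or p with h2 | h2 <;>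
      rcases negOnePow_eq_or i with h3 | h3 <;> rw [h1, h2, h3] <;> simp)

lemma swapHom_v (φ : X ⟶ homCx K N M) (n p q : ℤ) (h : p + n = q) (x : X.X p) (y : N.X n) :
    (toRC (swapHom φ) n y).v p q h x =
      ((p * n).negOnePow : ℤ) • (toLC φ p x).v n q (by omega) y :=
  swapLeft_v _ n n (add_zero n) p q h p (add_zero p) y x

/-- The morphism `X → Hom_K(N, M)` corresponding to a morphism `N → Hom_A(X, M)`. -/
def unswapHom (ψ : N ⟶ rightHomCx X M) : X ⟶ homCx K N M :=
  mkHom (F := X) (G := homCx K N M)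
    (fun n => swapRight (homCast (V := fun p => N.X p) (W := RC X M) (toRC ψ)) n n (add_zero n))
    (fun i j hij x => by
      rw [homCx_d _ _ _ _ hij]
      refine LC.ext fun p q h y => ?_
      rw [LC.δ_v hij _ p q h (p + 1) (q - 1) rfl (by omega),
        swapRight_v _ i i _ p (q - 1) _ p (add_zero p),
        swapRight_v _ i i _ (p + 1) q _ (p + 1) (add_zero _),
        swapRight_v _ j j _ p q h p (add_zero p), homCast_self, homCast_self,
        toRC_d ψ i j p (p + 1) (q - 1) q hij rfl (by omega) (by omega)]
      subst hij
      rw [negOnePow_mul_succ, negOnePow_succ_mul, negOnePow_succ_int, negOnePow_succ_int, map_zsmul]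
      rcases negOnePow_eq_or (i * p) with h1 | h1 <;> rcases negOnePow_eq_or p with h2 | h2 <;>
      rcases negOnePow_eq_or i with h3 | h3 <;> rw [h1, h2, h3] <;> simp)

lemma unswapHom_v (ψ : N ⟶ rightHomCx X M) (n p q : ℤ) (h : n + p = q) (x : X.X p) (y : N.X n) :
    (toLC (unswapHom ψ) p x).v n q h y =
      ((p * n).negOnePow : ℤ) • (toRC ψ n y).v p q (by omega) x :=
  swapRight_v _ p p (add_zero p) n q h n (add_zero n) x y

lemma swapHom_unswapHom (ψ : N ⟶ rightHomCx X M) : swapHom (K := K) (unswapHom ψ) = ψ := by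
  refine HomologicalComplex.hom_ext _ _ fun n => ModuleCat.hom_ext (LinearMap.ext fun y =>
    RC.ext (X := X) (M := M) fun p q h x => ?_)
  change (toRC (swapHom (K := K) (unswapHom ψ)) n y).v p q h x = (toRC ψ n y).v p q h x
  rw [swapHom_v, unswapHom_v, smul_smul, negOnePow_mul_self_int, one_smul]

lemma swapHom_sub (φ φ' : X ⟶ homCx K N M) : swapHom (φ - φ') = swapHom φ - swapHom φ' := by
  refine HomologicalComplex.hom_ext _ _ fun n => ModuleCat.hom_ext (LinearMap.ext fun y =>
    RC.ext (X := X) (M := M) fun p q h x => ?_)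
  change (toRC (swapHom (φ - φ')) n y).v p q h x =
    (toRC (swapHom φ) n y).v p q h x - (toRC (swapHom φ') n y).v p q h x
  rw [swapHom_v, swapHom_v, swapHom_v, ← smul_sub]
  rfl

/-- Morphisms that correspond under exchanging the arguments are simultaneously null-homotopic. -/
lemma swapHom_null_iff (φ : X ⟶ homCx K N M) :
    Nonempty (Homotopy (swapHom φ) 0) ↔ Nonempty (Homotopy φ 0) := by
  constructor
  · rintro ⟨h⟩
    let g : ∀ n j : ℤ, n + (-1) = j → (N.X n →ₗ[A] RC X M j) := fun n j _ => (h.hom n j).hom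
    refine ⟨mkHomotopyZero (F := X) (G := homCx K N M) φ
      (fun i j hij => swapRight g i j (by omega)) ?_⟩
    intro i j k hij hjk x
    rw [homCx_d _ _ _ _ hij]
    refine LC.ext fun n q hq y => ?_
    have key := RC.congr_v (homotopyZero_apply h (n - 1) n (n + 1) (by omega) rfl y) j q
      (by omega) x
    rw [rightHomCx_d _ _ _ _ (by omega)] at key
    change (toRC (swapHom φ) n y).v j q _ x = (RC.δ _ (g n (n - 1) (by omega) y)).v j q _ x +
      (g (n + 1) n (by omega) ((N.d n (n + 1)).hom y)).v j q _ x at key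
    rw [swapHom_v, RC.δ_v _ _ j q _ k (q - 1) hjk (by omega)] at key
    change (toLC φ j x).v n q _ y = (LC.δ hij (swapRight g j i _ x)).v n q _ y +
      (swapRight g k j _ ((X.d j k).hom x)).v n q _ y
    rw [LC.δ_v hij _ n q _ (n + 1) (q - 1) rfl (by omega),
      swapRight_v g j i _ n (q - 1) _ (n - 1) (by omega),
      swapRight_v g j i _ (n + 1) q _ n (by omega),
      swapRight_v g k j _ n q _ (n - 1) (by omega)]
    subst hjk
    rw [negOnePow_mul_succ, negOnePow_succ_mul, map_zsmul]
    have h4 : (toLC φ j x).v n q hq y = ((j * n).negOnePow : ℤ) • ((j * n).negOnePow : ℤ) •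
        (toLC φ j x).v n q hq y := by
      rw [smul_smul, negOnePow_mul_self_int, one_smul]
    rw [h4, key]
    rcases negOnePow_eq_or (j * n) with h1 | h1 <;> rcases negOnePow_eq_or j with h2 | h2 <;>
      rcases negOnePow_eq_or n with h3 | h3 <;> rw [h1, h2, h3] <;> simp <;> abel
  · rintro ⟨h⟩
    let g : ∀ p j : ℤ, p + (-1) = j → (X.X p →ₗ[Env K A] LC K N M j) := fun n j _ =>
      (h.hom n j).hom
    refine ⟨mkHomotopyZero (F := N) (G := rightHomCx X M) (swapHom φ)
      (fun i j hij => swapLeft g i j (by omega)) ?_⟩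
    intro i j k hij hjk y
    rw [rightHomCx_d _ _ _ _ hij]
    refine RC.ext fun p q hq x => ?_
    have key := LC.congr_v (homotopyZero_apply h (p - 1) p (p + 1) (by omega) rfl x) j q
      (by omega) y
    rw [homCx_d _ _ _ _ (by omega)] at key
    change (toLC φ p x).v j q _ y = (LC.δ _ (g p (p - 1) (by omega) x)).v j q _ y +
      (g (p + 1) p (by omega) ((X.d p (p + 1)).hom x)).v j q _ y at key
    rw [LC.δ_v _ _ j q _ k (q - 1) hjk (by omega)] at key
    change (toRC (swapHom φ) j y).v p q _ x = (RC.δ hij (swapLeft g j i _ y)).v p q _ x +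
      (swapLeft g k j _ ((N.d j k).hom y)).v p q _ x
    rw [swapHom_v, key, RC.δ_v hij _ p q _ (p + 1) (q - 1) rfl (by omega),
      swapLeft_v g j i _ p (q - 1) _ (p - 1) (by omega),
      swapLeft_v g j i _ (p + 1) q _ p (by omega),
      swapLeft_v g k j _ p q _ (p - 1) (by omega)]
    subst hjk
    rw [negOnePow_mul_succ, negOnePow_succ_mul, map_zsmul]
    rcases negOnePow_eq_or (p * j) with h1 | h1 <;> rcases negOnePow_eq_or j with h2 | h2 <;>
      rcases negOnePow_eq_or p with h3 | h3 <;> rw [h1, h2, h3] <;> simp <;> abel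

end Swap

end Enveloping

/-! ### Elementwise criteria for acyclicity and quasi-isomorphisms -/

section Criteria

variable {R : Type v} [Ring R]

lemma acyclic_iff (E : CochainComplex (ModuleCat.{v} R) ℤ) :
    E.Acyclic ↔ ∀ i j k, i + 1 = j → j + 1 = k → ∀ x, (E.d j k).hom x = 0 →
      ∃ y, (E.d i j).hom y = x := by
  have h : ∀ i j k, i + 1 = j → j + 1 = k → (E.ExactAt j ↔ ∀ x, (E.d j k).hom x = 0 →
      ∃ y, (E.d i j).hom y = x) := by
    intro i j k hij hjk
    rw [E.exactAt_iff' i j k (by simp; omega) (by simp; omega), ShortComplex.moduleCat_exact_iff]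
    rfl
  constructor
  · intro hE i j k hij hjk
    exact (h i j k hij hjk).1 (hE j)
  · intro hE j
    exact (h (j - 1) j (j + 1) (by omega) rfl).2 (hE _ _ _ (by omega) rfl)

/-- A cohomology class is represented by a cocycle, expressed through the embedding of cohomology
into the cokernel of the differential. -/
lemma exists_cycle_of_homology (E : CochainComplex (ModuleCat.{v} R) ℤ) (j k : ℤ)
    (c : E.homology j) :
    ∃ x, (E.d j k).hom x = 0 ∧ (E.homologyι j).hom c = (E.pOpcycles j).hom x := by
  obtain ⟨z, rfl⟩ := (ModuleCat.epi_iff_surjective (E.homologyπ j)).1 inferInstance c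
  refine ⟨(E.iCycles j).hom z, ?_, ?_⟩
  · exact congrArg (fun f => f.hom z) (E.iCycles_d j k)
  · exact congrArg (fun f => f.hom z) (E.homology_π_ι j)

lemma exists_homology_of_cycle (E : CochainComplex (ModuleCat.{v} R) ℤ) (j k : ℤ) (hjk : j + 1 = k)
    (x : E.X j) (hx : (E.d j k).hom x = 0) :
    ∃ c, (E.homologyι j).hom c = (E.pOpcycles j).hom x := by
  let f : ModuleCat.of R (ULift.{v} R) ⟶ E.X j :=
    ModuleCat.ofHom ((LinearMap.toSpanSingleton R (E.X j) x) ∘ₗ ULift.moduleEquiv.toLinearMap)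
  have hf : f ≫ E.d j k = 0 := by
    ext r
    change (E.d j k).hom (r.down • x) = 0
    rw [map_smul, hx, smul_zero]
  have hf1 : f.hom ⟨1⟩ = x := one_smul R x
  refine ⟨(E.liftCycles f k (by simp; omega) hf ≫ E.homologyπ j).hom ⟨1⟩, ?_⟩
  have := congrArg (fun g => g.hom ⟨1⟩) (show (E.liftCycles f k (by simp; omega) hf ≫
    E.homologyπ j) ≫ E.homologyι j = f ≫ E.pOpcycles j by simp)
  refine this.trans ?_
  change (E.pOpcycles j).hom (f.hom ⟨1⟩) = _
  rw [hf1]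

lemma pOpcycles_eq_zero_iff (E : CochainComplex (ModuleCat.{v} R) ℤ) (i j : ℤ) (hij : i + 1 = j)
    (x : E.X j) : (E.pOpcycles j).hom x = 0 ↔ ∃ y, (E.d i j).hom y = x := by
  obtain rfl : i = (ComplexShape.up ℤ).prev j := by simp; omega
  refine ((E.sc j).moduleCat_pOpcycles_eq_zero_iff x).trans ?_
  rfl

lemma homologyι_injective (E : CochainComplex (ModuleCat.{v} R) ℤ) (j : ℤ) :
    Function.Injective (E.homologyι j).hom :=
  (ModuleCat.mono_iff_injective (E.homologyι j)).1 inferInstance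

/-- A morphism of complexes of modules is a quasi-isomorphism if it is injective and surjective
on cohomology classes. -/
lemma quasiIso_of_elements {E E' : CochainComplex (ModuleCat.{v} R) ℤ} (f : E ⟶ E')
    (hinj : ∀ i j k, i + 1 = j → j + 1 = k → ∀ x, (E.d j k).hom x = 0 →
      ∀ y', (f.f j).hom x = (E'.d i j).hom y' → ∃ y, x = (E.d i j).hom y)
    (hsurj : ∀ i j k, i + 1 = j → j + 1 = k → ∀ x', (E'.d j k).hom x' = 0 →
      ∃ x y', (E.d j k).hom x = 0 ∧ x' = (f.f j).hom x + (E'.d i j).hom y') : QuasiIso f := by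
  rw [quasiIso_iff]
  intro j
  rw [quasiIsoAt_iff_isIso_homologyMap, ConcreteCategory.isIso_iff_bijective]
  have e1 : ∀ c, (E'.homologyι j).hom ((HomologicalComplex.homologyMap f j).hom c) =
      (HomologicalComplex.opcyclesMap f j).hom ((E.homologyι j).hom c) := fun c =>
    congrArg (fun g => g.hom c) (HomologicalComplex.homologyι_naturality f j)
  have e2 : ∀ x, (HomologicalComplex.opcyclesMap f j).hom ((E.pOpcycles j).hom x) =
      (E'.pOpcycles j).hom ((f.f j).hom x) := fun c =>
    congrArg (fun g => g.hom c) (HomologicalComplex.p_opcyclesMap f j)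
  constructor
  · refine (injective_iff_map_eq_zero (HomologicalComplex.homologyMap f j).hom).2 fun c hc => ?_
    obtain ⟨x, hx, hcx⟩ := exists_cycle_of_homology E j (j + 1) c
    have h1 : (E'.pOpcycles j).hom ((f.f j).hom x) = 0 := by
      rw [← e2, ← hcx, ← e1, hc, map_zero]
    obtain ⟨y', hy'⟩ := (pOpcycles_eq_zero_iff E' (j - 1) j (by omega) _).1 h1
    obtain ⟨y, hy⟩ := hinj (j - 1) j (j + 1) (by omega) rfl x hx y' hy'.symm
    apply homologyι_injective E j
    rw [hcx, map_zero, pOpcycles_eq_zero_iff E (j - 1) j (by omega)]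
    exact ⟨y, hy.symm⟩
  · intro c'
    obtain ⟨x', hx', hcx'⟩ := exists_cycle_of_homology E' j (j + 1) c'
    obtain ⟨x, y', hx, hxy⟩ := hsurj (j - 1) j (j + 1) (by omega) rfl x' hx'
    obtain ⟨c, hc⟩ := exists_homology_of_cycle E j (j + 1) rfl x hx
    refine ⟨c, homologyι_injective E' j ?_⟩
    refine (e1 c).trans ?_
    rw [hcx', hc, e2, hxy, map_add, (pOpcycles_eq_zero_iff E' (j - 1) j (by omega) _).2 ⟨y', rfl⟩,
      add_zero]

end Criteria

section Enveloping

variable {K : Type u} [Field K] {A : Type v} [Ring A] [Algebra K A]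

/-! ### K-injectivity of `Hom_A(X, M)` -/

section KInjective

variable {X : CochainComplex (ModuleCat.{v} (Env K A)) ℤ}
  {N M : CochainComplex (ModuleCat.{v} A) ℤ}

variable (K) in
/-- An acyclic complex of `A`-modules is contractible over the ground field. -/
lemma exists_contraction (hN : N.Acyclic) :
    ∃ h : ∀ i j, N.X i →ₗ[K] N.X j, ∀ i j k x, i + 1 = j → j + 1 = k →
      x = (N.d i j).hom (h j i x) + h k j ((N.d j k).hom x) := by
  obtain ⟨π, h, h1, h2, h3, h4⟩ := exists_hodge (K := K) (V := fun i => N.X i) (LC.diff K N)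
    (fun i j k x => hom_d_d N i j k x)
  rw [acyclic_iff] at hN
  refine ⟨h, fun i j k x hij hjk => ?_⟩
  obtain ⟨y, hy⟩ := hN i j k hij hjk (π j x) (h1 j k x hjk)
  have h5 : π j x = 0 := by
    rw [← h3, ← hy]
    exact h2 i j y hij
  have h6 := h4 i j k x hij hjk
  rw [h5, zero_add] at h6
  exact h6

/-- A homotopy on the source shows that cocycles `z` and `z ∘ π` are cohomologous. -/
lemma LC.exists_sub_eq_δ_of_source (π : ∀ i, N.X i →ₗ[K] N.X i) (h : ∀ i j, N.X i →ₗ[K] N.X j)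
    (H : ∀ i j k x, i + 1 = j → j + 1 = k →
      x = π j x + (N.d i j).hom (h j i x) + h k j ((N.d j k).hom x))
    (i j k : ℤ) (hij : i + 1 = j) (hjk : j + 1 = k) (z : LC K N M j) (hz : LC.δ hjk z = 0) :
    z - LC.mk (fun p q hpq => z.v p q hpq ∘ₗ π p) =
      LC.δ hij (LC.mk fun p q hpq =>
        (j.negOnePow : ℤ) • z.v (p - 1) q (by omega) ∘ₗ h p (p - 1)) := by
  subst hjk
  ext p q hpq x
  have h1 := LC.congr_v hz (p - 1) q (by omega) (h p (p - 1) x)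
  rw [LC.δ_v rfl z (p - 1) q _ p (q - 1) (by omega) (by omega)] at h1
  have h2 := congrArg (z.v p q hpq) (H (p - 1) p (p + 1) x (by omega) rfl)
  rw [LC.δ_v hij _ p q hpq (p + 1) (q - 1) rfl (by omega)]
  have h3 : (((LC.mk fun p q hpq =>
        (j.negOnePow : ℤ) • z.v (p - 1) q (by omega) ∘ₗ h p (p - 1) : LC K N M i)).v
        (p + 1) q (by omega)) ((N.d p (p + 1)).hom x) =
        (j.negOnePow : ℤ) • z.v p q hpq (h (p + 1) p ((N.d p (p + 1)).hom x)) := by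
    have : ∀ m (hm : m = p) w, (j.negOnePow : ℤ) • z.v m q (by omega) (h (p + 1) m w) =
        (j.negOnePow : ℤ) • z.v p q hpq (h (p + 1) p w) := by
      rintro _ rfl w; rfl
    exact this (p + 1 - 1) (by omega) _
  rw [h3, smul_smul, negOnePow_mul_self_int, one_smul]
  simp only [sub_v, mk_v, LinearMap.sub_apply, LinearMap.comp_apply, LinearMap.smul_apply,
    map_zsmul]
  rw [map_add, map_add] at h2
  rw [zero_v, LinearMap.zero_apply, negOnePow_succ_int, neg_smul, add_neg_eq_zero] at h1
  rw [h1, smul_smul, negOnePow_mul_self_int, one_smul, sub_eq_iff_eq_add]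
  refine h2.trans ?_
  abel

/-- A homotopy on the target shows that cocycles `z` and `π ∘ z` are cohomologous. -/
lemma LC.exists_sub_eq_δ_of_target (π : ∀ i, M.X i →ₗ[K] M.X i) (h : ∀ i j, M.X i →ₗ[K] M.X j)
    (H : ∀ i j k x, i + 1 = j → j + 1 = k →
      x = π j x + (M.d i j).hom (h j i x) + h k j ((M.d j k).hom x))
    (i j k : ℤ) (hij : i + 1 = j) (hjk : j + 1 = k) (z : LC K N M j) (hz : LC.δ hjk z = 0) :
    z - LC.mk (fun p q hpq => π q ∘ₗ z.v p q hpq) =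
      LC.δ hij (LC.mk fun p q hpq => h (q + 1) q ∘ₗ z.v p (q + 1) (by omega)) := by
  subst hjk
  ext p q hpq x
  have h1 := LC.congr_v hz p (q + 1) (by omega) x
  rw [LC.δ_v rfl z p (q + 1) _ (p + 1) q rfl rfl] at h1
  have h2 := H (q - 1) q (q + 1) (z.v p q hpq x) (by omega) rfl
  rw [LC.δ_v hij _ p q hpq (p + 1) (q - 1) rfl (by omega)]
  have h3 : ((LC.mk fun p q hpq => h (q + 1) q ∘ₗ z.v p (q + 1) (by omega) : LC K N M i)).v
        p (q - 1) (by omega) x = h q (q - 1) (z.v p q hpq x) := by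
    have : ∀ m (hm : m = q), h m (q - 1) (z.v p m (by omega) x) =
        h q (q - 1) (z.v p q hpq x) := by
      rintro _ rfl; rfl
    exact this (q - 1 + 1) (by omega)
  rw [h3]
  simp only [sub_v, mk_v, LinearMap.sub_apply, LinearMap.comp_apply]
  rw [zero_v, LinearMap.zero_apply, negOnePow_succ_int, neg_smul, add_neg_eq_zero] at h1
  rw [h1, map_zsmul] at h2
  rw [sub_eq_iff_eq_add]
  refine h2.trans ?_
  abel

/-- As `K` is a field, an acyclic complex is contractible over `K`, so that `Hom_K(N, M)` is
acyclic. -/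
lemma homCx_acyclic_of_source (hN : N.Acyclic) : (homCx K N M).Acyclic := by
  obtain ⟨h, H⟩ := exists_contraction K hN
  rw [acyclic_iff]
  intro i j k hij hjk z hz
  rw [homCx_d _ _ _ _ hjk] at hz
  have := LC.exists_sub_eq_δ_of_source (M := M) (fun _ => 0) h (fun i j k x hij hjk => by
    rw [LinearMap.zero_apply, zero_add]; exact H i j k x hij hjk) i j k hij hjk z hz
  refine ⟨_, (homCx_d _ _ _ _ hij _).trans (this.symm.trans ?_)⟩
  ext p q hpq x
  simp

variable (X M) in
/-- `Hom_A(X, -)` produces K-injective complexes when `X` is K-projective over `Aᵉ`: a morphism from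
an acyclic complex `N` corresponds to a morphism from `X` to the acyclic complex `Hom_K(N, M)`. -/
lemma rightHomCx_isKInjective [X.IsKProjective] : (rightHomCx X M).IsKInjective where
  nonempty_homotopy_zero {N} f hN := by
    rw [← swapHom_unswapHom (K := K) f, swapHom_null_iff]
    exact ⟨CochainComplex.IsKProjective.homotopyZero _ (homCx_acyclic_of_source hN)⟩

/-- If the complex `Hom_A(X, M)` is acyclic, then so is the complex of morphisms from the
K-projective complex `X` to `Hom_K(N, M)`. -/
lemma homotopy_zero_of_rightHomCx_acyclic [X.IsKProjective] (hX : (rightHomCx X M).Acyclic)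
    (φ : X ⟶ homCx K N M) : Nonempty (Homotopy φ 0) := by
  rw [← swapHom_null_iff]
  have := rightHomCx_isKInjective X M
  exact ⟨(Homotopy.ofEq (by simp)).trans
    (((CochainComplex.IsKInjective.homotopyZero (𝟙 (rightHomCx X M)) hX).compLeft (swapHom φ)).trans
      (Homotopy.ofEq (by simp)))⟩

end KInjective

/-! ### The unit map `M → Hom_A(P, M)` for a resolution `P` of the diagonal bimodule -/

section Projective

/-- A projective bimodule is projective as a left module, since `Aᵉ` is free over `A`. -/
lemma projective_left_of_projective {V : ModuleCat.{v} (Env K A)}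
    (hV : Module.Projective (Env K A) V) :
    Module.Projective A V := by
  obtain ⟨s, hs⟩ := Module.projective_def'.1 hV
  let b := Algebra.TensorProduct.basis A (Module.Free.chooseBasis K Aᵐᵒᵖ)
  have hB : Module.Projective A (Env K A) := Module.Projective.of_basis b
  have : Module.Projective A (V →₀ Env K A) := inferInstance
  refine Module.Projective.of_split (R := A) (M := V →₀ Env K A) (P := V)
    { toFun := s, map_add' := map_add s, map_smul' := fun a x => ?_ }
    { toFun := Finsupp.linearCombination (Env K A) id,
      map_add' := map_add _, map_smul' := fun a x => ?_ } ?_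
  · refine (map_smul s (a ⊗ₜ MulOpposite.op 1 : Env K A) x).trans ?_
    ext v
    change (a ⊗ₜ 1 : Env K A) * s x v = a • s x v
    induction s x v using TensorProduct.induction_on with
    | zero => simp
    | tmul c d => simp [TensorProduct.smul_tmul']
    | add c d hc hd => rw [mul_add, hc, hd, smul_add]
  · refine Eq.trans ?_ (map_smul (Finsupp.linearCombination (Env K A) id)
      (a ⊗ₜ MulOpposite.op 1 : Env K A) x)
    refine congrArg _ ?_
    ext v
    change a • x v = (a ⊗ₜ 1 : Env K A) * x v
    induction x v using TensorProduct.induction_on with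
    | zero => simp
    | tmul c d => simp [TensorProduct.smul_tmul']
    | add c d hc hd => rw [smul_add, hc, hd, mul_add]
  · exact LinearMap.ext fun x => LinearMap.congr_fun hs x

end Projective

section Unit

variable {N M N' M' : CochainComplex (ModuleCat.{v} A) ℤ}

/-- The components of a morphism of complexes, as a degree-zero cochain. -/
def LC.ofHom (f : N ⟶ M) : LC K N M 0 :=
  LC.mk fun p q h => homCast (V := fun i => N.X i) (W := fun i => M.X i)
    (fun i => (f.f i).hom.restrictScalars A) p q h |>.restrictScalars K

lemma LC.ofHom_v (f : N ⟶ M) (p : ℤ) (x : N.X p) :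
    (LC.ofHom (K := K) f).v p p (add_zero p) x = (f.f p).hom x := rfl

/-- The additive map underlying `LC.unit`. -/
def LC.unitAux (f : N ⟶ M) : A →+ LC K N M 0 where
  toFun a := (a ⊗ₜ[K] MulOpposite.op (1 : A)) • LC.ofHom f
  map_zero' := by rw [TensorProduct.zero_tmul]; exact zero_smul (Env K A) (LC.ofHom (K := K) f)
  map_add' a b := by rw [TensorProduct.add_tmul, add_smul]

lemma LC.unitAux_v (f : N ⟶ M) (a : A) (p : ℤ) (x : N.X p) :
    (LC.unitAux (K := K) f a).v p p (add_zero p) x = a • (f.f p).hom x := by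
  change ((a ⊗ₜ[K] MulOpposite.op (1 : A)) • LC.ofHom f).v p p _ x = _
  rw [LC.env_smul_v, tmul_smul_hom, MulOpposite.unop_op, one_smul, LC.ofHom_v]

lemma LC.unitAux_mul (f : N ⟶ M) (x y a : A) :
    LC.unitAux (K := K) f (x * a * y) =
      (x ⊗ₜ MulOpposite.op y : Env K A) • LC.unitAux f a := by
  refine LC.ext fun p q h m => ?_
  obtain rfl : p = q := by omega
  rw [LC.env_smul_v, tmul_smul_hom, MulOpposite.unop_op, LC.unitAux_v, LC.unitAux_v, map_smul,
    smul_smul, smul_smul]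

/-- The bimodule map `A → Hom_K(N, M)` that sends `a` to `a • f`, for a morphism of complexes `f`
of `A`-modules. -/
def LC.unit (f : N ⟶ M) : diagBimod K A →ₗ[Env K A] LC K N M 0 where
  toFun a := LC.unitAux f (show A from a)
  map_add' a b := (LC.unitAux f).map_add (show A from a) (show A from b)
  map_smul' b a := by
    let g : diagBimod K A →+ LC K N M 0 := AddMonoidHom.mk' (fun a => LC.unitAux f (show A from a))
      (fun a b => (LC.unitAux f).map_add (show A from a) (show A from b))
    refine env_smul_induction g a (fun x y => ?_) b
    exact (congrArg g (diagBimod_smul K A x y a)).trans (LC.unitAux_mul f x y (show A from a))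

lemma LC.unit_v (f : N ⟶ M) (a : A) (p : ℤ) (x : N.X p) :
    (LC.unit (K := K) f a).v p p (add_zero p) x = a • (f.f p).hom x :=
  LC.unitAux_v f a p x

lemma LC.δ_unit (f : N ⟶ M) (a : A) : LC.δ (zero_add 1) (LC.unit (K := K) f a) = 0 := by
  refine LC.ext fun p q h x => ?_
  subst h
  rw [LC.δ_v _ _ p (p + 1) rfl (p + 1) p rfl rfl, LC.unit_v, LC.unit_v, map_smul, hom_comm]
  simp

/-- `LC.unit` as a morphism of bimodules. -/
def LC.unitMor (f : N ⟶ M) : diagBimod K A ⟶ (homCx K N M).X 0 :=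
  ModuleCat.ofHom (X := diagBimod K A) (LC.unit f)

lemma LC.unitMor_d (f : N ⟶ M) (k : ℤ) (hk : (ComplexShape.up ℤ).Rel 0 k) :
    LC.unitMor (K := K) f ≫ (homCx K N M).d 0 k = 0 := by
  obtain rfl : 0 + 1 = k := hk
  refine ModuleCat.hom_ext (LinearMap.ext fun a => ?_)
  exact (homCx_d N M 0 1 (zero_add 1) _).trans (LC.δ_unit f a)

/-- The morphism `A → Hom_K(N, M)` of complexes of bimodules attached to a morphism `N → M` of
complexes of `A`-modules. -/
def unitHom (f : N ⟶ M) :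
    (HomologicalComplex.single (ModuleCat.{v} (Env K A)) (ComplexShape.up ℤ) 0).obj
      (diagBimod K A) ⟶ homCx K N M :=
  HomologicalComplex.mkHomFromSingle (LC.unitMor f) (LC.unitMor_d f)

variable {P : CochainComplex (ModuleCat.{v} (Env K A)) ℤ}
  (ε : P ⟶ (HomologicalComplex.single (ModuleCat.{v} (Env K A)) (ComplexShape.up ℤ) 0).obj
      (diagBimod K A))

/-- The degree-zero component of an augmentation `P → A`. -/
def augment (x : P.X 0) : A :=
  (ε.f 0 ≫ (HomologicalComplex.singleObjXSelf (ComplexShape.up ℤ) 0 (diagBimod K A)).hom).hom x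

/-- The morphism `P → Hom_K(N, M)` attached to a morphism `N → M`. -/
def resUnit (f : N ⟶ M) : P ⟶ homCx K N M := ε ≫ unitHom f

lemma toLC_resUnit_zero (f : N ⟶ M) (x : P.X 0) (p : ℤ) (y : N.X p) :
    (toLC (resUnit ε f) 0 x).v p p (add_zero p) y =
      augment ε x • (f.f p).hom y := by
  rw [← LC.unit_v (K := K)]
  refine LC.congr_v ?_ p p (add_zero p) y
  refine (congrArg (fun t => t.hom ((ε.f 0).hom x))
    (HomologicalComplex.mkHomFromSingle_f (c := ComplexShape.up ℤ)
      (K := homCx K N M) (j := 0) (A := diagBimod K A)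
      (LC.unitMor f) (LC.unitMor_d f))).trans ?_
  rfl

lemma single_eq_zero (V : ModuleCat.{v} (Env K A)) (i : ℤ) (hi : i ≠ 0)
    (x : ((HomologicalComplex.single (ModuleCat.{v} (Env K A)) (ComplexShape.up ℤ) 0).obj V).X i) :
    x = 0 := by
  have := ModuleCat.isZero_iff_subsingleton.1
    (HomologicalComplex.isZero_single_obj_X (ComplexShape.up ℤ) 0 V i hi)
  exact Subsingleton.elim _ _

lemma toLC_resUnit_ne (f : N ⟶ M) (i : ℤ) (hi : i ≠ 0) (x : P.X i) :
    toLC (resUnit ε f) i x = 0 := by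
  change ((unitHom f).f i).hom ((ε.f i).hom x) = 0
  rw [single_eq_zero _ i hi ((ε.f i).hom x), map_zero]

/-- A morphism to `Hom_K(N, M)` with the components of `resUnit ε f` equals it. -/
lemma resUnit_ext {φ : P ⟶ homCx K N M} (f : N ⟶ M) (h0 : ∀ (x : P.X 0) p (y : N.X p),
    (toLC φ 0 x).v p p (add_zero p) y = augment ε x • (f.f p).hom y)
    (h : ∀ i, i ≠ 0 → ∀ x : P.X i, toLC φ i x = 0) : resUnit ε f = φ := by
  refine HomologicalComplex.hom_ext _ _ fun i => ModuleCat.hom_ext (LinearMap.ext fun x => ?_)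
  by_cases hi : i = 0
  · subst hi
    refine LC.ext fun p q hpq y => ?_
    obtain rfl : p = q := by omega
    exact (toLC_resUnit_zero ε f x p y).trans (h0 x p y).symm
  · exact (toLC_resUnit_ne ε f i hi x).trans (h i hi x).symm

lemma resUnit_comp_left (f : N ⟶ M) (g : M ⟶ M') :
    resUnit ε (f ≫ g) = resUnit (K := K) ε f ≫ homCxMap K (𝟙 N) g := by
  refine resUnit_ext ε _ (fun x p y => ?_) (fun i hi x => ?_)
  · change (LC.map (𝟙 N) g 0 (toLC (resUnit ε f) 0 x)).v _ _ _ _ = _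
    rw [LC.map_v]
    refine (congrArg (g.f p).hom (toLC_resUnit_zero ε f x p y)).trans ?_
    rw [map_smul]
    rfl
  · change LC.map (𝟙 N) g i (toLC (resUnit ε f) i x) = _
    rw [toLC_resUnit_ne ε f i hi x, map_zero]

lemma resUnit_comp_right (f : N' ⟶ N) (g : N ⟶ M) :
    resUnit ε (f ≫ g) = resUnit (K := K) ε g ≫ homCxMap K f (𝟙 M) := by
  refine resUnit_ext ε _ (fun x p y => ?_) (fun i hi x => ?_)
  · change (LC.map f (𝟙 M) 0 (toLC (resUnit ε g) 0 x)).v _ _ _ _ = _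
    rw [LC.map_v]
    exact toLC_resUnit_zero ε g x p _
  · change LC.map f (𝟙 M) i (toLC (resUnit ε g) i x) = _
    rw [toLC_resUnit_ne ε g i hi x, map_zero]

lemma swapHom_comp (f : N' ⟶ N) (φ : P ⟶ homCx K N M) :
    swapHom (φ ≫ homCxMap K f (𝟙 M)) = f ≫ swapHom φ := by
  refine HomologicalComplex.hom_ext _ _ fun n => ModuleCat.hom_ext (LinearMap.ext fun y =>
    RC.ext (X := P) (M := M) fun p q h x => ?_)
  change (toRC (swapHom (φ ≫ homCxMap K f (𝟙 M))) n y).v p q h x =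
    (toRC (swapHom φ) n ((f.f n).hom y)).v p q h x
  rw [swapHom_v, swapHom_v]
  rfl

variable (M) in
/-- The morphism `M → Hom_A(P, M)` induced by an augmentation `P → A`. -/
def coaug : M ⟶ rightHomCx P M := swapHom (resUnit ε (𝟙 M))

lemma swapHom_resUnit (f : N ⟶ M) : swapHom (resUnit ε f) = f ≫ coaug M ε := by
  rw [coaug, ← swapHom_comp, ← resUnit_comp_right, Category.comp_id]

lemma coaug_v (n : ℤ) (x : P.X 0) (y : M.X n) :
    (toRC (coaug M ε) n y).v 0 n (zero_add n) x = augment ε x • y := by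
  rw [coaug, swapHom_v, zero_mul, Int.negOnePow_zero, Units.val_one, one_smul, toLC_resUnit_zero]
  rfl

lemma coaug_v_ne (n p q : ℤ) (h : p + n = q) (hp : p ≠ 0) (x : P.X p) (y : M.X n) :
    (toRC (coaug M ε) n y).v p q h x = 0 := by
  rw [coaug, swapHom_v, toLC_resUnit_ne ε _ p hp]
  simp

end Unit

section Coaug

variable {N M N' M' : CochainComplex (ModuleCat.{v} A) ℤ}
  {P : CochainComplex (ModuleCat.{v} (Env K A)) ℤ}
  (ε : P ⟶ (HomologicalComplex.single (ModuleCat.{v} (Env K A)) (ComplexShape.up ℤ) 0).obj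
      (diagBimod K A))

variable (K A) in
/-- Restriction of bimodules to left modules. -/
abbrev leftRes : ModuleCat.{v} (Env K A) ⥤ ModuleCat.{v} A :=
  ModuleCat.restrictScalars.{v} (Algebra.TensorProduct.includeLeft : A →ₐ[K] Env K A).toRingHom

/-- The inclusion of `A` as the degree-zero term of the complex `A`. -/
def singleIn (a : A) : ((HomologicalComplex.single (ModuleCat.{v} (Env K A))
    (ComplexShape.up ℤ) 0).obj (diagBimod K A)).X 0 :=
  (HomologicalComplex.singleObjXSelf (ComplexShape.up ℤ) 0 (diagBimod K A)).inv.hom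
    (show diagBimod K A from a)

lemma singleIn_augment (x : P.X 0) : singleIn (augment ε x) = (ε.f 0).hom x :=
  congrArg (fun t => t.hom ((ε.f 0).hom x))
    (HomologicalComplex.singleObjXSelf (ComplexShape.up ℤ) 0 (diagBimod K A)).hom_inv_id

lemma singleIn_eq_smul (a : A) : singleIn (K := K) a = a • singleIn (1 : A) := by
  refine Eq.trans ?_ (map_smul (HomologicalComplex.singleObjXSelf (ComplexShape.up ℤ) 0
    (diagBimod K A)).inv.hom (a ⊗ₜ MulOpposite.op 1 : Env K A) (show diagBimod K A from (1 : A)))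
  refine congrArg _ (Eq.trans ?_ (diagBimod_smul K A a 1 1).symm)
  change a = a * 1 * 1
  simp

lemma augment_eq_of_eq (x : P.X 0) (a : A) (h : (ε.f 0).hom x = singleIn a) :
    augment ε x = a := by
  refine (congrArg (HomologicalComplex.singleObjXSelf (ComplexShape.up ℤ) 0
    (diagBimod K A)).hom.hom h).trans ?_
  exact congrArg (fun t => t.hom (show diagBimod K A from a))
    (HomologicalComplex.singleObjXSelf (ComplexShape.up ℤ) 0 (diagBimod K A)).inv_hom_id

/-- A bounded above complex of bimodules that are projective as left modules is K-projective over
`A`. -/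
lemma isKProjective_leftRes (X : CochainComplex (ModuleCat.{v} (Env K A)) ℤ) (b : ℤ)
    [X.IsStrictlyLE b] (hX : ∀ i, Module.Projective A (X.X i)) :
    CochainComplex.IsKProjective
      (((leftRes K A).mapHomologicalComplex (ComplexShape.up ℤ)).obj X) := by
  have h1 : CochainComplex.IsStrictlyLE
    (((leftRes K A).mapHomologicalComplex (ComplexShape.up ℤ)).obj X) b := by
    rw [CochainComplex.isStrictlyLE_iff]
    intro i hi
    exact (leftRes K A).map_isZero (X.isZero_of_isStrictlyLE b i hi)
  have : ∀ i, Projective ((((leftRes K A).mapHomologicalComplex (ComplexShape.up ℤ)).obj X).X i) :=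
    fun i => (IsProjective.iff_projective (R := A) (X.X i)).1 (hX i)
  exact CochainComplex.isKProjective_of_projective _ b

/-- Over the left copy of `A`, a projective bimodule resolution `P` of `A` splits: it is homotopy
equivalent to `A`. -/
lemma exists_splitting (b : ℤ) [P.IsStrictlyLE b] (hP : ∀ i, Module.Projective (Env K A) (P.X i))
    [QuasiIso ε] : ∃ (s : P.X 0) (r : ∀ i, P.X i →ₗ[A] P.X i) (h : ∀ i j, P.X i →ₗ[A] P.X j),
      (∀ k, (P.d 0 k).hom s = 0) ∧ augment ε s = 1 ∧ (∀ x, r 0 x = augment ε x • s) ∧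
      (∀ i, i ≠ 0 → r i = 0) ∧ ∀ i j k x, i + 1 = j → j + 1 = k →
        x = r j x + (P.d i j).hom (h j i x) + h k j ((P.d j k).hom x) := by
  let F := (leftRes K A).mapHomologicalComplex (ComplexShape.up ℤ)
  let S := (HomologicalComplex.single (ModuleCat.{v} (Env K A)) (ComplexShape.up ℤ) 0).obj
      (diagBimod K A)
  have hP' : CochainComplex.IsKProjective (F.obj P) := isKProjective_leftRes P b
    fun i => projective_left_of_projective (hP i)
  have hS : CochainComplex.IsKProjective (F.obj S) := by
    refine isKProjective_leftRes S 0 fun i => ?_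
    by_cases hi : i = 0
    · subst hi
      refine Module.Projective.of_basis (ι := Unit) ?_
      let e : A ≃ₗ[A] S.X 0 := LinearEquiv.ofBijective
        (LinearMap.toSpanSingleton A (S.X 0) (singleIn (1 : A))) ⟨fun a a' haa => ?_, fun y => ?_⟩
      · exact (Module.Basis.singleton Unit A).map e
      · have h1 : a • singleIn (K := K) (1 : A) = a' • singleIn (1 : A) := haa
        rw [← singleIn_eq_smul, ← singleIn_eq_smul] at h1
        have h2 := congrArg (HomologicalComplex.singleObjXSelf (ComplexShape.up ℤ) 0
          (diagBimod K A)).hom.hom h1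
        have h3 : ∀ c : A, (HomologicalComplex.singleObjXSelf (ComplexShape.up ℤ) 0
            (diagBimod K A)).hom.hom (singleIn c) = (show diagBimod K A from c) := fun c =>
          congrArg (fun t => t.hom (show diagBimod K A from c))
            (HomologicalComplex.singleObjXSelf (ComplexShape.up ℤ) 0 (diagBimod K A)).inv_hom_id
        rw [h3, h3] at h2
        exact h2
      · refine ⟨augment (𝟙 S) y, ?_⟩
        refine (singleIn_eq_smul (augment (𝟙 S) y)).symm.trans ?_
        exact singleIn_augment (𝟙 S) y
    · have : Subsingleton (S.X i) := ⟨fun x y => by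
        rw [single_eq_zero _ i hi x, single_eq_zero _ i hi y]⟩
      infer_instance
  have hq : QuasiIso (F.map ε) := inferInstance
  obtain ⟨e, he⟩ := (CochainComplex.IsKProjective.quasiIso_iff (F.map ε)).1 hq
  have ht := Homotopy.equivSubZero e.homotopyHomInvId
  let θ : ∀ j, P.X j →ₗ[A] P.X j := fun j => ((e.hom ≫ e.inv).f j).hom
  have hθ : ∀ j x, θ j x = (e.inv.f j).hom ((ε.f j).hom x) := fun j x =>
    congrArg (fun t => (e.inv.f j).hom ((t.f j).hom x)) he
  let σ : S.X 0 →ₗ[A] P.X 0 := (e.inv.f 0).hom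
  let s : P.X 0 := σ (singleIn 1)
  let h : ∀ i j, P.X i →ₗ[A] P.X j := fun i j => -(ht.hom i j).hom
  have hd : ∀ (i j : ℤ) x, (S.d i j).hom x = 0 := fun i j x =>
    congrArg (fun t => t.hom x) (show S.d i j = 0 from rfl)
  refine ⟨s, θ, h, fun k => ?_, augment_eq_of_eq ε _ _ ?_, fun x => ?_, fun i hi => ?_,
    fun i j k x hij hjk => ?_⟩
  · refine (hom_comm e.inv 0 k (singleIn 1 : S.X 0)).trans ?_
    exact (congrArg (e.inv.f k).hom (hd 0 k _)).trans (map_zero (e.inv.f k).hom)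
  · have h1 := homotopyZero_apply (Homotopy.equivSubZero e.homotopyInvHomId) (-1) 0 1 rfl rfl
      (singleIn 1 : S.X 0)
    have h2 : ∀ y, ((F.obj S).d (-1) 0).hom y = 0 := fun y => hd (-1) 0 y
    have h3 : ((F.obj S).d 0 1).hom (singleIn 1 : S.X 0) = 0 := hd 0 1 _
    rw [h2, h3, map_zero, add_zero] at h1
    have h4 : (e.hom.f 0).hom s = (singleIn 1 : S.X 0) := sub_eq_zero.1 h1
    refine Eq.trans ?_ h4
    exact congrArg (fun t : F.obj P ⟶ F.obj S => (t.f 0).hom s) he.symm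
  · rw [hθ, ← singleIn_augment, singleIn_eq_smul]
    exact map_smul σ _ _
  · refine LinearMap.ext fun x => (hθ i x).trans ?_
    rw [single_eq_zero _ i hi ((ε.f i).hom x)]
    exact map_zero (e.inv.f i).hom
  · have h1 := homotopyZero_apply ht i j k hij hjk x
    have h2 : θ j x - x = -(P.d i j).hom (h j i x) + -h k j ((P.d j k).hom x) := by
      refine h1.trans (congrArg₂ (· + ·) ?_ ?_)
      · refine Eq.trans ?_ (map_neg (P.d i j).hom (h j i x))
        exact congrArg (P.d i j).hom (neg_neg _).symm
      · exact (neg_neg _).symm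
    rw [sub_eq_iff_eq_add] at h2
    rw [h2]
    abel

/-- A homotopy on the source shows that cocycles `z` and `z ∘ r` are cohomologous. -/
lemma RC.exists_sub_eq_δ_of_source {X : CochainComplex (ModuleCat.{v} (Env K A)) ℤ}
    (r : ∀ i, X.X i →ₗ[A] X.X i) (h : ∀ i j, X.X i →ₗ[A] X.X j)
    (H : ∀ i j k x, i + 1 = j → j + 1 = k →
      x = r j x + (X.d i j).hom (h j i x) + h k j ((X.d j k).hom x))
    (i j k : ℤ) (hij : i + 1 = j) (hjk : j + 1 = k) (z : RC X M j) (hz : RC.δ hjk z = 0) :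
    z - RC.mk (fun p q hpq => z.v p q hpq ∘ₗ r p) =
      RC.δ hij (RC.mk fun p q hpq =>
        (j.negOnePow : ℤ) • z.v (p - 1) q (by omega) ∘ₗ h p (p - 1)) := by
  subst hjk
  ext p q hpq x
  have h1 := RC.congr_v hz (p - 1) q (by omega) (h p (p - 1) x)
  rw [RC.δ_v rfl z (p - 1) q _ p (q - 1) (by omega) (by omega)] at h1
  have h2 := congrArg (z.v p q hpq) (H (p - 1) p (p + 1) x (by omega) rfl)
  rw [RC.δ_v hij _ p q hpq (p + 1) (q - 1) rfl (by omega)]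
  have h3 : (((RC.mk fun p q hpq =>
        (j.negOnePow : ℤ) • z.v (p - 1) q (by omega) ∘ₗ h p (p - 1) : RC X M i)).v
        (p + 1) q (by omega)) ((X.d p (p + 1)).hom x) =
        (j.negOnePow : ℤ) • z.v p q hpq (h (p + 1) p ((X.d p (p + 1)).hom x)) := by
    have : ∀ m (hm : m = p) w, (j.negOnePow : ℤ) • z.v m q (by omega) (h (p + 1) m w) =
        (j.negOnePow : ℤ) • z.v p q hpq (h (p + 1) p w) := by
      rintro _ rfl w; rfl
    exact this (p + 1 - 1) (by omega) _
  rw [h3, smul_smul, negOnePow_mul_self_int, one_smul]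
  simp only [sub_v, mk_v, LinearMap.sub_apply, LinearMap.comp_apply, LinearMap.smul_apply,
    map_zsmul]
  rw [map_add, map_add] at h2
  rw [zero_v, LinearMap.zero_apply, negOnePow_succ_int, neg_smul, add_neg_eq_zero] at h1
  rw [h1, smul_smul, negOnePow_mul_self_int, one_smul, sub_eq_iff_eq_add]
  refine h2.trans ?_
  abel

variable (M) in
/-- If `P` is a projective bimodule resolution of `A`, then `M → Hom_A(P, M)` is a
quasi-isomorphism. -/
lemma quasiIso_coaug (b : ℤ) [P.IsStrictlyLE b] (hP : ∀ i, Module.Projective (Env K A) (P.X i))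
    [QuasiIso ε] : QuasiIso (coaug M ε) := by
  obtain ⟨s, r, h, h1, h2, h3, h4, h5⟩ := exists_splitting ε b hP
  refine quasiIso_of_elements _ (fun i j k hij hjk y hy w hw => ?_) fun i j k hij hjk z hz => ?_
  · rw [rightHomCx_d _ _ _ _ hij] at hw
    refine ⟨RC.v w 0 i (zero_add i) s, ?_⟩
    have e1 := RC.congr_v hw 0 j (zero_add j) s
    rw [RC.δ_v hij _ 0 j _ 1 i rfl hij, h1, map_zero, smul_zero, add_zero] at e1
    refine Eq.trans ?_ e1
    refine Eq.trans ?_ (coaug_v ε j s y).symm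
    rw [h2, one_smul]
  · rw [rightHomCx_d _ _ _ _ hjk] at hz
    let w : RC P M i := RC.mk fun p q hpq =>
      (j.negOnePow : ℤ) • RC.v z (p - 1) q (by omega) ∘ₗ h p (p - 1)
    refine ⟨RC.v z 0 j (zero_add j) s, w, ?_,
      Eq.trans ?_ (congrArg (fun t => _ + t) (rightHomCx_d P M i j hij w).symm)⟩
    · have e1 := RC.congr_v hz 0 k (zero_add k) s
      rw [RC.δ_v hjk _ 0 k _ 1 j rfl hjk, h1, map_zero, smul_zero, add_zero] at e1
      exact e1
    · have e := RC.exists_sub_eq_δ_of_source r h h5 i j k hij hjk z hz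
      rw [sub_eq_iff_eq_add] at e
      refine e.trans ?_
      rw [add_comm]
      refine congrArg (fun t => t + _) ?_
      refine RC.ext fun p q hpq x => ?_
      change RC.v z p q hpq (r p x) = (toRC (coaug M ε) j (RC.v z 0 j _ s)).v p q hpq x
      by_cases hp : p = 0
      · subst hp
        obtain rfl : j = q := by omega
        rw [coaug_v, h3, map_smul]
      · rw [coaug_v_ne ε j p q hpq hp, h4 p hp, LinearMap.zero_apply, map_zero]

end Coaug

end Enveloping

/-! ### Morphisms in derived categories -/

section Derived

variable {R : Type v} [Ring R]
  {X Y : CochainComplex (ModuleCat.{v} R) ℤ}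

lemma quotient_map_eq_zero_iff (f : X ⟶ Y) :
    (HomotopyCategory.quotient (ModuleCat.{v} R) (ComplexShape.up ℤ)).map f = 0 ↔
      Nonempty (Homotopy f 0) := by
  constructor
  · intro h
    exact ⟨HomotopyCategory.homotopyOfEq _ _ (by rw [h, Functor.map_zero])⟩
  · rintro ⟨h⟩
    rw [HomotopyCategory.eq_of_homotopy _ _ h, Functor.map_zero]

variable [HasDerivedCategory.{w} (ModuleCat.{v} R)]

/-- `Q` factors through the homotopy category. -/
lemma Q_map_eq (f : X ⟶ Y) : DerivedCategory.Q.map f =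
    (DerivedCategory.quotientCompQhIso _).inv.app X ≫ DerivedCategory.Qh.map
      ((HomotopyCategory.quotient _ _).map f) ≫
      (DerivedCategory.quotientCompQhIso _).hom.app Y := by
  have := (DerivedCategory.quotientCompQhIso (ModuleCat.{v} R)).hom.naturality f
  rw [← Functor.comp_map, this, Iso.inv_hom_id_app_assoc]

lemma Q_map_eq_zero_iff_aux (f : X ⟶ Y) : DerivedCategory.Q.map f = 0 ↔
    DerivedCategory.Qh.map ((HomotopyCategory.quotient _ _).map f) = 0 := by
  rw [Q_map_eq, Preadditive.IsIso.comp_left_eq_zero, Preadditive.IsIso.comp_right_eq_zero]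

lemma Q_map_surjective_aux (h : Function.Surjective (DerivedCategory.Qh.map :
      ((HomotopyCategory.quotient (ModuleCat.{v} R) _).obj X ⟶
        (HomotopyCategory.quotient _ _).obj Y) → _)) :
    Function.Surjective (DerivedCategory.Q.map : (X ⟶ Y) → _) := by
  intro g
  obtain ⟨f, hf⟩ := h ((DerivedCategory.quotientCompQhIso _).hom.app X ≫ g ≫
    (DerivedCategory.quotientCompQhIso _).inv.app Y)
  obtain ⟨f, rfl⟩ := (HomotopyCategory.quotient _ _).map_surjective f
  refine ⟨f, ?_⟩
  rw [Q_map_eq, hf]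
  simp

lemma Q_map_surjective_of_isKInjective [Y.IsKInjective] :
    Function.Surjective (DerivedCategory.Q.map : (X ⟶ Y) → _) :=
  Q_map_surjective_aux (CochainComplex.IsKInjective.Qh_map_bijective _ Y).2

lemma Q_map_surjective_of_isKProjective [X.IsKProjective] :
    Function.Surjective (DerivedCategory.Q.map : (X ⟶ Y) → _) :=
  Q_map_surjective_aux (CochainComplex.IsKProjective.Qh_map_bijective X _).2

lemma Q_map_eq_zero_iff_of_isKInjective [Y.IsKInjective] (f : X ⟶ Y) :
    DerivedCategory.Q.map f = 0 ↔ Nonempty (Homotopy f 0) := by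
  rw [Q_map_eq_zero_iff_aux, ← quotient_map_eq_zero_iff,
    ← (CochainComplex.IsKInjective.Qh_map_bijective _ Y).1.eq_iff, Functor.map_zero]

lemma Q_map_eq_zero_iff_of_isKProjective [X.IsKProjective] (f : X ⟶ Y) :
    DerivedCategory.Q.map f = 0 ↔ Nonempty (Homotopy f 0) := by
  rw [Q_map_eq_zero_iff_aux, ← quotient_map_eq_zero_iff,
    ← (CochainComplex.IsKProjective.Qh_map_bijective X _).1.eq_iff, Functor.map_zero]

end Derived

section Enveloping

variable {K : Type u} [Field K] {A : Type v} [Ring A] [Algebra K A]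

section

variable {N M : CochainComplex (ModuleCat.{v} A) ℤ}
  {P : CochainComplex (ModuleCat.{v} (Env K A)) ℤ}
  (ε : P ⟶ (HomologicalComplex.single (ModuleCat.{v} (Env K A)) (ComplexShape.up ℤ) 0).obj
      (diagBimod K A))

lemma resUnit_add (f g : N ⟶ M) :
    resUnit (K := K) ε (f + g) = resUnit ε f + resUnit ε g := by
  refine resUnit_ext ε _ (fun x p y => ?_) (fun i hi x => ?_)
  · change (toLC (resUnit ε f) 0 x).v _ _ _ y + (toLC (resUnit ε g) 0 x).v _ _ _ y = _
    rw [toLC_resUnit_zero, toLC_resUnit_zero, ← smul_add]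
    rfl
  · change toLC (resUnit ε f) i x + toLC (resUnit ε g) i x = 0
    rw [toLC_resUnit_ne ε f i hi x, toLC_resUnit_ne ε g i hi x, add_zero]

lemma env_algebraMap_smul {V : Type v} [AddCommGroup V] [Module (Env K A) V] [Module K V]
    [IsScalarTower K (Env K A) V] (k : K) (x : V) : (algebraMap K (Env K A) k) • x = k • x :=
  algebraMap_smul (Env K A) k x

lemma resUnit_smul (k : K) (f : N ⟶ M) :
    resUnit (K := K) ε (k • f) = k • resUnit ε f := by
  refine resUnit_ext ε _ (fun x p y => ?_) (fun i hi x => ?_)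
  · have h : toLC (k • resUnit ε f) 0 x = k • toLC (resUnit ε f) 0 x :=
      env_algebraMap_smul (A := A) k (toLC (resUnit ε f) 0 x)
    rw [h, LC.smul_v, LinearMap.smul_apply, toLC_resUnit_zero, smul_comm]
    rfl
  · have h : toLC (k • resUnit ε f) i x = k • toLC (resUnit ε f) i x :=
      env_algebraMap_smul (A := A) k (toLC (resUnit ε f) i x)
    rw [h, toLC_resUnit_ne ε f i hi x, smul_zero]

variable (N M) in
/-- `resUnit` as a linear map. -/
def resUnitLinear : (N ⟶ M) →ₗ[K] (P ⟶ homCx K N M) where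
  toFun f := resUnit ε f
  map_add' := resUnit_add ε
  map_smul' := resUnit_smul ε

variable [HasDerivedCategory.{w₁} (ModuleCat.{v} A)]
  [HasDerivedCategory.{w₃} (ModuleCat.{v} (Env K A))]

/-- A quasi-isomorphism between K-injective complexes detects null-homotopic morphisms. -/
lemma homotopy_comp_iff {M' : CochainComplex (ModuleCat.{v} A) ℤ} [M.IsKInjective] [M'.IsKInjective]
    (η : M ⟶ M') [QuasiIso η] (f : N ⟶ M) :
    Nonempty (Homotopy (f ≫ η) 0) ↔ Nonempty (Homotopy f 0) := by
  rw [← Q_map_eq_zero_iff_of_isKInjective, ← Q_map_eq_zero_iff_of_isKInjective, Functor.map_comp]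
  have : IsIso (DerivedCategory.Q.map η) := inferInstance
  rw [Preadditive.IsIso.comp_right_eq_zero]

variable (N M) in
/-- Morphisms `N → M` in the derived category of `A` are the same as morphisms `A → Hom_K(N, M)` in
the derived category of bimodules. -/
lemma exists_linearEquiv_resUnit (b : ℤ) [P.IsStrictlyLE b] [P.IsKProjective]
    (hP : ∀ i, Module.Projective (Env K A) (P.X i)) [QuasiIso ε] [M.IsKInjective] :
    ∃ E : (DerivedCategory.Q.obj N ⟶ DerivedCategory.Q.obj M) ≃ₗ[K]
      (DerivedCategory.Q.obj P ⟶ DerivedCategory.Q.obj (homCx K N M)),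
      ∀ f : N ⟶ M, E (DerivedCategory.Q.map f) = DerivedCategory.Q.map (resUnit ε f) := by
  have hη := quasiIso_coaug M ε b hP
  have hinj := rightHomCx_isKInjective P M
  have hnull : ∀ f : N ⟶ M, Nonempty (Homotopy (resUnit ε f) 0) ↔ Nonempty (Homotopy f 0) := by
    intro f
    rw [← swapHom_null_iff, swapHom_resUnit, homotopy_comp_iff]
  refine exists_linearEquiv_of_surjective
    (DerivedCategory.Q.mapLinearMap K : (N ⟶ M) →ₗ[K] _) Q_map_surjective_of_isKInjective
    (DerivedCategory.Q.mapLinearMap K : (P ⟶ homCx K N M) →ₗ[K] _) (resUnitLinear N M ε)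
    (fun f => ?_) (fun φ => ?_)
  · refine (Q_map_eq_zero_iff_of_isKInjective f).trans ((hnull f).symm.trans ?_)
    exact (Q_map_eq_zero_iff_of_isKProjective (resUnit ε f)).symm
  · obtain ⟨φ, rfl⟩ := Q_map_surjective_of_isKProjective φ
    obtain ⟨f, hf⟩ := Q_map_surjective_of_isKInjective
      (DerivedCategory.Q.map (swapHom φ) ≫ inv (DerivedCategory.Q.map (coaug M ε)))
    refine ⟨f, ?_⟩
    have h1 : DerivedCategory.Q.map (swapHom (resUnit ε f - φ)) = 0 := by
      rw [swapHom_sub, swapHom_resUnit, Functor.map_sub, Functor.map_comp, hf]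
      simp
    rw [Q_map_eq_zero_iff_of_isKInjective, swapHom_null_iff,
      ← Q_map_eq_zero_iff_of_isKProjective, Functor.map_sub, sub_eq_zero] at h1
    exact h1

end

/-! ### The dual of a bounded complex of finitely generated projective bimodules -/

section DualBasis

/-- An element of the bimodule `Hom_{Aᵉ}(V, Aᵉ)` given by a linear map. -/
def toDual {V : ModuleCat.{v} (Env K A)} (w : V →ₗ[Env K A] Env K A) : dualObj K A V := w

/-- The linear map underlying an element of the bimodule `Hom_{Aᵉ}(V, Aᵉ)`. -/
def ofDual {V : ModuleCat.{v} (Env K A)} (w : dualObj K A V) : V →ₗ[Env K A] Env K A := w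

lemma ofDual_smul {V : ModuleCat.{v} (Env K A)} (b : Env K A) (w : dualObj K A V) (x : V) :
    ofDual (b • w) x = ofDual w x * (swapEnv K A b).unop := rfl

lemma ofDual_sum {V : ModuleCat.{v} (Env K A)} {ι : Type*} (s : Finset ι) (w : ι → dualObj K A V)
    (x : V) : ofDual (∑ i ∈ s, w i) x = ∑ i ∈ s, ofDual (w i) x := by
  classical
  induction s using Finset.induction_on with
  | empty => rfl
  | insert a s ha ih =>
    rw [Finset.sum_insert ha, Finset.sum_insert ha, ← ih]
    rfl

/-- A finitely generated projective bimodule has a finite dual basis. -/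
lemma exists_dual_basis (V : ModuleCat.{v} (Env K A)) [Module.Finite (Env K A) V]
    [Module.Projective (Env K A) V] :
    ∃ (n : ℕ) (w : Fin n → (V →ₗ[Env K A] Env K A)) (β : Fin n → V),
      ∀ x, ∑ i, w i x • β i = x := by
  obtain ⟨n, f, g, -, -, hfg⟩ := Module.Finite.exists_comp_eq_id_of_projective (Env K A) V
  refine ⟨n, fun i => LinearMap.proj i ∘ₗ g, fun i => f (Pi.single i 1), fun x => ?_⟩
  refine Eq.trans ?_ (LinearMap.congr_fun hfg x)
  rw [LinearMap.comp_apply]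
  conv_rhs => rw [← Finset.univ_sum_single (g x), map_sum]
  refine Finset.sum_congr rfl fun i _ => ?_
  rw [← map_smul]
  congr 1
  ext j
  by_cases h : j = i
  · subst h; simp
  · simp [h]

/-- The element of `Aᵉ` whose action on `Hom_{Aᵉ}(V, Aᵉ)` is right multiplication by `b`. It
expresses elements of the dual in terms of a dual basis. -/
def dualCoeff (b : Env K A) : Env K A := (swapEnv K A).symm (MulOpposite.op b)

lemma swapEnv_dualCoeff (b : Env K A) : (swapEnv K A (dualCoeff b)).unop = b := by
  simp [dualCoeff]

/-- The coordinate functions `w i` of a dual basis generate the dual bimodule. -/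
lemma sum_dualCoeff_smul {V : ModuleCat.{v} (Env K A)} {n : ℕ}
    (w : Fin n → (V →ₗ[Env K A] Env K A)) (β : Fin n → V) (h : ∀ x, ∑ i, w i x • β i = x)
    (f : dualObj K A V) : ∑ i, dualCoeff (ofDual f (β i)) • toDual (w i) = f := by
  suffices H : ∀ x, ofDual (∑ i, dualCoeff (ofDual f (β i)) • toDual (w i)) x = ofDual f x from
    LinearMap.ext H
  intro x
  rw [ofDual_sum]
  conv_rhs => rw [← h x, map_sum]
  refine Finset.sum_congr rfl fun i _ => ?_
  rw [ofDual_smul, swapEnv_dualCoeff, map_smul]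
  rfl

/-- The dual of a finitely generated projective bimodule is projective. -/
lemma projective_dualObj (V : ModuleCat.{v} (Env K A)) [Module.Finite (Env K A) V]
    [Module.Projective (Env K A) V] : Module.Projective (Env K A) (dualObj K A V) := by
  obtain ⟨n, w, β, h⟩ := exists_dual_basis V
  refine Module.Projective.of_split (R := Env K A) (M := Fin n → Env K A) (P := dualObj K A V)
    { toFun := fun f i => dualCoeff (ofDual f (β i)), map_add' := fun f g => ?_,
      map_smul' := fun b f => ?_ } (Fintype.linearCombination (Env K A) fun i => toDual (w i)) ?_
  · funext i
    exact map_add ((swapEnv K A).symm.toAddEquiv.toAddMonoidHom.comp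
      MulOpposite.opAddEquiv.toAddMonoidHom) (ofDual f (β i)) (ofDual g (β i))
  · funext i
    change (swapEnv K A).symm (MulOpposite.op (ofDual f (β i) * (swapEnv K A b).unop)) = _
    rw [MulOpposite.op_mul, map_mul, MulOpposite.op_unop, AlgEquiv.symm_apply_apply]
    rfl
  · refine LinearMap.ext fun f => ?_
    exact sum_dualCoeff_smul w β h f

end DualBasis

section Rank

/-- The morphism `x ↦ w x • y`. -/
def rankOne {V W : ModuleCat.{v} (Env K A)} (w : V →ₗ[Env K A] Env K A) (y : W) : V ⟶ W :=
  ModuleCat.ofHom (LinearMap.toSpanSingleton (Env K A) W y ∘ₗ w)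

lemma rankOne_comp {V W W' : ModuleCat.{v} (Env K A)} (w : V →ₗ[Env K A] Env K A) (y : W)
    (g : W ⟶ W') : rankOne w y ≫ g = rankOne w (g.hom y) :=
  ModuleCat.hom_ext (LinearMap.ext fun x => map_smul g.hom (w x) y)

lemma comp_rankOne {V V' W : ModuleCat.{v} (Env K A)} (w : V →ₗ[Env K A] Env K A) (y : W)
    (g : V' ⟶ V) : g ≫ rankOne w y = rankOne (w ∘ₗ g.hom) y := rfl

lemma rankOne_add_left {V W : ModuleCat.{v} (Env K A)} (w w' : V →ₗ[Env K A] Env K A) (y : W) :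
    rankOne (w + w') y = rankOne w y + rankOne w' y :=
  ModuleCat.hom_ext (LinearMap.ext fun x => add_smul (w x) (w' x) y)

lemma rankOne_add_right {V W : ModuleCat.{v} (Env K A)} (w : V →ₗ[Env K A] Env K A) (y y' : W) :
    rankOne w (y + y') = rankOne w y + rankOne w y' :=
  ModuleCat.hom_ext (LinearMap.ext fun x => smul_add (w x) y y')

lemma rankOne_smul_left {V W : ModuleCat.{v} (Env K A)} (b : Env K A) (w : dualObj K A V) (y : W) :
    rankOne (ofDual (b • w)) y = rankOne (ofDual w) ((swapEnv K A b).unop • y) :=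
  ModuleCat.hom_ext (LinearMap.ext fun x => mul_smul (ofDual w x) _ y)

lemma rankOne_smul_right {V W : ModuleCat.{v} (Env K A)} (w : V →ₗ[Env K A] Env K A) (k : K)
    (y : W) : rankOne w (k • y) = k • rankOne w y :=
  ModuleCat.hom_ext (LinearMap.ext fun x => smul_comm (w x) k y)

end Rank

/-- Finite dual bases for the terms of a complex which is nonzero in finitely many degrees only. -/
structure FiniteDualBasis (P : CochainComplex (ModuleCat.{v} (Env K A)) ℤ) where
  /-- A finite set that contains the negatives of all degrees in which the complex is nonzero. -/
  supp : Finset ℤ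
  eq_zero : ∀ n, n ∉ supp → ∀ x : P.X (-n), x = 0
  /-- The lengths of the dual bases. -/
  card : ℤ → ℕ
  /-- The coordinate functions. -/
  coord : ∀ n, Fin (card n) → (P.X (-n) →ₗ[Env K A] Env K A)
  /-- The basis vectors. -/
  vec : ∀ n, Fin (card n) → P.X (-n)
  sum_eq : ∀ n x, ∑ i, coord n i x • vec n i = x

lemma nonempty_finiteDualBasis (P : CochainComplex (ModuleCat.{v} (Env K A)) ℤ) (a b : ℤ)
    [P.IsStrictlyGE a] [P.IsStrictlyLE b]
    (hP : ∀ i, Module.Finite (Env K A) (P.X i) ∧ Module.Projective (Env K A) (P.X i)) :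
    Nonempty (FiniteDualBasis P) := by
  have h : ∀ n : ℤ, ∃ (r : ℕ) (w : Fin r → (P.X (-n) →ₗ[Env K A] Env K A))
      (β : Fin r → P.X (-n)), ∀ x, ∑ i, w i x • β i = x := fun n => by
    have := (hP (-n)).1
    have := (hP (-n)).2
    exact exists_dual_basis (P.X (-n))
  choose r w β h using h
  refine ⟨⟨Finset.Icc (-b) (-a), fun n hn x => ?_, r, w, β, h⟩⟩
  have : Subsingleton (P.X (-n)) := by
    rw [Finset.mem_Icc, not_and_or] at hn
    rcases hn with hn | hn
    · exact ModuleCat.isZero_iff_subsingleton.1 (P.isZero_of_isStrictlyLE b (-n) (by omega))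
    · exact ModuleCat.isZero_iff_subsingleton.1 (P.isZero_of_isStrictlyGE a (-n) (by omega))
  exact Subsingleton.elim _ _

/-- The dual of a bounded below complex of finitely generated projectives is bounded above with
projective terms, hence K-projective. -/
lemma isKProjective_dualComplex (P : CochainComplex (ModuleCat.{v} (Env K A)) ℤ) (a : ℤ)
    [P.IsStrictlyGE a]
    (hP : ∀ i, Module.Finite (Env K A) (P.X i) ∧ Module.Projective (Env K A) (P.X i)) :
    (dualComplex K A P).IsKProjective := by
  have h1 : (dualComplex K A P).IsStrictlyLE (-a) := by
    rw [CochainComplex.isStrictlyLE_iff]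
    intro i hi
    refine ModuleCat.isZero_iff_subsingleton.2 ⟨fun f g => ?_⟩
    let f' : P.X (-i) →ₗ[Env K A] Env K A := f
    let g' : P.X (-i) →ₗ[Env K A] Env K A := g
    have : Subsingleton (P.X (-i)) :=
      ModuleCat.isZero_iff_subsingleton.1 (P.isZero_of_isStrictlyGE a (-i) (by omega))
    have h2 : f' = g' := LinearMap.ext fun x => by
      rw [Subsingleton.elim x 0, map_zero, map_zero]
    exact h2
  have : ∀ i, Projective ((dualComplex K A P).X i) := fun i => by
    have := (hP (-i)).1
    have := (hP (-i)).2
    have h2 : Projective (dualObj K A (P.X (-i))) :=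
      (IsProjective.iff_projective (dualObj K A (P.X (-i)))).1 (projective_dualObj (P.X (-i)))
    exact h2
  exact CochainComplex.isKProjective_of_projective _ (-a)

/-! ### The duality between `Hom(Hom(P, Aᵉ), DY)` and `Hom(P, Y)` -/

section Pairing

open CochainComplex.HomComplex

variable (L : Type v) [AddCommGroup L] [Module K L]
  {P Y Y' : CochainComplex (ModuleCat.{v} (Env K A)) ℤ}

variable {L} in
/-- A linear functional on cochains is determined by its values on cochains of rank one. -/
lemma functional_ext (β : FiniteDualBasis P) {m : ℤ} (ν : ℤ → ℤ) (hν : ∀ n, -n + m = -ν n)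
    (l l' : Cochain P Y m →ₗ[K] L)
    (h : ∀ n (w : P.X (-n) →ₗ[Env K A] Env K A) (y : Y.X (-ν n)),
      l (Cochain.single (rankOne w y) m) = l' (Cochain.single (rankOne w y) m)) : l = l' := by
  refine LinearMap.ext fun z => ?_
  have hz : z = ∑ n ∈ β.supp, ∑ i, Cochain.single (rankOne (β.coord n i)
      ((z.v (-n) (-ν n) (hν n)).hom (β.vec n i))) m := by
    ext p q hpq x
    obtain ⟨n, rfl⟩ : ∃ n, p = -n := ⟨-p, by simp⟩
    obtain rfl : q = -ν n := by rw [← hν, hpq]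
    let e : Cochain P Y m →+ Y.X (-ν n) :=
      AddMonoidHom.mk' (fun z => (z.v (-n) (-ν n) hpq).hom x) (fun _ _ => rfl)
    have h1 : ∀ n' ≠ n, ∀ i, e (Cochain.single (rankOne (β.coord n' i)
        ((z.v (-n') (-ν n') (hν n')).hom (β.vec n' i))) m) = 0 := fun n' hn i =>
      congrArg (fun t : P.X (-n) ⟶ Y.X (-ν n) => t.hom x)
        (Cochain.single_v_eq_zero (rankOne (β.coord n' i)
          ((z.v (-n') (-ν n') (hν n')).hom (β.vec n' i))) m (-n) (-ν n) hpq (by omega))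
    have h2 : ∀ i, e (Cochain.single (rankOne (β.coord n i)
        ((z.v (-n) (-ν n) (hν n)).hom (β.vec n i))) m) =
        (z.v (-n) (-ν n) (hν n)).hom (β.coord n i x • β.vec n i) := fun i =>
      (congrArg (fun t : P.X (-n) ⟶ Y.X (-ν n) => t.hom x)
        (Cochain.single_v (rankOne (β.coord n i)
          ((z.v (-n) (-ν n) (hν n)).hom (β.vec n i))) m hpq)).trans
        (map_smul (z.v (-n) (-ν n) (hν n)).hom _ _).symm
    change e z = e _
    rw [map_sum, Finset.sum_eq_single n]
    · rw [map_sum, Finset.sum_congr rfl fun i _ => h2 i, ← map_sum, β.sum_eq]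
      rfl
    · intro n' _ hn
      rw [map_sum, Finset.sum_eq_zero fun i _ => h1 n' hn i]
    · intro hn
      rw [map_sum, Finset.sum_congr rfl fun i _ => h2 i, ← map_sum, β.sum_eq,
        β.eq_zero n hn x, map_zero]
  rw [hz]
  simp only [map_sum, h]

/-- The functional on cochains of degree `m` attached to maps `φ n : Hom_{Aᵉ}(P⁻ⁿ, Aᵉ) → D(Y⁻ᵛⁿ)`,
where `ν n = n - m`. Up to a sign, it takes the value `φ n w y` on the cochain of rank one given by
`w` and `y`. The function `ν` is a parameter, subject to the equation `hν`, so that for a concrete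
`m` it can be given a convenient form. -/
def pairFun (β : FiniteDualBasis P) {m : ℤ} (ν : ℤ → ℤ) (hν : ∀ n, -n + m = -ν n)
    (φ : ∀ n, dualObj K A (P.X (-n)) → (Y.X (-ν n) →ₗ[K] L)) : Cochain P Y m →ₗ[K] L where
  toFun z := ∑ n ∈ β.supp, ∑ i, (n.negOnePow : ℤ) • φ n (toDual (β.coord n i))
      ((z.v (-n) (-ν n) (hν n)).hom (β.vec n i))
  map_add' z z' := by
    simp only [Cochain.add_v, ModuleCat.hom_add, LinearMap.add_apply, map_add, smul_add,
      Finset.sum_add_distrib]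
  map_smul' k z := by
    have : ∀ n (x : P.X (-n)), ((k • z).v (-n) (-ν n) (hν n)).hom x =
        k • (z.v (-n) (-ν n) (hν n)).hom x := fun n x => rfl
    simp only [this, map_smul, Finset.smul_sum, smul_comm k, RingHom.id_apply]

variable {L} in
/-- The value of the functional on a cochain of rank one. It does not depend on the dual basis. -/
lemma pairFun_single (β : FiniteDualBasis P) {m : ℤ} (ν : ℤ → ℤ) (hν : ∀ n, -n + m = -ν n)
    (φ : ∀ n, dualObj K A (P.X (-n)) →ₗ[Env K A] (Y.X (-ν n) →ₗ[K] L)) (n : ℤ)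
    (w : P.X (-n) →ₗ[Env K A] Env K A) (y : Y.X (-ν n)) :
    pairFun L β ν hν (fun n w => φ n w) (Cochain.single (rankOne w y) m) =
      (n.negOnePow : ℤ) • φ n (toDual w) y := by
  have h1 : ∀ n' ≠ n, ∀ i, (n'.negOnePow : ℤ) • φ n' (toDual (β.coord n' i))
      (((Cochain.single (rankOne w y) m).v (-n') (-ν n') (hν n')).hom (β.vec n' i)) = 0 := by
    intro n' hn i
    rw [Cochain.single_v_eq_zero _ m (-n') (-ν n') (hν n') (by omega)]
    simp
  have h2 : ∀ i, (n.negOnePow : ℤ) • φ n (toDual (β.coord n i))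
      (((Cochain.single (rankOne w y) m).v (-n) (-ν n) (hν n)).hom (β.vec n i)) =
      (n.negOnePow : ℤ) • φ n (dualCoeff (ofDual (toDual w) (β.vec n i)) •
        toDual (β.coord n i)) y := by
    intro i
    rw [Cochain.single_v, map_smul, env_smul_dual_apply, swapEnv_dualCoeff]
    rfl
  have h3 : ∑ i, (n.negOnePow : ℤ) • φ n (dualCoeff (ofDual (toDual w) (β.vec n i)) •
      toDual (β.coord n i)) y = (n.negOnePow : ℤ) • φ n (toDual w) y := by
    rw [← Finset.smul_sum]
    congr 1
    conv_rhs => rw [← sum_dualCoeff_smul (β.coord n) (β.vec n) (β.sum_eq n) (toDual w), map_sum]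
    rw [LinearMap.sum_apply]
  change ∑ n' ∈ β.supp, ∑ i, _ = _
  rw [Finset.sum_eq_single n (fun n' _ hn => Finset.sum_eq_zero fun i _ => h1 n' hn i),
    Finset.sum_congr rfl fun i _ => h2 i, h3]
  intro hn
  rw [Finset.sum_congr rfl fun i _ => h2 i, h3]
  have h4 : w = 0 := LinearMap.ext fun x => by
    rw [β.eq_zero n hn x, map_zero, map_zero]
  have h5 : toDual w = 0 := h4
  rw [h5, map_zero, LinearMap.zero_apply, smul_zero]

end Pairing

section Pairing

open CochainComplex.HomComplex

variable {L : Type v} [AddCommGroup L] [Module K L]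
  {P Y Y' : CochainComplex (ModuleCat.{v} (Env K A)) ℤ}

lemma single_add {p q : ℤ} (f g : P.X p ⟶ Y.X q) (n : ℤ) :
    Cochain.single (f + g) n = Cochain.single f n + Cochain.single g n := by
  ext p' q' h : 3
  rw [Cochain.add_v]
  by_cases hp : p' = p
  · by_cases hq : q' = q
    · subst hp hq
      simp only [Cochain.single_v]
    · simp only [Cochain.single_v_eq_zero' _ n p' q' h hq, add_zero]
  · simp only [Cochain.single_v_eq_zero _ n p' q' h hp, add_zero]

lemma single_smul {p q : ℤ} (k : K) (f : P.X p ⟶ Y.X q) (n : ℤ) :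
    Cochain.single (k • f) n = k • Cochain.single f n := by
  ext p' q' h : 3
  rw [Cochain.smul_v]
  by_cases hp : p' = p
  · by_cases hq : q' = q
    · subst hp hq
      simp only [Cochain.single_v]
    · simp only [Cochain.single_v_eq_zero' _ n p' q' h hq, smul_zero]
  · simp only [Cochain.single_v_eq_zero _ n p' q' h hp, smul_zero]

/-- The maps `Hom_{Aᵉ}(P⁻ⁱ, Aᵉ) → D(Y⁻ʲ)` attached to a functional on cochains. -/
def fromFun {m : ℤ} (l : Cochain P Y m →ₗ[K] L) (i j : ℤ) :
    dualObj K A (P.X (-i)) →ₗ[Env K A] (Y.X (-j) →ₗ[K] L) where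
  toFun w :=
    { toFun := fun y => (i.negOnePow : ℤ) • l (Cochain.single (rankOne (ofDual w) y) m)
      map_add' := fun y y' => by rw [rankOne_add_right, single_add, map_add, smul_add]
      map_smul' := fun k y => by
        rw [rankOne_smul_right, single_smul, map_smul, smul_comm, RingHom.id_apply] }
  map_add' w w' := LinearMap.ext fun y => by
    change (i.negOnePow : ℤ) • l (Cochain.single (rankOne (ofDual w + ofDual w') y) m) = _
    rw [rankOne_add_left, single_add, map_add, smul_add]
    rfl
  map_smul' b w := LinearMap.ext fun y => by
    change (i.negOnePow : ℤ) • l (Cochain.single (rankOne (ofDual (b • w)) y) m) = _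
    rw [rankOne_smul_left]
    rfl

/-- The components of a morphism from the dual of `P` to the `K`-dual of `Y`. -/
def dualComp (φ : dualComplex K A P ⟶ dualCx K L Y) (n : ℤ) :
    dualObj K A (P.X (-n)) →ₗ[Env K A] (Y.X (-n) →ₗ[K] L) := (φ.f n).hom

lemma dualComp_d (φ : dualComplex K A P ⟶ dualCx K L Y) (i j : ℤ) (h : i + 1 = j)
    (w : P.X (-i) →ₗ[Env K A] Env K A) (y : Y.X (-j)) :
    dualComp φ i (toDual w) ((Y.d (-j) (-i)).hom y) =
      dualComp φ j (toDual (w ∘ₗ (P.d (-j) (-i)).hom)) y := by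
  have := hom_comm φ i j w
  rw [dualCx_d L _ _ _ h] at this
  exact LinearMap.congr_fun this y

instance (V : Type v) [AddCommGroup V] [Module (Env K A) V] [Module K V]
    [IsScalarTower K (Env K A) V] : IsScalarTower K (Env K A) (V →ₗ[K] L) where
  smul_assoc k b l := LinearMap.ext fun x => by
    rw [LinearMap.smul_apply, env_smul_dual_apply, env_smul_dual_apply,
      map_smul (swapEnv K A), MulOpposite.unop_smul, smul_assoc, map_smul]

variable (L Y) in
/-- The pairing between morphisms from the dual of `P` to the `K`-dual of `Y` and morphisms
from `P` to `Y`, extended to all cochains of degree zero. -/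
def dualPair (β : FiniteDualBasis P) :
    (dualComplex K A P ⟶ dualCx K L Y) →ₗ[K] Cochain P Y 0 →ₗ[K] L where
  toFun φ := pairFun L β id (fun n => add_zero _) fun n w => dualComp φ n w
  map_add' φ φ' := functional_ext β id (fun n => add_zero _) _ _ fun n w y => by
    rw [LinearMap.add_apply, pairFun_single, pairFun_single, pairFun_single, ← smul_add]
    rfl
  map_smul' k φ := functional_ext β id (fun n => add_zero _) _ _ fun n w y => by
    rw [RingHom.id_apply, LinearMap.smul_apply, pairFun_single, pairFun_single, smul_comm k]
    have h : dualComp (k • φ) n (toDual w) = k • dualComp φ n (toDual w) :=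
      env_algebraMap_smul (A := A) k (dualComp φ n (toDual w))
    rw [h]
    rfl

lemma dualPair_single (β : FiniteDualBasis P) (φ : dualComplex K A P ⟶ dualCx K L Y) (n : ℤ)
    (w : P.X (-n) →ₗ[Env K A] Env K A) (y : Y.X (-n)) :
    dualPair L Y β φ (Cochain.single (rankOne w y) 0) =
      (n.negOnePow : ℤ) • dualComp φ n (toDual w) y :=
  pairFun_single β id _ (dualComp φ) n w y

lemma δ_single_rankOne {n m : ℤ} (hm : n + 1 = m) (p q p' q' : ℤ) (hp : p' + 1 = p)
    (hq : q + 1 = q') (w : P.X p →ₗ[Env K A] Env K A) (y : Y.X q) :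
    δ n m (Cochain.single (rankOne w y) n) = Cochain.single (rankOne w ((Y.d q q').hom y)) m +
      m.negOnePow • Cochain.single (rankOne (w ∘ₗ (P.d p' p).hom) y) m := by
  rw [Cochain.δ_single _ n m hm p' q' hp hq, rankOne_comp, comp_rankOne]

/-- The functional attached to a morphism of complexes vanishes on coboundaries. -/
lemma dualPair_δ (β : FiniteDualBasis P) (φ : dualComplex K A P ⟶ dualCx K L Y)
    (z : Cochain P Y (-1)) : dualPair L Y β φ (δ (-1) 0 z) = 0 := by
  suffices h : dualPair L Y β φ ∘ₗ δ_hom K P Y (-1) 0 = 0 from LinearMap.congr_fun h z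
  refine functional_ext β (fun n => n + 1) (fun n => by ring) _ _ fun n w y => ?_
  rw [LinearMap.comp_apply, LinearMap.zero_apply]
  change dualPair L Y β φ (δ (-1) 0 (Cochain.single (rankOne w y) (-1))) = 0
  rw [δ_single_rankOne (by norm_num) (-n) (-(n + 1)) (-(n + 1)) (-n) (by ring) (by ring),
    Int.negOnePow_zero, one_smul, map_add, dualPair_single, dualPair_single,
    dualComp_d φ n (n + 1) rfl, negOnePow_succ_int, neg_smul, add_neg_cancel]

/-- The morphism of complexes attached to a functional on cochains that vanishes on
coboundaries. -/
def ofFunctional (l : Cochain P Y 0 →ₗ[K] L) (hl : ∀ z, l (δ (-1) 0 z) = 0) :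
    dualComplex K A P ⟶ dualCx K L Y :=
  mkHom (F := dualComplex K A P) (G := dualCx K L Y) (fun n => fromFun l n n)
    (fun i j hij w => by
      rw [dualCx_d L _ _ _ hij]
      refine LinearMap.ext fun y => ?_
      have h := hl (Cochain.single (rankOne (ofDual (V := P.X (-i)) w) y) (-1))
      rw [δ_single_rankOne (by norm_num) (-i) (-j) (-j) (-i) (by omega) (by omega),
        Int.negOnePow_zero, one_smul, map_add, add_eq_zero_iff_eq_neg] at h
      change (i.negOnePow : ℤ) • l _ = (j.negOnePow : ℤ) • l _
      subst hij
      rw [negOnePow_succ_int, neg_smul, ← smul_neg]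
      exact congrArg _ h)

lemma dualPair_ofFunctional (β : FiniteDualBasis P) (l : Cochain P Y 0 →ₗ[K] L)
    (hl : ∀ z, l (δ (-1) 0 z) = 0) : dualPair L Y β (ofFunctional l hl) = l := by
  refine functional_ext β id (fun n => add_zero _) _ _ fun n w y => ?_
  refine (dualPair_single β _ n w y).trans ?_
  change (n.negOnePow : ℤ) • (n.negOnePow : ℤ) • l _ = _
  rw [smul_smul, negOnePow_mul_self_int, one_smul]
  rfl

/-- A morphism is null-homotopic if and only if the functional attached to it vanishes on
cocycles. -/
lemma dualPair_null_iff (β : FiniteDualBasis P) (φ : dualComplex K A P ⟶ dualCx K L Y) :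
    Nonempty (Homotopy φ 0) ↔ ∀ f : P ⟶ Y, dualPair L Y β φ (Cochain.ofHom f) = 0 := by
  constructor
  · rintro ⟨h⟩ f
    let hc : ∀ i j : ℤ, dualObj K A (P.X (-i)) →ₗ[Env K A] (Y.X (-j) →ₗ[K] L) :=
      fun i j => (h.hom i j).hom
    let μ : Cochain P Y 1 →ₗ[K] L := pairFun L β (fun n => n - 1) (fun n => by ring)
      fun n w => hc n (n - 1) w
    have hμ : ∀ i j (hij : j + 1 = i) w y, μ (Cochain.single (rankOne w y) 1) =
        (i.negOnePow : ℤ) • hc i j (toDual w) y := by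
      intro i j hij w y
      obtain rfl : j = i - 1 := by omega
      exact pairFun_single β (fun n => n - 1) _ (fun n => hc n (n - 1)) i w y
    have key : dualPair L Y β φ = μ ∘ₗ δ_hom K P Y 0 1 := by
      refine functional_ext β id (fun n => add_zero _) _ _ fun n w y => ?_
      refine (dualPair_single β φ n w y).trans ?_
      change _ = μ (δ 0 1 (Cochain.single (rankOne w y) 0))
      rw [δ_single_rankOne (zero_add 1) (-n) (-n) (-(n + 1)) (-(n - 1)) (by ring) (by ring),
        Int.negOnePow_one, Units.neg_smul, one_smul, map_add, map_neg, hμ n (n - 1) (by ring),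
        hμ (n + 1) n rfl, negOnePow_succ_int, neg_smul, neg_neg, ← smul_add]
      congr 1
      have := homotopyZero_apply h (n - 1) n (n + 1) (by ring) rfl w
      rw [dualCx_d L _ _ _ (by ring)] at this
      exact LinearMap.congr_fun this y
    rw [key]
    change μ (δ 0 1 (Cochain.ofHom f)) = 0
    rw [δ_ofHom, map_zero]
  · intro h
    obtain ⟨μ, hμ⟩ := exists_comp_eq_of_ker_le (δ_hom K P Y 0 1) (dualPair L Y β φ) fun z hz => by
      have := h (Cocycle.homOf (Cocycle.mk z 1 (zero_add 1) hz))
      rwa [Cocycle.cochain_ofHom_homOf_eq_coe] at this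
    refine ⟨mkHomotopyZero (F := dualComplex K A P) (G := dualCx K L Y) φ
      (fun i j _ => fromFun μ i j) fun i j k hij hjk w => ?_⟩
    rw [dualCx_d L _ _ _ hij]
    refine LinearMap.ext fun y => ?_
    have h1 := LinearMap.congr_fun hμ
      (Cochain.single (rankOne (ofDual (V := P.X (-j)) w) y) 0)
    rw [dualPair_single] at h1
    change μ (δ 0 1 (Cochain.single (rankOne (ofDual (V := P.X (-j)) w) y) 0)) = _ at h1
    rw [δ_single_rankOne (zero_add 1) (-j) (-j) (-k) (-i) (by omega) (by omega),
      Int.negOnePow_one, Units.neg_smul, one_smul, map_add, map_neg] at h1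
    have h2 := congrArg (fun t => (j.negOnePow : ℤ) • t) h1
    simp only [smul_smul, negOnePow_mul_self_int, one_smul] at h2
    refine h2.symm.trans ?_
    change _ = (j.negOnePow : ℤ) • μ _ + (k.negOnePow : ℤ) • μ _
    subst hjk
    rw [negOnePow_succ_int, neg_smul, smul_add, smul_neg]
    rfl

/-- The pairing is natural in `Y`. -/
lemma dualPair_comp (β : FiniteDualBasis P) (φ : dualComplex K A P ⟶ dualCx K L Y') (g : Y ⟶ Y')
    (f : P ⟶ Y) : dualPair L Y β (φ ≫ dualCxMap K L g) (Cochain.ofHom f) =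
      dualPair L Y' β φ (Cochain.ofHom (f ≫ g)) := by
  let c : Cochain P Y 0 →ₗ[K] Cochain P Y' 0 :=
    { toFun := fun z => z.comp (Cochain.ofHom g) (add_zero 0)
      map_add' := fun z z' => Cochain.add_comp _ _ _ _
      map_smul' := fun k z => Cochain.smul_comp _ _ _ _ }
  have key : dualPair L Y β (φ ≫ dualCxMap K L g) = dualPair L Y' β φ ∘ₗ c := by
    refine functional_ext β id (fun n => add_zero _) _ _ fun n w (y : Y.X (-n)) => ?_
    refine (dualPair_single β _ n w y).trans ?_
    have h : c (Cochain.single (rankOne w y) 0) =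
        Cochain.single (rankOne w ((g.f (-n)).hom y)) 0 := by
      refine Cochain.ext₀ _ _ fun p => ?_
      change (((Cochain.single (rankOne w y) 0).comp (Cochain.ofHom g) (add_zero 0)).v p p _) = _
      rw [Cochain.comp_zero_cochain_v, Cochain.ofHom_v]
      by_cases hp : p = -n
      · subst hp
        rw [Cochain.single_v, Cochain.single_v, rankOne_comp]
      · rw [Cochain.single_v_eq_zero _ _ _ _ _ hp, Cochain.single_v_eq_zero _ _ _ _ _ hp,
          Limits.zero_comp]
    rw [LinearMap.comp_apply, h]
    exact (dualPair_single β φ n w _).symm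
  rw [key, LinearMap.comp_apply]
  congr 1
  exact (Cochain.ofHom_comp f g).symm

variable [HasDerivedCategory.{w₃} (ModuleCat.{v} (Env K A))]

variable (K L) in
/-- Morphisms from the dual of `P` to the `K`-dual of `Y` form the `K`-dual of the space of
morphisms from `P` to `Y` in the derived category of bimodules. -/
lemma exists_linearEquiv_dual (β : FiniteDualBasis P) [P.IsKProjective]
    [(dualComplex K A P).IsKProjective] :
    ∃ T : ∀ Y, (DerivedCategory.Q.obj (dualComplex K A P) ⟶ DerivedCategory.Q.obj (dualCx K L Y))
        ≃ₗ[K] ((DerivedCategory.Q.obj P ⟶ DerivedCategory.Q.obj Y) →ₗ[K] L),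
      ∀ Y Y' (g : Y ⟶ Y') a b, T Y (a ≫ DerivedCategory.Q.map (dualCxMap K L g)) b =
        T Y' a (b ≫ DerivedCategory.Q.map g) := by
  have h : ∀ Y, ∃ T : (DerivedCategory.Q.obj (dualComplex K A P) ⟶
      DerivedCategory.Q.obj (dualCx K L Y)) ≃ₗ[K]
        ((DerivedCategory.Q.obj P ⟶ DerivedCategory.Q.obj Y) →ₗ[K] L),
      ∀ (φ : dualComplex K A P ⟶ dualCx K L Y) (f : P ⟶ Y), T (DerivedCategory.Q.map φ)
        (DerivedCategory.Q.map f) = dualPair L Y β φ (Cochain.ofHom f) := by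
    intro Y
    let o : (P ⟶ Y) →ₗ[K] Cochain P Y 0 :=
      { toFun := Cochain.ofHom
        map_add' := Cochain.ofHom_add
        map_smul' := fun k f => by ext; simp }
    refine exists_linearEquiv_of_pairing
      (DerivedCategory.Q.mapLinearMap K : (dualComplex K A P ⟶ dualCx K L Y) →ₗ[K] _)
      Q_map_surjective_of_isKProjective
      (DerivedCategory.Q.mapLinearMap K : (P ⟶ Y) →ₗ[K] _) Q_map_surjective_of_isKProjective
      (LinearMap.lcomp K L o ∘ₗ dualPair L Y β) (fun φ f hf => ?_) (fun φ => ?_) fun l => ?_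
    · obtain ⟨h⟩ := (Q_map_eq_zero_iff_of_isKProjective f).1 hf
      change dualPair L Y β φ (Cochain.ofHom f) = 0
      have : Cochain.ofHom f = δ (-1) 0 (Cochain.ofHomotopy h) := by
        rw [δ_ofHomotopy, Cochain.ofHom_zero, sub_zero]
      rw [this, dualPair_δ]
    · refine (Q_map_eq_zero_iff_of_isKProjective φ).trans ((dualPair_null_iff β φ).trans ?_)
      exact ⟨fun h => LinearMap.ext h, fun h f => LinearMap.congr_fun h f⟩
    · obtain ⟨m, hm⟩ := exists_comp_eq_of_ker_le o
        (l ∘ₗ (DerivedCategory.Q.mapLinearMap K : (P ⟶ Y) →ₗ[K] _)) fun f hf => by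
          have : f = 0 := by
            ext p : 1
            have := Cochain.congr_v (show Cochain.ofHom f = 0 from hf) p p (add_zero p)
            rwa [Cochain.ofHom_v] at this
          rw [this, map_zero]
      have hm' : ∀ f : P ⟶ Y, m (Cochain.ofHom f) = l (DerivedCategory.Q.map f) :=
        LinearMap.congr_fun hm
      refine ⟨ofFunctional m fun z => ?_, ?_⟩
      · let f := Cocycle.homOf (Cocycle.mk (δ (-1) 0 z) 1 (zero_add 1) (δ_δ _ _ _ z))
        have h1 : Cochain.ofHom f = δ (-1) 0 z := Cocycle.cochain_ofHom_homOf_eq_coe _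
        have h2 : Nonempty (Homotopy f 0) :=
          ⟨(Cochain.equivHomotopy f 0).symm ⟨z, by rw [h1, Cochain.ofHom_zero, add_zero]⟩⟩
        rw [← h1, hm', (Q_map_eq_zero_iff_of_isKProjective f).2 h2, map_zero]
      · refine LinearMap.ext fun f => ?_
        change dualPair L Y β (ofFunctional m _) (Cochain.ofHom f) = _
        rw [dualPair_ofFunctional]
        exact hm' f
  choose T hT using h
  refine ⟨T, fun Y Y' g a b => ?_⟩
  obtain ⟨φ, rfl⟩ := Q_map_surjective_of_isKProjective a
  obtain ⟨f, rfl⟩ := Q_map_surjective_of_isKProjective b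
  rw [← Functor.map_comp, ← Functor.map_comp, hT, hT, dualPair_comp]

end Pairing

/-! ### Comparison of `D Hom_K(M, N)` with `Hom_K(N, DDM)` -/

section Kappa

variable {L : Type v} [AddCommGroup L] [Module K L] (ι : K ≃ₗ[K] L)
  {M N M' N' : CochainComplex (ModuleCat.{v} A) ℤ}

/-- The cochain with a single nonzero component. -/
def LC.single {m : ℤ} (q p : ℤ) (h : q + m = p) (f : M.X q →ₗ[K] N.X p) : LC K M N m :=
  LC.mk fun q' p' h' => if e : q' = q then
    have e' : p' = p := by omega
    e' ▸ e ▸ f else 0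

lemma LC.single_v {m : ℤ} (q p : ℤ) (h : q + m = p) (f : M.X q →ₗ[K] N.X p) :
    (LC.single q p h f).v q p h = f := dif_pos rfl

lemma LC.single_v_ne {m : ℤ} (q p : ℤ) (h : q + m = p) (f : M.X q →ₗ[K] N.X p) (q' p' : ℤ)
    (h' : q' + m = p') (hq : q' ≠ q) : (LC.single q p h f).v q' p' h' = 0 :=
  dif_neg hq

lemma LC.single_eq_of_v {m : ℤ} (q p : ℤ) (h : q + m = p) (f : M.X q →ₗ[K] N.X p)
    (z : LC K M N m) (h1 : ∀ x, z.v q p h x = f x)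
    (h2 : ∀ q' p' h' x, q' ≠ q → z.v q' p' h' x = 0) : LC.single q p h f = z := by
  refine LC.ext fun q' p' h' x => ?_
  by_cases hq : q' = q
  · subst hq
    obtain rfl : p = p' := by omega
    rw [LC.single_v, h1]
  · rw [LC.single_v_ne q p h f q' p' h' hq, h2 q' p' h' x hq, LinearMap.zero_apply]

lemma LC.single_add {m : ℤ} (q p : ℤ) (h : q + m = p) (f g : M.X q →ₗ[K] N.X p) :
    LC.single q p h (f + g) = LC.single q p h f + LC.single q p h g := by
  refine LC.single_eq_of_v _ _ _ _ _ (fun x => ?_) fun q' p' h' x hq => ?_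
  · rw [LC.add_v, LC.single_v, LC.single_v]
  · rw [LC.add_v, LC.single_v_ne _ _ _ _ _ _ _ hq, LC.single_v_ne _ _ _ _ _ _ _ hq, add_zero,
      LinearMap.zero_apply]

lemma LC.single_smul {m : ℤ} (q p : ℤ) (h : q + m = p) (k : K) (f : M.X q →ₗ[K] N.X p) :
    LC.single q p h (k • f) = k • LC.single q p h f := by
  refine LC.single_eq_of_v _ _ _ _ _ (fun x => ?_) fun q' p' h' x hq => ?_
  · rw [LC.smul_v, LC.single_v]
  · rw [LC.smul_v, LC.single_v_ne _ _ _ _ _ _ _ hq, smul_zero, LinearMap.zero_apply]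

/-- The differential of a cochain with a single nonzero component. -/
lemma LC.δ_single {m m' : ℤ} (hm : m + 1 = m') (q p q₀ p₁ : ℤ) (h : q + m = p) (hq : q₀ + 1 = q)
    (hp : p + 1 = p₁) (f : M.X q →ₗ[K] N.X p) :
    LC.δ hm (LC.single q p h f) = LC.single q p₁ (by omega) (LC.diff K N p p₁ ∘ₗ f) +
      (m'.negOnePow : ℤ) • LC.single q₀ p (by omega) (f ∘ₗ LC.diff K M q₀ q) := by
  refine LC.ext fun q' p' h' x => ?_
  rw [LC.δ_v hm _ q' p' h' (q' + 1) (p' - 1) rfl (by omega)]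
  rw [LC.add_v, LinearMap.add_apply]
  change _ = _ + (m'.negOnePow : ℤ) • (LC.single (K := K) (M := M) (N := N) q₀ p _ _).v q' p' h' x
  by_cases hq1 : q' = q
  · subst hq1
    obtain rfl : p = p' - 1 := by omega
    obtain rfl : p₁ = p' := by omega
    rw [LC.single_v, LC.single_v, LC.single_v_ne q' _ _ _ (q' + 1) _ _ (by omega),
      LC.single_v_ne q₀ _ _ _ q' _ _ (by omega)]
    rfl
  · rw [LC.single_v_ne q _ _ _ q' _ _ hq1, LC.single_v_ne q _ _ _ q' _ _ hq1]
    by_cases hq2 : q' = q₀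
    · subst hq2
      subst hq
      obtain rfl : p = p' := by omega
      rw [LC.single_v, LC.single_v, LinearMap.zero_apply, LinearMap.zero_apply, map_zero]
      rfl
    · rw [LC.single_v_ne q _ _ _ (q' + 1) _ _ (by omega), LC.single_v_ne q₀ _ _ _ q' _ _ hq2]
      simp

/-- The `K`-linear map of rank one given by a functional and a vector. -/
def tens {V W : Type v} [AddCommGroup V] [Module K V] [AddCommGroup W] [Module K W]
    (ξ : V →ₗ[K] L) (y : W) : V →ₗ[K] W :=
  LinearMap.toSpanSingleton K W y ∘ₗ ι.symm.toLinearMap ∘ₗ ξ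

lemma tens_apply {V W : Type v} [AddCommGroup V] [Module K V] [AddCommGroup W] [Module K W]
    (ξ : V →ₗ[K] L) (y : W) (x : V) : tens ι ξ y x = ι.symm (ξ x) • y := rfl

/-- The sign in the comparison of `D Hom_K(M, N)` with `Hom_K(N, DDM)`, forced by the sign-free
differential of `dualCx`. -/
def kSign (p n : ℤ) : ℤ := (p.negOnePow : ℤ) * (triSign n : ℤ)

lemma kSign_mul_self (p n : ℤ) : kSign p n * kSign p n = 1 := by
  have h : (triSign n : ℤ) * triSign n = 1 := by
    rw [← Units.val_mul, Int.units_mul_self, Units.val_one]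
  rw [kSign, mul_mul_mul_comm, negOnePow_mul_self_int, h, one_mul]

lemma kSign_succ_left (p n : ℤ) : kSign (p + 1) n = -kSign p n := by
  rw [kSign, kSign, negOnePow_succ_int, neg_mul]

lemma kSign_succ_right (p n : ℤ) : kSign p (n + 1) = (n.negOnePow : ℤ) * kSign p n := by
  rw [kSign, kSign, triSign_succ, Units.val_mul]
  ring

/-- The action of `K` through `A` on a term of the double dual complex is the usual one. -/
lemma doubleDualCx_smul (q : ℤ) (k : K) (s : (M.X q →ₗ[K] L) →ₗ[K] L) :
    (algebraMap K A k) • s = k • s :=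
  algebraMap_smul A k s

/-- The cochain with given components, whose `K`-linearity is expressed through the action of
`A` on the target. -/
def LC.ofFun {n : ℤ} (f : ∀ p q : ℤ, p + n = q → N.X p → M.X q)
    (hadd : ∀ p q h y y', f p q h (y + y') = f p q h y + f p q h y')
    (hsmul : ∀ p q h (k : K) y, f p q h (k • y) = algebraMap K A k • f p q h y) : LC K N M n :=
  LC.mk fun p q h => { toFun := f p q h, map_add' := hadd p q h, map_smul' := hsmul p q h }

lemma LC.tmul_smul_v {n : ℤ} (z : LC K N M n) (x y : A) (p q : ℤ) (h : p + n = q) (m : N.X p) :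
    ((x ⊗ₜ MulOpposite.op y : Env K A) • z).v p q h m = x • z.v p q h (y • m) := by
  rw [LC.env_smul_v, tmul_smul_hom, MulOpposite.unop_op]

variable (K M N) in
/-- The complex `Hom_K(M, N)` with its terms kept folded, so that instance search finds the
action of `K` on them through `Aᵉ`. -/
def homBi : CochainComplex (ModuleCat.{v} (Env K A)) ℤ := homCx K M N

/-- An element of the dual of `Hom_K(M, N)`, as a functional on cochains. -/
def toFunctional {n : ℤ} (l : (homBi K M N).X (-n) →ₗ[K] L) : LC K M N (-n) →ₗ[K] L where
  toFun z := l z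
  map_add' z z' := l.map_add z z'
  map_smul' k z :=
    (congrArg l (env_algebraMap_smul (A := A) k z).symm).trans (l.map_smul k z)

/-- A functional on cochains, as an element of the dual of `Hom_K(M, N)`. -/
def ofFunctionalDual {n : ℤ} (l : LC K M N (-n) →ₗ[K] L) : (homBi K M N).X (-n) →ₗ[K] L where
  toFun z := l z
  map_add' z z' := l.map_add z z'
  map_smul' k z := by
    let z' : LC K M N (-n) := z
    have h : (algebraMap K (Env K A) k) • z' = k • z' := env_algebraMap_smul (A := A) k z'
    exact (congrArg l h).trans (l.map_smul k z')

lemma toFunctional_d (i j : ℤ) (hij : i + 1 = j) (l : (homBi K M N).X (-i) →ₗ[K] L)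
    (z : LC K M N (-j)) : toFunctional (((dualCx K L (homBi K M N)).d i j).hom l) z =
      toFunctional l (LC.δ (show -j + 1 = -i by omega) z) := by
  rw [dualCx_d L _ _ _ hij]
  change toFunctional l (((homCx K M N).d (-j) (-i)).hom z) = _
  rw [homCx_d _ _ _ _ (by omega)]

lemma toFunctional_smul {n : ℤ} (x y : A) (l : (homBi K M N).X (-n) →ₗ[K] L)
    (z : LC K M N (-n)) : toFunctional ((x ⊗ₜ MulOpposite.op y : Env K A) • l) z =
      toFunctional l ((y ⊗ₜ MulOpposite.op x : Env K A) • z) :=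
  tmul_smul_dual_apply x y l z

/-- The comparison map on components: a functional `l` on `Hom_K(M, N)` and an element `y` of `N`
give the element `ξ ↦ ± l (ξ(-) • y)` of the double dual of `M`. -/
def kappaFun (n : ℤ) (l : LC K M N (-n) →ₗ[K] L) (p q : ℤ) (h : p + n = q) (y : N.X p) :
    (M.X q →ₗ[K] L) →ₗ[K] L where
  toFun ξ := kSign p n • l (LC.single q p (by omega) (tens ι ξ y))
  map_add' ξ ξ' := by
    have : tens ι (ξ + ξ') y = tens ι ξ y + tens ι ξ' y := LinearMap.ext fun x => by
      simp only [tens_apply, LinearMap.add_apply, map_add, add_smul]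
    rw [this, LC.single_add, map_add, smul_add]
  map_smul' k ξ := by
    have : tens ι (k • ξ) y = k • tens ι ξ y := LinearMap.ext fun x => by
      simp only [tens_apply, LinearMap.smul_apply, map_smul, smul_assoc]
    rw [this, LC.single_smul, map_smul, smul_comm, RingHom.id_apply]

/-- The comparison map on cochains. -/
def kappaCochain (n : ℤ) (l : LC K M N (-n) →ₗ[K] L) : LC K N (doubleDualCx K L M) n :=
  LC.ofFun (M := doubleDualCx K L M) (kappaFun ι n l)
    (fun p q h y y' => LinearMap.ext fun ξ => by
      have : tens ι ξ (y + y') = tens ι ξ y + tens ι ξ y' :=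
        LinearMap.ext fun x => smul_add _ _ _
      change kSign p n • l (LC.single q p _ (tens ι ξ (y + y'))) = _
      rw [this, LC.single_add, map_add, smul_add]
      rfl)
    (fun p q h k y => by
      refine Eq.trans (LinearMap.ext fun ξ => ?_) (doubleDualCx_smul (M := M) q k _).symm
      have : tens ι ξ (k • y) = k • tens ι ξ y := LinearMap.ext fun x => smul_comm _ _ _
      change kSign p n • l (LC.single q p _ (tens ι ξ (k • y))) = _
      rw [this, LC.single_smul, map_smul, smul_comm]
      rfl)

lemma kappaCochain_add (n : ℤ) (l l' : LC K M N (-n) →ₗ[K] L) :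
    kappaCochain ι n (l + l') = kappaCochain ι n l + kappaCochain ι n l' :=
  LC.ext fun p _ _ _ => LinearMap.ext fun _ => smul_add (kSign p n) (l _) (l' _)

/-- The comparison map in a given degree. -/
def kappaLin (n : ℤ) :
    ((homBi K M N).X (-n) →ₗ[K] L) →ₗ[Env K A] LC K N (doubleDualCx K L M) n where
  toFun l := kappaCochain ι n (toFunctional l)
  map_add' l l' := kappaCochain_add ι n (toFunctional l) (toFunctional l')
  map_smul' b l := by
    let g : ((homBi K M N).X (-n) →ₗ[K] L) →+ LC K N (doubleDualCx K L M) n :=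
      AddMonoidHom.mk' (fun l => kappaCochain ι n (toFunctional l)) fun l l' =>
        kappaCochain_add ι n (toFunctional l) (toFunctional l')
    refine env_smul_induction g l (fun x y => LC.ext fun p q h z => ?_) b
    refine Eq.trans ?_ (LC.tmul_smul_v (M := doubleDualCx K L M) _ x y p q h z).symm
    refine LinearMap.ext fun ξ => ?_
    change kSign p n • toFunctional ((x ⊗ₜ MulOpposite.op y : Env K A) • l)
        (LC.single q p _ (tens ι ξ z)) =
      kSign p n • toFunctional l
        (LC.single q p _ (tens ι (ξ ∘ₗ Algebra.lsmul K K (M.X q) x) (y • z)))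
    rw [toFunctional_smul]
    congr 2
    refine (LC.single_eq_of_v _ _ _ _ _ (fun m => ?_) fun q' p' h' m hq => ?_).symm
    · rw [LC.tmul_smul_v, LC.single_v, tens_apply, tens_apply, smul_comm]
      rfl
    · rw [LC.tmul_smul_v, LC.single_v_ne _ _ _ _ _ _ _ hq, LinearMap.zero_apply, smul_zero]

variable (M N) in
/-- The comparison morphism `D Hom_K(M, N) → Hom_K(N, DDM)`. -/
def kappa : dualCx K L (homBi K M N) ⟶ homCx K N (doubleDualCx K L M) :=
  mkHom (F := dualCx K L (homBi K M N)) (G := homCx K N (doubleDualCx K L M))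
    (fun n => kappaLin ι n) (fun i j hij l => by
      rw [homCx_d _ _ _ _ hij]
      refine LC.ext fun p q h y => ?_
      rw [LC.δ_v hij _ p q h (p + 1) (q - 1) rfl (by omega), doubleDualCx_d L M _ _ (by omega)]
      refine LinearMap.ext fun ξ => ?_
      change kSign p i • toFunctional l (LC.single (q - 1) p _
          (tens ι (ξ ∘ₗ (M.d (q - 1) q).hom.restrictScalars K) y)) + (j.negOnePow : ℤ) •
          kSign (p + 1) i • toFunctional l (LC.single q (p + 1) _
            (tens ι ξ ((N.d p (p + 1)).hom y))) =
        kSign p j • toFunctional (((dualCx K L (homBi K M N)).d i j).hom l)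
          (LC.single q p _ (tens ι ξ y))
      rw [toFunctional_d i j hij, LC.δ_single _ q p (q - 1) (p + 1) _ (by omega) rfl, map_add,
        map_zsmul, kSign_succ_left]
      have e : LC.diff K N p (p + 1) ∘ₗ tens ι ξ y = tens ι ξ ((N.d p (p + 1)).hom y) :=
        LinearMap.ext fun x => map_smul (LC.diff K N p (p + 1)) _ _
      rw [e]
      subst hij
      rw [kSign_succ_right, negOnePow_succ_int, Int.negOnePow_neg, smul_add, add_comm, neg_smul,
        neg_smul, smul_neg, neg_neg, smul_smul, smul_smul]
      congr 1
      rw [mul_right_comm, negOnePow_mul_self_int, one_mul]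
      rfl)

/-- The functoriality of `homBi`. -/
def homBiMap (f : M ⟶ M') (g : N' ⟶ N) : homBi K M' N' ⟶ homBi K M N := homCxMap K f g

lemma kappa_naturality (f : M ⟶ M') (g : N' ⟶ N) :
    dualCxMap K L (homBiMap f g) ≫ kappa ι M' N' =
      kappa ι M N ≫ homCxMap K g (doubleDualMap K L f) := by
  refine HomologicalComplex.hom_ext _ _ fun n => ModuleCat.hom_ext (LinearMap.ext fun l =>
    LC.ext (N := N') (M := doubleDualCx K L M') fun p q h y => LinearMap.ext fun ξ => ?_)
  change kSign p n • toFunctional l (LC.map f g (-n) (LC.single q p _ (tens ι ξ y))) =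
    kSign p n • toFunctional l
      (LC.single q p _ (tens ι (ξ ∘ₗ (f.f q).hom.restrictScalars K) ((g.f p).hom y)))
  congr 2
  refine (LC.single_eq_of_v _ _ _ _ _ (fun m => ?_) fun q' p' h' m hq => ?_).symm
  · rw [LC.map_v, LC.single_v, tens_apply, tens_apply]
    exact map_smul ((g.f p).hom.restrictScalars K) _ _
  · rw [LC.map_v, LC.single_v_ne _ _ _ _ _ _ _ hq, LinearMap.zero_apply, map_zero]

end Kappa

/-! ### Complexes with finite-dimensional cohomology -/

section FiniteHodge

/-- A decomposition over the ground field of a complex with finite-dimensional total cohomology: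
the identity is homotopic to an operator of finite rank, given by cocycles `vec` and functionals
`coord` that vanish on coboundaries. -/
structure FiniteHodge (K : Type u) [Field K] {A : Type v} [Ring A] [Algebra K A]
    (M : CochainComplex (ModuleCat.{v} A) ℤ) where
  /-- The homotopy. -/
  h : ∀ i j, M.X i →ₗ[K] M.X j
  /-- A finite set that contains all degrees with nonzero cohomology. -/
  supp : Finset ℤ
  /-- The number of cocycles in each degree. -/
  card : ℤ → ℕ
  card_eq : ∀ q, q ∉ supp → card q = 0
  /-- Cocycles whose classes generate the cohomology. -/
  vec : ∀ q, Fin (card q) → M.X q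
  /-- The coordinates of the operator of finite rank. -/
  coord : ∀ q, Fin (card q) → (M.X q →ₗ[K] K)
  d_vec : ∀ i j a, (M.d i j).hom (vec i a) = 0
  coord_d : ∀ i j a x, i + 1 = j → coord j a ((M.d i j).hom x) = 0
  eq_add : ∀ i j k x, i + 1 = j → j + 1 = k →
    x = ∑ a, coord j a x • vec j a + (M.d i j).hom (h j i x) + h k j ((M.d j k).hom x)

variable {L : Type v} [AddCommGroup L] [Module K L] (ι : K ≃ₗ[K] L)
  {M N M' N' : CochainComplex (ModuleCat.{v} A) ℤ}

/-- The operator of finite rank in a finite Hodge decomposition; it is homotopic to the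
identity. -/
def FiniteHodge.proj (D : FiniteHodge K M) (q : ℤ) : M.X q →ₗ[K] M.X q :=
  ∑ a, (D.coord q a).smulRight (D.vec q a)

lemma FiniteHodge.proj_apply (D : FiniteHodge K M) (q : ℤ) (x : M.X q) :
    D.proj q x = ∑ a, D.coord q a x • D.vec q a := by
  simp [FiniteHodge.proj]

/-- The coordinate functions with values in `L`. -/
def FiniteHodge.coordL (D : FiniteHodge K M) (q : ℤ) (a : Fin (D.card q)) : M.X q →ₗ[K] L :=
  ι.toLinearMap ∘ₗ D.coord q a

lemma FiniteHodge.coordL_d (D : FiniteHodge K M) (p q : ℤ) (a : Fin (D.card q)) (h : p + 1 = q) :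
    D.coordL ι q a ∘ₗ (M.d p q).hom.restrictScalars K = 0 :=
  LinearMap.ext fun x => (congrArg ι (D.coord_d p q a x h)).trans (map_zero ι)

/-- A functional composed with the operator of finite rank is a combination of the coordinates. -/
lemma FiniteHodge.comp_proj (D : FiniteHodge K M) (q : ℤ) (ξ : M.X q →ₗ[K] L) :
    ξ ∘ₗ D.proj q = ∑ a, ι.symm (ξ (D.vec q a)) • D.coordL ι q a := by
  refine LinearMap.ext fun x => ?_
  rw [LinearMap.comp_apply, D.proj_apply, map_sum, LinearMap.sum_apply]
  refine Finset.sum_congr rfl fun a _ => ?_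
  change ξ (D.coord q a x • D.vec q a) = ι.symm (ξ (D.vec q a)) • ι (D.coord q a x)
  obtain ⟨c, hc⟩ := ι.surjective (ξ (D.vec q a))
  rw [ξ.map_smul, ← hc, ι.symm_apply_apply, ← ι.map_smul, ← ι.map_smul, smul_eq_mul, smul_eq_mul,
    mul_comm]

/-- A map between modules that commutes with the scalars acting through `A`, as a `K`-linear
map. -/
def kLin {V W : ModuleCat.{v} A} (f : V → W) (hadd : ∀ x y, f (x + y) = f x + f y)
    (hsmul : ∀ (k : K) x, f (algebraMap K A k • x) = algebraMap K A k • f x) : V →ₗ[K] W where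
  toFun := f
  map_add' := hadd
  map_smul' := hsmul

variable (M) in
/-- Precomposition with a transpose, as an endomorphism of the double dual. -/
def ddLin {i j : ℤ} (f : M.X i →ₗ[K] M.X j) :=
  kLin (K := K) (V := (doubleDualCx K L M).X i) (W := (doubleDualCx K L M).X j)
    (fun s => (show (M.X i →ₗ[K] L) →ₗ[K] L from s) ∘ₗ LinearMap.lcomp K L f) (fun _ _ => rfl)
    (fun k s => by
      refine Eq.trans ?_ (doubleDualCx_smul (M := M) (L := L) j k _).symm
      exact congrArg (fun t : (M.X i →ₗ[K] L) →ₗ[K] L => t ∘ₗ LinearMap.lcomp K L f)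
        (doubleDualCx_smul (M := M) (L := L) i k s))

lemma LC.v_map_add {n : ℤ} (z : LC K N M n) (p q : ℤ) (h : p + n = q) (y y' : N.X p) :
    z.v p q h (y + y') = z.v p q h y + z.v p q h y' :=
  map_add _ y y'

lemma LC.v_map_smul {n : ℤ} (z : LC K N M n) (p q : ℤ) (h : p + n = q) (k : K) (y : N.X p) :
    z.v p q h (k • y) = algebraMap K A k • z.v p q h y :=
  map_smul (z.v p q h) k y

/-- The components of a cochain with values in the double dual. -/
def ddv {n : ℤ} (z : LC K N (doubleDualCx K L M) n) (p q : ℤ) (h : p + n = q) :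
    N.X p →ₗ[K] ((M.X q →ₗ[K] L) →ₗ[K] L) where
  toFun y := z.v p q h y
  map_add' y y' := z.v_map_add p q h y y'
  map_smul' k y := (z.v_map_smul p q h k y).trans (doubleDualCx_smul (M := M) (L := L) q k _)

lemma ddv_ext {n : ℤ} {z z' : LC K N (doubleDualCx K L M) n}
    (H : ∀ p q h y ξ, ddv z p q h y ξ = ddv z' p q h y ξ) : z = z' :=
  LC.ext fun p q h y => LinearMap.ext fun ξ => H p q h y ξ

lemma ddv_δ {i j : ℤ} (hij : i + 1 = j) (w : LC K N (doubleDualCx K L M) i) (p q p' q' : ℤ)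
    (h : p + j = q) (hp : p + 1 = p') (hq : q' + 1 = q) (y : N.X p) (ξ : M.X q →ₗ[K] L) :
    ddv (LC.δ hij w) p q h y ξ =
      ddv w p q' (by omega) y (ξ ∘ₗ (M.d q' q).hom.restrictScalars K) +
        (j.negOnePow : ℤ) • ddv w p' q (by omega) ((N.d p p').hom y) ξ := by
  have := LC.δ_v hij w p q h p' q' hp hq y
  rw [doubleDualCx_d L M _ _ hq] at this
  exact LinearMap.congr_fun this ξ

/-- The coordinates vanish on coboundaries, so only the differential of `N` contributes here. -/
lemma ddv_δ_coordL (D : FiniteHodge K M) {i j : ℤ} (hij : i + 1 = j)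
    (w : LC K N (doubleDualCx K L M) i) (p q p' : ℤ)
    (h : p + j = q) (hp : p + 1 = p') (y : N.X p) (a : Fin (D.card q)) :
    ddv (LC.δ hij w) p q h y (D.coordL ι q a) =
        (j.negOnePow : ℤ) • ddv w p' q (by omega) ((N.d p p').hom y) (D.coordL ι q a) := by
  rw [ddv_δ hij w p q p' (q - 1) h hp (by omega), D.coordL_d ι _ _ _ (by omega), map_zero, zero_add]

/-- A cocycle with values in the double dual is cohomologous to its composite with the double
transpose of the operator of finite rank. -/
lemma exists_ddv_eq (D : FiniteHodge K M) {i j k : ℤ} (hij : i + 1 = j) (hjk : j + 1 = k)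
    (γ : LC K N (doubleDualCx K L M) j) (hγ : LC.δ hjk γ = 0) :
    ∃ w : LC K N (doubleDualCx K L M) i, ∀ p q h y ξ,
      ddv γ p q h y ξ = ddv γ p q h y (ξ ∘ₗ D.proj q) + ddv (LC.δ hij w) p q h y ξ := by
  obtain ⟨w, H⟩ : ∃ w : LC K N (doubleDualCx K L M) i,
      γ - LC.mk (fun p q h => ddLin M (D.proj q) ∘ₗ γ.v p q h) = LC.δ hij w :=
    ⟨_, LC.exists_sub_eq_δ_of_target (M := doubleDualCx K L M) (fun q => ddLin M (D.proj q))
    (fun p q => ddLin M (D.h p q)) (fun i j k s hij hjk => by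
      rw [doubleDualCx_d L M _ _ hij, doubleDualCx_d L M _ _ hjk]
      refine LinearMap.ext fun ξ => ?_
      let s' : (M.X j →ₗ[K] L) →ₗ[K] L := s
      change s' ξ = s' (ξ ∘ₗ D.proj j) + s' ((ξ ∘ₗ (M.d i j).hom.restrictScalars K) ∘ₗ D.h j i) +
        s' ((ξ ∘ₗ D.h k j) ∘ₗ (M.d j k).hom.restrictScalars K)
      rw [← map_add, ← map_add]
      refine congrArg s' (LinearMap.ext fun x => ?_)
      have := congrArg ξ (D.eq_add i j k x hij hjk)
      rw [map_add, map_add, ← D.proj_apply] at this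
      exact this) i j k hij hjk γ hγ⟩
  refine ⟨w, fun p q h y ξ => ?_⟩
  have h1 : (ddv γ p q h y : (M.X q →ₗ[K] L) →ₗ[K] L) =
      ddv γ p q h y ∘ₗ LinearMap.lcomp K L (D.proj q) + ddv (LC.δ hij w) p q h y :=
    LC.congr_v (sub_eq_iff_eq_add'.1 H) p q h y
  exact LinearMap.congr_fun h1 ξ

/-- A cochain composed with the operator of finite rank on the source is a finite sum of cochains
of rank one. -/
lemma LC.mk_comp_proj (D : FiniteHodge K M) {m : ℤ} (z : LC K M N m) :
    LC.mk (fun p q h => z.v p q h ∘ₗ D.proj p) = ∑ q ∈ D.supp, ∑ a,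
      LC.single q (q + m) rfl (tens ι (D.coordL ι q a) (z.v q (q + m) rfl (D.vec q a))) := by
  refine LC.ext fun p q h x => ?_
  subst h
  let e : LC K M N m →+ N.X (p + m) :=
    AddMonoidHom.mk' (fun z => z.v p (p + m) rfl x) (fun _ _ => rfl)
  change z.v p (p + m) rfl (D.proj p x) = e _
  have h1 : ∀ q ≠ p, ∀ a, e (LC.single q (q + m) rfl
      (tens ι (D.coordL ι q a) (z.v q (q + m) rfl (D.vec q a)))) = 0 := fun q hq a =>
    LinearMap.congr_fun (LC.single_v_ne q (q + m) rfl
      (tens ι (D.coordL ι q a) (z.v q (q + m) rfl (D.vec q a))) p (p + m) rfl hq.symm) x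
  have h2 : ∀ a, e (LC.single p (p + m) rfl
      (tens ι (D.coordL ι p a) (z.v p (p + m) rfl (D.vec p a)))) =
      D.coord p a x • z.v p (p + m) rfl (D.vec p a) := fun a => by
    refine (LinearMap.congr_fun (LC.single_v p (p + m) rfl
      (tens ι (D.coordL ι p a) (z.v p (p + m) rfl (D.vec p a)))) x).trans ?_
    rw [tens_apply]
    exact congrArg (fun t => t • _) (ι.symm_apply_apply _)
  rw [map_sum, Finset.sum_eq_single p, map_sum, Finset.sum_congr rfl fun a _ => h2 a, D.proj_apply,
    map_sum]
  · simp only [map_smul]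
  · intro q _ hq
    rw [map_sum, Finset.sum_eq_zero fun a _ => h1 q hq a]
  · intro hp
    rw [map_sum, Finset.sum_eq_zero]
    intro a
    have := D.card_eq p hp
    exact (Fin.cast this a).elim0

lemma toFunctional_injective {n : ℤ} {l l' : (homBi K M N).X (-n) →ₗ[K] L}
    (h : toFunctional l = toFunctional l') : l = l' :=
  LinearMap.ext fun z => LinearMap.congr_fun h z

variable (N) in
/-- If `M` has finite-dimensional total cohomology, then the comparison
`D Hom_K(M, N) → Hom_K(N, DDM)` is a quasi-isomorphism. -/
lemma quasiIso_kappa (D : FiniteHodge K M) : QuasiIso (kappa ι M N) := by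
  refine quasiIso_of_elements _ (fun i j k hij hjk l hl w hw => ?_) fun i j k hij hjk γ hγ => ?_
  · rw [homCx_d _ _ _ _ hij] at hw
    let l' : (homBi K M N).X (-j) →ₗ[K] L := l
    have hl' : ∀ z, toFunctional l' (LC.δ (show -k + 1 = -j by omega) z) = 0 := fun z => by
      rw [← toFunctional_d j k hjk l' z]
      exact LinearMap.congr_fun hl z
    have hs : ∀ p q (h : p + j = q) (y : N.X p) a, (N.d p (p + 1)).hom y = 0 →
        toFunctional l' (LC.single q p (by omega) (tens ι (D.coordL ι q a) y)) = 0 := by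
      intro p q h y a hy
      have h1 : kSign p j •
          toFunctional l' (LC.single q p (by omega) (tens ι (D.coordL ι q a) y)) =
          ddv (LC.δ hij w) p q h y (D.coordL ι q a) := LinearMap.congr_fun (LC.congr_v hw p q h y :
            (ddv (kappaLin ι j l') p q h y : (M.X q →ₗ[K] L) →ₗ[K] L) = ddv (LC.δ hij w) p q h y) _
      rw [ddv_δ_coordL ι D hij w p q (p + 1) h rfl, hy, map_zero, LinearMap.zero_apply,
        smul_zero] at h1
      have h2 := congrArg (fun t => kSign p j • t) h1
      simpa only [smul_smul, kSign_mul_self, one_smul, smul_zero] using h2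
    obtain ⟨m, hm⟩ := exists_comp_eq_of_ker_le
      ((LC.δ (K := K) (N := M) (M := N) (show -j + 1 = -i by omega)).restrictScalars K)
      (toFunctional l') fun z hz => by
        have h1 := LC.exists_sub_eq_δ_of_source D.proj D.h (fun i j k x hij hjk => by
          rw [D.proj_apply]; exact D.eq_add i j k x hij hjk) (-k) (-j) (-i) (by omega) (by omega)
          z hz
        have h2 := congrArg (toFunctional l') h1
        rw [hl', map_sub, sub_eq_zero, LC.mk_comp_proj ι, map_sum] at h2
        rw [h2]
        refine Finset.sum_eq_zero fun q _ => ?_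
        rw [map_sum]
        refine Finset.sum_eq_zero fun a _ => hs _ _ (by omega) _ _ ?_
        have h3 := LC.congr_v hz q (q + -j + 1) (by omega) (D.vec q a)
        rw [LinearMap.restrictScalars_apply, LC.δ_v _ z q _ _ (q + 1) (q + -j) rfl rfl, D.d_vec,
          map_zero, smul_zero, add_zero] at h3
        exact h3
    refine ⟨(ofFunctionalDual m : (homBi K M N).X (-i) →ₗ[K] L), ?_⟩
    refine toFunctional_injective (l := l') (LinearMap.ext fun z => ?_)
    refine Eq.trans ?_ (toFunctional_d i j hij (ofFunctionalDual m) z).symm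
    exact (LinearMap.congr_fun hm z).symm
  · rw [homCx_d _ _ _ _ hjk] at hγ
    let l : LC K M N (-j) →ₗ[K] L :=
      { toFun := fun z => ∑ q ∈ D.supp, ∑ a, kSign (q + -j) j •
          ddv γ (q + -j) q (by omega) (z.v q (q + -j) rfl (D.vec q a)) (D.coordL ι q a)
        map_add' := fun z z' => by
          simp only [LC.add_v, LinearMap.add_apply, map_add, smul_add, Finset.sum_add_distrib]
        map_smul' := fun k z => by
          simp only [LC.smul_v, LinearMap.smul_apply, map_smul, Finset.smul_sum, smul_comm k,
            RingHom.id_apply] }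
    have hl : ∀ p q (h : p + j = q) (y : N.X p) (ξ : M.X q →ₗ[K] L),
        kSign p j • l (LC.single q p (by omega) (tens ι ξ y)) =
          ddv γ p q h y (ξ ∘ₗ D.proj q) := by
      intro p q h y ξ
      obtain rfl : p = q + -j := by omega
      change kSign (q + -j) j • ∑ q' ∈ D.supp, ∑ a, _ = _
      rw [Finset.sum_eq_single q, ← Finset.smul_sum, smul_smul, kSign_mul_self, one_smul,
        D.comp_proj ι, map_sum]
      · refine Finset.sum_congr rfl fun a _ => ?_
        rw [LC.single_v, tens_apply, map_smul, map_smul, LinearMap.smul_apply]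
      · intro q' _ hq
        refine Finset.sum_eq_zero fun a _ => ?_
        rw [LC.single_v_ne _ _ _ _ _ _ _ hq]
        simp
      · intro hq
        refine Finset.sum_eq_zero fun a _ => ?_
        exact (Fin.cast (D.card_eq q hq) a).elim0
    have hl0 : ∀ z, l (LC.δ (show -k + 1 = -j by omega) z) = 0 := by
      intro z
      refine Finset.sum_eq_zero fun q _ => Finset.sum_eq_zero fun a _ => ?_
      rw [LC.δ_v _ z q (q + -j) rfl (q + 1) (q + -k) rfl (by omega), D.d_vec, map_zero, smul_zero,
        add_zero]
      have h1 := ddv_δ_coordL ι D hjk γ (q + -k) q (q + -j) (by omega) (by omega)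
        (z.v q (q + -k) rfl (D.vec q a)) a
      rw [hγ] at h1
      have h2 := congrArg (fun t => (k.negOnePow : ℤ) • t) h1
      simp only [smul_smul, negOnePow_mul_self_int, one_smul] at h2
      rw [← h2]
      change kSign (q + -j) j • ((k.negOnePow : ℤ) • (0 : L)) = 0
      rw [smul_zero, smul_zero]
    obtain ⟨w, hw⟩ := exists_ddv_eq D hij hjk γ hγ
    refine ⟨(ofFunctionalDual l : (homBi K M N).X (-j) →ₗ[K] L), w, ?_, ?_⟩
    · refine toFunctional_injective (n := k) (l' := 0) (LinearMap.ext fun z => ?_)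
      exact (toFunctional_d j k hjk (ofFunctionalDual l) z).trans (hl0 z)
    · rw [homCx_d _ _ _ _ hij]
      refine ddv_ext fun p q h y ξ => (hw p q h y ξ).trans ?_
      rw [← hl]
      rfl

end FiniteHodge

section FiniteHodge

variable {L : Type v} [AddCommGroup L] [Module K L] (ι : K ≃ₗ[K] L)
  {M N : CochainComplex (ModuleCat.{v} A) ℤ}

/-- The cochain with values in `M` obtained from one with values in the double dual by evaluating at
the coordinates and recombining with the cocycles of a finite Hodge decomposition. -/
def FiniteHodge.rho (D : FiniteHodge K M) {n : ℤ} (w : LC K N (doubleDualCx K L M) n) :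
    LC K N M n :=
  LC.mk fun p q h => ∑ a, (ι.symm.toLinearMap ∘ₗ LinearMap.applyₗ (D.coordL ι q a) ∘ₗ
    ddv w p q h).smulRight (D.vec q a)

lemma FiniteHodge.rho_v (D : FiniteHodge K M) {n : ℤ} (w : LC K N (doubleDualCx K L M) n)
    (p q : ℤ) (h : p + n = q) (y : N.X p) :
    (D.rho ι w).v p q h y = ∑ a, ι.symm (ddv w p q h y (D.coordL ι q a)) • D.vec q a := by
  rw [FiniteHodge.rho, LC.mk_v, LinearMap.sum_apply]
  rfl

/-- Both the cocycles and the coordinates are annihilated by the differential of `M`, hence `rho`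
is a morphism of complexes. -/
lemma FiniteHodge.rho_δ (D : FiniteHodge K M) {i j : ℤ} (hij : i + 1 = j)
    (w : LC K N (doubleDualCx K L M) i) : D.rho ι (LC.δ hij w) = LC.δ hij (D.rho ι w) := by
  refine LC.ext fun p q h y => ?_
  rw [D.rho_v, LC.δ_v hij _ p q h (p + 1) (q - 1) rfl (by omega), D.rho_v, D.rho_v, map_sum,
    Finset.smul_sum]
  refine Eq.trans ?_ (congrArg (· + _) (Finset.sum_eq_zero ?_).symm)
  · rw [zero_add]
    refine Finset.sum_congr rfl fun a _ => ?_
    rw [ddv_δ_coordL ι D hij w p q (p + 1) h rfl, map_zsmul, smul_assoc]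
  · intro a _
    refine ((M.d (q - 1) q).hom.map_smul_of_tower _ _).trans ?_
    rw [D.d_vec, smul_zero]

lemma ddv_evalDual {n : ℤ} (z : LC K N M n) (p q : ℤ) (h : p + n = q) (y : N.X p)
    (ξ : M.X q →ₗ[K] L) :
    ddv (LC.map (𝟙 N) (evalDual K L M) n z) p q h y ξ = ξ (z.v p q h y) := rfl

variable (N) in
/-- If `M` has finite-dimensional total cohomology, then evaluation induces a quasi-isomorphism
from `Hom_K(N, M)` to `Hom_K(N, DDM)`. -/
lemma quasiIso_homCxMap_evalDual (ι : K ≃ₗ[K] L) (D : FiniteHodge K M) :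
    QuasiIso (homCxMap K (𝟙 N) (evalDual K L M)) := by
  refine quasiIso_of_elements _ (fun i j k hij hjk z hz w hw => ?_) fun i j k hij hjk γ hγ => ?_
  · rw [homCx_d _ _ _ _ hjk] at hz
    rw [homCx_d _ _ _ _ hij, homCxMap_f] at hw
    have h1 := LC.exists_sub_eq_δ_of_target (M := M) D.proj D.h (fun i j k x hij hjk => by
          rw [D.proj_apply]; exact D.eq_add i j k x hij hjk) i j k hij hjk z hz
    have h2 : LC.mk (fun p q h => D.proj q ∘ₗ z.v p q h) =
        D.rho ι (LC.map (𝟙 N) (evalDual K L M) j z) := by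
      refine LC.ext fun p q h y => ?_
      rw [D.rho_v, LC.mk_v, LinearMap.comp_apply, D.proj_apply]
      refine Finset.sum_congr rfl fun a _ => ?_
      rw [ddv_evalDual]
      exact congrArg (fun t => t • _) (ι.symm_apply_apply _).symm
    rw [h2, hw, D.rho_δ, sub_eq_iff_eq_add, ← map_add] at h1
    refine ⟨_, h1.trans (homCx_d _ _ _ _ hij _).symm⟩
  · rw [homCx_d _ _ _ _ hjk] at hγ
    obtain ⟨w, hw⟩ := exists_ddv_eq D hij hjk γ hγ
    refine ⟨D.rho ι γ, w, ?_, ?_⟩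
    · rw [homCx_d _ _ _ _ hjk, ← D.rho_δ, hγ]
      refine LC.ext fun p q h y => ?_
      rw [D.rho_v]
      refine Finset.sum_eq_zero fun a _ => ?_
      change ι.symm 0 • _ = _
      rw [map_zero, zero_smul]
    · rw [homCx_d _ _ _ _ hij]
      refine ddv_ext fun p q h y ξ => (hw p q h y ξ).trans ?_
      refine congrArg (· + _) (Eq.trans ?_ (ddv_evalDual (D.rho ι γ) p q h y ξ).symm)
      rw [D.comp_proj ι, D.rho_v, map_sum, map_sum]
      refine Finset.sum_congr rfl fun a _ => ?_
      rw [map_smul, ξ.map_smul]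
      obtain ⟨c, hc⟩ := ι.surjective (ξ (D.vec q a))
      obtain ⟨c', hc'⟩ := ι.surjective (ddv γ p q h y (D.coordL ι q a))
      rw [← hc, ← hc', ι.symm_apply_apply, ι.symm_apply_apply, ← ι.map_smul, ← ι.map_smul,
        smul_eq_mul, smul_eq_mul, mul_comm]

/-- A complex with finite-dimensional total cohomology has a finite Hodge decomposition. -/
lemma nonempty_finiteHodge (M : CochainComplex (ModuleCat.{v} A) ℤ) (S : Finset ℤ)
    (hfin : ∀ i, Module.Finite K (M.homology i))
    (hS : ∀ i, i ∉ S → Subsingleton (M.homology i)) : Nonempty (FiniteHodge K M) := by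
  obtain ⟨π, h, h1, h2, h3, h4⟩ := exists_hodge (K := K) (V := fun i => M.X i) (LC.diff K M)
    (fun i j k x => hom_d_d M i j k x)
  have key : ∀ q, ∃ f : LinearMap.range (π q) →ₗ[K] M.homology q, Function.Injective f := by
    intro q
    have hm : ∀ x : LinearMap.range (π q), (M.pOpcycles q).hom x ∈
        LinearMap.range ((M.homologyι q).hom.restrictScalars K) := by
      rintro ⟨_, x, rfl⟩
      obtain ⟨c, hc⟩ := exists_homology_of_cycle M q (q + 1) rfl (π q x) (h1 q (q + 1) x rfl)
      exact ⟨c, hc⟩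
    let g : LinearMap.range (π q) →ₗ[K] LinearMap.range ((M.homologyι q).hom.restrictScalars K) :=
      LinearMap.codRestrict _
        ((M.pOpcycles q).hom.restrictScalars K ∘ₗ (LinearMap.range (π q)).subtype) hm
    let e := LinearEquiv.ofInjective ((M.homologyι q).hom.restrictScalars K)
      (homologyι_injective M q)
    refine ⟨e.symm.toLinearMap ∘ₗ g, e.symm.injective.comp ?_⟩
    refine (injective_iff_map_eq_zero g).2 ?_
    rintro ⟨_, x, rfl⟩ hx
    obtain ⟨y, hy⟩ := (pOpcycles_eq_zero_iff M (q - 1) q (by omega) _).1 (congrArg Subtype.val hx)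
    refine Subtype.ext ?_
    change π q x = 0
    rw [← h3]
    refine (congrArg (π q) hy).symm.trans ?_
    exact h2 (q - 1) q y (by omega)
  have hf : ∀ q, Module.Finite K (LinearMap.range (π q)) := fun q => by
    obtain ⟨f, hf⟩ := key q
    have := hfin q
    exact Module.Finite.of_injective f hf
  let b := fun q => Module.finBasis K (LinearMap.range (π q))
  refine ⟨⟨h, S, fun q => Module.finrank K (LinearMap.range (π q)), fun q hq => ?_,
    fun q a => (b q a).1, fun q a => (b q).coord a ∘ₗ (π q).rangeRestrict, ?_, ?_, ?_⟩⟩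
  · obtain ⟨f, hf⟩ := key q
    have := hS q hq
    have := hf.subsingleton
    exact Module.finrank_zero_of_subsingleton
  · intro i j a
    by_cases hij : i + 1 = j
    · obtain ⟨x, hx⟩ := (b i a).2
      rw [← hx]
      exact h1 i j x hij
    · rw [M.shape i j hij]
      rfl
  · intro i j a x hij
    have : (π j).rangeRestrict ((M.d i j).hom x) = 0 := Subtype.ext (h2 i j x hij)
    rw [LinearMap.comp_apply, this, map_zero]
  · intro i j k x hij hjk
    refine (h4 i j k x hij hjk).trans ?_
    refine congrArg (· + (h k j ((M.d j k).hom x))) (congrArg (· + (M.d i j).hom (h j i x)) ?_)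
    have := congrArg (LinearMap.range (π j)).subtype ((b j).sum_repr ((π j).rangeRestrict x))
    rw [map_sum] at this
    refine this.symm.trans (Finset.sum_congr rfl fun a _ => ?_)
    rw [map_smul]
    rfl

open Classical in
/-- A direct sum is finite-dimensional only if almost all its summands vanish. -/
lemma exists_finset_of_finite_directSum {V : ℤ → Type*} [∀ i, AddCommGroup (V i)]
    [∀ i, Module K (V i)] [Module.Finite K (⨁ i, V i)] :
    (∀ i, Module.Finite K (V i)) ∧ ∃ S : Finset ℤ, ∀ i, i ∉ S → Subsingleton (V i) := by
  refine ⟨fun i => Module.Finite.of_surjective (DirectSum.component K ℤ V i) fun x =>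
    ⟨DirectSum.of V i x, DirectSum.of_eq_same i x⟩, ?_⟩
  obtain ⟨T, hT⟩ := Module.Finite.fg_top (R := K) (M := ⨁ i, V i)
  refine ⟨T.biUnion fun t => DFinsupp.support t, fun i hi => ?_⟩
  have h0 : DirectSum.component K ℤ V i = 0 := by
    refine LinearMap.ext_on hT fun t ht => ?_
    by_contra hne
    exact hi (Finset.mem_biUnion.2 ⟨t, ht, DFinsupp.mem_support_iff.2 hne⟩)
  refine subsingleton_of_forall_eq 0 fun x => ?_
  have := LinearMap.congr_fun h0 (DirectSum.of V i x)
  exact (DirectSum.of_eq_same i x).symm.trans this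

/-- A complex that represents an object of `D_{fd, A/⟨e⟩}(A)` has a finite Hodge decomposition;
only the dimension of the cohomology matters here. -/
lemma nonempty_finiteHodge_of_stabFD [HasDerivedCategory.{w₁} (ModuleCat.{v} A)] {e : A}
    (M : CochainComplex (ModuleCat.{v} A) ℤ) {X : DerivedCategory (ModuleCat.{v} A)}
    (φ : X ≅ DerivedCategory.Q.obj M) (hX : StabFD K e X) : Nonempty (FiniteHodge K M) := by
  have := hX.2
  obtain ⟨h1, S, hS⟩ := exists_finset_of_finite_directSum (K := K)
    (V := fun i => (ModuleCat.restrictScalars.{v} (algebraMap K A)).obj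
    ((DerivedCategory.homologyFunctor (ModuleCat.{v} A) i).obj X))
  let E := fun i : ℤ => ((ModuleCat.restrictScalars.{v} (algebraMap K A)).mapIso
    ((DerivedCategory.homologyFunctor (ModuleCat.{v} A) i).mapIso φ ≪≫
      (DerivedCategory.homologyFunctorFactors (ModuleCat.{v} A) i).app M)).toLinearEquiv
  refine nonempty_finiteHodge M S (fun i => ?_) fun i hi => ?_
  · exact (Module.Finite.equiv_iff (E i)).1 (h1 i)
  · exact (E i).symm.toEquiv.subsingleton_congr.2 (hS i hi)

end FiniteHodge

/-! ### Shifts and vanishing -/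

section Shift

variable {N M N' M' : CochainComplex (ModuleCat.{v} A) ℤ}

/-- The change of the degree of a term of a complex along an equality. -/
def termCast {R : Type v} [Ring R] (E : CochainComplex (ModuleCat.{v} R) ℤ) {p q : ℤ} (h : p = q) :
    E.X p →ₗ[R] E.X q := (E.XIsoOfEq h).hom.hom

lemma termCast_rfl {R : Type v} [Ring R] (E : CochainComplex (ModuleCat.{v} R) ℤ) (p : ℤ)
    (x : E.X p) : termCast E (rfl : p = p) x = x := by
  rw [termCast, HomologicalComplex.XIsoOfEq_rfl]
  rfl

lemma hom_shift_d {R : Type v} [Ring R] (E : CochainComplex (ModuleCat.{v} R) ℤ) (d p q : ℤ)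
    (x : E.X (p + d)) :
    ((E⟦d⟧).d p q).hom x = (d.negOnePow : ℤ) • (E.d (p + d) (q + d)).hom x := rfl

/-- Cochains with values in a shifted complex. -/
def LC.shiftRight (d n : ℤ) : LC K N M (n + d) →ₗ[Env K A] LC K N (M⟦d⟧) n where
  toFun z := LC.mk fun p q h => z.v p (q + d) (by omega)
  map_add' _ _ := rfl
  map_smul' _ _ := rfl

lemma LC.shiftRight_v (d n : ℤ) (z : LC K N M (n + d)) (p q : ℤ) (h : p + n = q) (x : N.X p) :
    (LC.shiftRight d n z).v p q h x = z.v p (q + d) (by omega) x := rfl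

lemma LC.shiftRight_bijective (d n : ℤ) :
    Function.Bijective (LC.shiftRight (K := K) (N := N) (M := M) d n) := by
  constructor
  · intro z z' h
    refine LC.ext fun p q hpq x => ?_
    obtain rfl : q = p + n + d := by omega
    exact LC.congr_v h p (p + n) rfl x
  · intro w
    refine ⟨LC.mk fun p q h => (termCast M (show p + n + d = q by omega)).restrictScalars K ∘ₗ
      w.v p (p + n) rfl, LC.ext fun p q h x => ?_⟩
    subst h
    exact termCast_rfl M _ (w.v p (p + n) rfl x)

/-- The sign on the differential of `M⟦d⟧` and the sign in the differential of cochains combine to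
the sign on the differential of a shifted complex. -/
lemma LC.shiftRight_δ (d : ℤ) {n m : ℤ} (h : n + 1 = m) (z : LC K N M (n + d)) :
    LC.δ h (LC.shiftRight d n z) =
      (d.negOnePow : ℤ) • LC.shiftRight d m (LC.δ (show n + d + 1 = m + d by omega) z) := by
  refine LC.ext fun p q hpq x => ?_
  change _ = (d.negOnePow : ℤ) • (LC.shiftRight d m (LC.δ _ z)).v p q hpq x
  rw [LC.δ_v h _ p q hpq (p + 1) (q - 1) rfl (by omega), LC.shiftRight_v, LC.shiftRight_v,
    LC.shiftRight_v, LC.δ_v _ z p (q + d) (by omega) (p + 1) (q - 1 + d) rfl (by omega)]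
  refine Eq.trans ?_ (smul_add (d.negOnePow : ℤ) _ _).symm
  refine congrArg (_ + ·) (Eq.symm ((smul_smul _ _ _).trans ?_))
  rw [Int.negOnePow_add, Units.val_mul, mul_left_comm, negOnePow_mul_self_int, mul_one]

variable (K N M) in
/-- Shifting commutes with `Hom_K(N, -)`, without signs. -/
def shiftMap (d : ℤ) : (homCx K N M)⟦d⟧ ⟶ homCx K N (M⟦d⟧) :=
  mkHom (F := (homCx K N M)⟦d⟧) (G := homCx K N (M⟦d⟧)) (fun n => LC.shiftRight d n)
    fun i j hij z => by
      rw [homCx_d _ _ _ _ hij]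
      refine (LC.shiftRight_δ d hij z).trans ?_
      rw [← map_zsmul]
      refine congrArg (LC.shiftRight d j) (Eq.trans ?_ (hom_shift_d (homCx K N M) d i j z).symm)
      exact congrArg ((d.negOnePow : ℤ) • ·) (homCx_d _ _ (i + d) (j + d) (by omega) z).symm

instance isIso_shiftMap (d : ℤ) : IsIso (shiftMap K N M d) := by
  have : ∀ n, IsIso ((shiftMap K N M d).f n) := fun n => by
    rw [ConcreteCategory.isIso_iff_bijective]
    exact LC.shiftRight_bijective d n
  exact HomologicalComplex.Hom.isIso_of_components _

lemma shiftMap_naturality (f : N' ⟶ N) (g : M ⟶ M') (d : ℤ) :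
    (homCxMap K f g)⟦d⟧' ≫ shiftMap K N' M' d = shiftMap K N M d ≫ homCxMap K f (g⟦d⟧') := rfl

end Shift

section Vanishing

variable {X : CochainComplex (ModuleCat.{v} (Env K A)) ℤ}
  {N M : CochainComplex (ModuleCat.{v} A) ℤ}

/-- A cocycle of `Hom_A(X, M)`, as a morphism of complexes. -/
def cocycleHom {j k : ℤ} (hjk : j + 1 = k) (z : RC X M j) (hz : RC.δ hjk z = 0) :
    ((leftRes K A).mapHomologicalComplex (ComplexShape.up ℤ)).obj X ⟶ M⟦j⟧ :=
  mkHom (F := ((leftRes K A).mapHomologicalComplex (ComplexShape.up ℤ)).obj X) (G := M⟦j⟧)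
    (fun p => z.v p (p + j) rfl) fun p q hpq x => by
      subst hjk
      let x' : X.X p := x
      have h := RC.congr_v hz p (q + j) (by omega) x'
      rw [RC.δ_v rfl z p (q + j) _ q (p + j) hpq (by omega), RC.zero_v, LinearMap.zero_apply,
        negOnePow_succ_int, neg_smul, add_neg_eq_zero] at h
      have h' := congrArg (fun t => (j.negOnePow : ℤ) • t) h
      simp only [smul_smul, negOnePow_mul_self_int, one_smul] at h'
      exact (hom_shift_d M j p q _).trans h'

/-- If the morphism attached to a cocycle is null-homotopic, then the cocycle is a coboundary. -/
lemma exists_eq_δ_of_homotopy {i j k : ℤ} (hij : i + 1 = j) (hjk : j + 1 = k) (z : RC X M j)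
    (hz : RC.δ hjk z = 0) (H : Homotopy (cocycleHom hjk z hz) 0) :
    ∃ w : RC X M i, z = RC.δ hij w := by
  let s : ∀ p q : ℤ, X.X p →ₗ[A] M.X (q + j) := fun p q => (H.hom p q).hom
  refine ⟨RC.mk fun p q h => (j.negOnePow : ℤ) •
    (termCast M (show p - 1 + j = q by omega) ∘ₗ s p (p - 1)), RC.ext fun p q h x => ?_⟩
  subst h
  rw [RC.δ_v hij _ p (p + j) rfl (p + 1) (p - 1 + j) rfl (by omega), RC.mk_v, RC.mk_v]
  have h1 : z.v p (p + j) rfl x = s (p + 1) p ((X.d p (p + 1)).hom x) +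
      (j.negOnePow : ℤ) • (M.d (p - 1 + j) (p + j)).hom (s p (p - 1) x) :=
    (homotopyZero_apply H (p - 1) p (p + 1) (by omega) rfl x).trans (add_comm _ _)
  have h2 : ∀ m (hm : m = p) y, termCast M (show m + j = p + j by omega) (s (p + 1) m y) =
      s (p + 1) p y := by
    rintro _ rfl y
    exact termCast_rfl M _ _
  rw [h1]
  simp only [LinearMap.smul_apply, LinearMap.comp_apply]
  rw [h2 (p + 1 - 1) (by omega), smul_smul, negOnePow_mul_self_int, one_smul, termCast_rfl,
    map_zsmul]
  exact add_comm _ _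

variable [HasDerivedCategory.{w₁} (ModuleCat.{v} A)]
  [HasDerivedCategory.{w₃} (ModuleCat.{v} (Env K A))]

/-- If `RHom_A(X, M)` vanishes and `M` is K-injective, then `Hom_A(X, M)` is acyclic. -/
lemma rightHomCx_acyclic [M.IsKInjective]
    (h : RHomVanishes ((resLeft K A).obj (DerivedCategory.Q.obj X)) (DerivedCategory.Q.obj M)) :
    (rightHomCx X M).Acyclic := by
  rw [acyclic_iff]
  intro i j k hij hjk z hz
  rw [rightHomCx_d _ _ _ _ hjk] at hz
  have : DerivedCategory.Q.map (cocycleHom hjk z hz) = 0 := by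
    have := h j
    have e := ((DerivedCategory.Q : CochainComplex (ModuleCat.{v} A) ℤ ⥤ _).commShiftIso j).app M
    have h1 : (leftRes K A).mapDerivedCategoryFactors.hom.app X ≫
        DerivedCategory.Q.map (cocycleHom hjk z hz) ≫ e.hom = 0 :=
      Subsingleton.elim (α := (resLeft K A).obj (DerivedCategory.Q.obj X) ⟶
        (DerivedCategory.Q.obj M)⟦j⟧) _ _
    rwa [Preadditive.IsIso.comp_left_eq_zero, Preadditive.IsIso.comp_right_eq_zero] at h1
  rw [Q_map_eq_zero_iff_of_isKInjective] at this
  obtain ⟨w, hw⟩ := exists_eq_δ_of_homotopy hij hjk z hz this.some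
  exact ⟨w, (rightHomCx_d _ _ _ _ hij w).trans hw.symm⟩

lemma RHomVanishes.shift {X Y : DerivedCategory (ModuleCat.{v} A)} (h : RHomVanishes X Y) (n : ℤ) :
    RHomVanishes X (Y⟦n⟧) := fun m =>
  have := h (n + m)
  ((shiftFunctorAdd (DerivedCategory (ModuleCat.{v} A)) n m).app Y).homToEquiv.symm.subsingleton

/-- If `RHom_A(X, M)` vanishes, then there are no nonzero morphisms from `X` to `Hom_K(N, M)` in
`D(Aᵉ)`. -/
lemma subsingleton_hom_homCx [X.IsKProjective] [M.IsKInjective]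
    (h : RHomVanishes ((resLeft K A).obj (DerivedCategory.Q.obj X)) (DerivedCategory.Q.obj M))
    (N : CochainComplex (ModuleCat.{v} A) ℤ) :
    Subsingleton (DerivedCategory.Q.obj X ⟶ DerivedCategory.Q.obj (homCx K N M)) := by
  refine subsingleton_of_forall_eq 0 fun g => ?_
  obtain ⟨f, rfl⟩ := Q_map_surjective_of_isKProjective g
  rw [Q_map_eq_zero_iff_of_isKProjective]
  exact homotopy_zero_of_rightHomCx_acyclic (rightHomCx_acyclic h) f

/-- If `RHom_A(X, M)` vanishes, then so does `RHom_{Aᵉ}(X, Hom_K(N, M))`. -/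
lemma rHomVanishes_homCx [X.IsKProjective] [M.IsKInjective]
    (h : RHomVanishes ((resLeft K A).obj (DerivedCategory.Q.obj X)) (DerivedCategory.Q.obj M))
    (N : CochainComplex (ModuleCat.{v} A) ℤ) :
    RHomVanishes (DerivedCategory.Q.obj X) (DerivedCategory.Q.obj (homCx K N M)) := fun n => by
  have h1 : RHomVanishes ((resLeft K A).obj (DerivedCategory.Q.obj X))
      (DerivedCategory.Q.obj (M⟦n⟧)) := fun m =>
    ((shiftFunctor _ m).mapIso ((DerivedCategory.Q :
      CochainComplex (ModuleCat.{v} A) ℤ ⥤ _).commShiftIso n |>.app M)).homToEquiv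
        |>.subsingleton_congr.2 (h.shift n m)
  have := subsingleton_hom_homCx h1 N
  exact ((DerivedCategory.Q.mapIso (asIso (shiftMap K N M n))).symm ≪≫
    ((DerivedCategory.Q : CochainComplex (ModuleCat.{v} (Env K A)) ℤ ⥤ _).commShiftIso n).app
      (homCx K N M)).homToEquiv.symm.subsingleton

end Vanishing

end Enveloping

/-! ### Triangles -/

section Triangles

/-- K-projective complexes form a triangulated subcategory of the homotopy category. -/
lemma isKProjective_mappingCone {R : Type v} [Ring R] {X Y : CochainComplex (ModuleCat.{v} R) ℤ}
    (f : X ⟶ Y) [X.IsKProjective] [Y.IsKProjective] :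
    (CochainComplex.mappingCone f).IsKProjective := by
  have hX := CochainComplex.IsKProjective.leftOrthogonal X
  have hY := CochainComplex.IsKProjective.leftOrthogonal Y
  rw [CochainComplex.isKProjective_iff_leftOrthogonal]
  exact ObjectProperty.ext_of_isTriangulatedClosed₃ _ _
    (HomotopyCategory.mappingCone_triangleh_distinguished f) hX hY

open Pretriangulated in
/-- A morphism whose cone has no morphisms to `Z` and `Z⟦1⟧` induces a bijection on morphisms to
`Z`. -/
lemma bijective_comp_of_distinguished {C : Type*} [Category C] [Preadditive C]
    [Limits.HasZeroObject C] [HasShift C ℤ] [∀ n : ℤ, (shiftFunctor C n).Additive]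
    [Pretriangulated C]
    (T : Triangle C) (hT : T ∈ distinguishedTriangles) (Z : C)
    (h0 : Subsingleton (T.obj₃ ⟶ Z)) (h1 : Subsingleton (T.obj₃ ⟶ Z⟦(1 : ℤ)⟧)) :
    Function.Bijective (fun x : T.obj₂ ⟶ Z => T.mor₁ ≫ x) := by
  constructor
  · intro x y hxy
    obtain ⟨g, hg⟩ := T.yoneda_exact₂ hT (x - y) (by
      rw [Preadditive.comp_sub, sub_eq_zero]; exact hxy)
    rw [Subsingleton.elim g 0, Limits.comp_zero, sub_eq_zero] at hg
    exact hg
  · intro y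
    obtain ⟨g, hg⟩ := T.invRotate.yoneda_exact₂ (inv_rot_of_distTriang _ hT) y (by
      apply (shiftFunctor C (1 : ℤ)).map_injective
      have h := Subsingleton.elim ((shiftNegShift T.obj₃ (1 : ℤ)).inv ≫
        (T.invRotate.mor₁ ≫ y)⟦(1 : ℤ)⟧') 0
      rwa [Preadditive.IsIso.comp_left_eq_zero, ← Functor.map_zero (shiftFunctor C (1 : ℤ))] at h)
    exact ⟨g, hg.symm⟩

end Triangles

section Enveloping

variable {K : Type u} [Field K] {A : Type v} [Ring A] [Algebra K A]

section DualComplex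

variable {P P' P'' : CochainComplex (ModuleCat.{v} (Env K A)) ℤ}

/-- The functoriality of `Hom_{Aᵉ}(-, Aᵉ)` on complexes. -/
def dualComplexMap (f : P ⟶ P') : dualComplex K A P' ⟶ dualComplex K A P :=
  ((dualFunctor K A).mapHomologicalComplex (ComplexShape.up ℤ)).map
    ((CochainComplex.opEquivalence (ModuleCat.{v} (Env K A))).functor.map f.op)

lemma dualComplexMap_id : dualComplexMap (𝟙 P) = 𝟙 (dualComplex K A P) := by
  simp [dualComplexMap, dualComplex]

lemma dualComplexMap_comp (f : P ⟶ P') (g : P' ⟶ P'') :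
    dualComplexMap (f ≫ g) = dualComplexMap g ≫ dualComplexMap f := by
  rw [dualComplexMap, op_comp, Functor.map_comp, Functor.map_comp]
  rfl

/-- Homotopic morphisms have homotopic duals. -/
def homotopyDual {f g : P ⟶ P'} (h : Homotopy f g) :
    Homotopy (dualComplexMap f) (dualComplexMap g) :=
  (dualFunctor K A).mapHomotopy (CochainComplex.homotopyOp h)

variable [HasDerivedCategory.{w₃} (ModuleCat.{v} (Env K A))]

/-- The dual of a K-projective complex depends only on its class in the derived category. -/
lemma nonempty_iso_dualComplex [P.IsKProjective] [P'.IsKProjective]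
    (e : DerivedCategory.Q.obj P ≅ DerivedCategory.Q.obj P') :
    Nonempty (DerivedCategory.Q.obj (dualComplex K A P) ≅
      DerivedCategory.Q.obj (dualComplex K A P')) := by
  obtain ⟨f, hf⟩ := Q_map_surjective_of_isKProjective e.hom
  obtain ⟨g, hg⟩ := Q_map_surjective_of_isKProjective e.inv
  have key : ∀ {X : CochainComplex (ModuleCat.{v} (Env K A)) ℤ} [X.IsKProjective] (u : X ⟶ X),
      DerivedCategory.Q.map u = 𝟙 _ → DerivedCategory.Q.map (dualComplexMap u) = 𝟙 _ := by
    intro X _ u hu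
    have h1 : DerivedCategory.Q.map (u - 𝟙 X) = 0 := by
      rw [Functor.map_sub, hu, CategoryTheory.Functor.map_id, sub_self]
    rw [Q_map_eq_zero_iff_of_isKProjective] at h1
    rw [← CategoryTheory.Functor.map_id, ← dualComplexMap_id]
    exact DerivedCategory.Q_map_eq_of_homotopy _ (homotopyDual (Homotopy.equivSubZero.symm h1.some))
  refine ⟨⟨DerivedCategory.Q.map (dualComplexMap g), DerivedCategory.Q.map (dualComplexMap f),
    ?_, ?_⟩⟩
  · rw [← Functor.map_comp, ← dualComplexMap_comp]
    exact key _ (by rw [Functor.map_comp, hf, hg, e.hom_inv_id])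
  · rw [← Functor.map_comp, ← dualComplexMap_comp]
    exact key _ (by rw [Functor.map_comp, hf, hg, e.inv_hom_id])

/-- `Ω_A` can be computed from any K-projective resolution of the bimodule `A`. -/
lemma nonempty_iso_invDual [P.IsKProjective]
    (e : DerivedCategory.Q.obj P ≅ (DerivedCategory.singleFunctor _ 0).obj (diagBimod K A)) :
    Nonempty (DerivedCategory.Q.obj (dualComplex K A P) ≅ invDual K A) := by
  have : IsIso (DerivedCategory.Q.map (projectiveResolution (diagBimod K A)).π') := inferInstance
  exact nonempty_iso_dualComplex (e ≪≫ (DerivedCategory.singleFunctorIsoCompQ _ 0).app _ ≪≫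
    (asIso (DerivedCategory.Q.map (projectiveResolution (diagBimod K A)).π')).symm)

end DualComplex

section Comparison

variable [HasDerivedCategory.{w₁} (ModuleCat.{v} A)]
  [HasDerivedCategory.{w₃} (ModuleCat.{v} (Env K A))]

lemma rHomVanishes_resLeft_of_iso {X Y : DerivedCategory (ModuleCat.{v} (Env K A))} (e : X ≅ Y)
    {M : DerivedCategory (ModuleCat.{v} A)} (h : RHomVanishes ((resLeft K A).obj Y) M) :
    RHomVanishes ((resLeft K A).obj X) M := fun n =>
  (((resLeft K A).mapIso e).homFromEquiv).subsingleton_congr.2 (h n)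

open Pretriangulated in
/-- Precomposition with a morphism `A → Ω_A[d]` whose cone is orthogonal to `M` is bijective on
morphisms to the shifts of `Hom_K(N, M)`. -/
lemma bijective_comp_shift {P : CochainComplex (ModuleCat.{v} (Env K A)) ℤ} [P.IsKProjective]
    [(dualComplex K A P).IsKProjective] (d : ℤ) {S Ω C : DerivedCategory (ModuleCat.{v} (Env K A))}
    (a : DerivedCategory.Q.obj P ≅ S) (b : DerivedCategory.Q.obj (dualComplex K A P) ≅ Ω)
    (ψ : S ⟶ Ω⟦d⟧) (α : Ω⟦d⟧ ⟶ C) (β : C ⟶ S⟦(1 : ℤ)⟧)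
    (hT : Triangle.mk ψ α β ∈ distinguishedTriangles)
    (M : CochainComplex (ModuleCat.{v} A) ℤ) [M.IsKInjective]
    (hM : RHomVanishes ((resLeft K A).obj C) (DerivedCategory.Q.obj M))
    (N : CochainComplex (ModuleCat.{v} A) ℤ) :
    Function.Bijective (fun x : DerivedCategory.Q.obj (dualComplex K A P) ⟶
      DerivedCategory.Q.obj (homCx K N M) => (a.hom ≫ ψ ≫ b.inv⟦d⟧') ≫ x⟦d⟧') := by
  let s := ((DerivedCategory.Q : CochainComplex (ModuleCat.{v} (Env K A)) ℤ ⥤ _).commShiftIso d).app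
    (dualComplex K A P)
  obtain ⟨f, hf⟩ := Q_map_surjective_of_isKProjective (a.hom ≫ ψ ≫ b.inv⟦d⟧' ≫ s.inv)
  have hcone := isKProjective_mappingCone f
  have hT' := DerivedCategory.mappingCone_triangle_distinguished f
  let e := isoTriangleOfIso₁₂ (DerivedCategory.Q.mapTriangle.obj
    (CochainComplex.mappingCone.triangle f)) _ hT' hT a (s ≪≫ (shiftFunctor _ d).mapIso b) (by
      change DerivedCategory.Q.map f ≫ s.hom ≫ b.hom⟦d⟧' = a.hom ≫ ψ
      rw [hf]
      simp only [Category.assoc, Iso.inv_hom_id_assoc, ← Functor.map_comp, b.inv_hom_id,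
        CategoryTheory.Functor.map_id, Category.comp_id])
  have hC : DerivedCategory.Q.obj (CochainComplex.mappingCone f) ≅ C := Triangle.π₃.mapIso e
  have h0 := rHomVanishes_homCx (rHomVanishes_resLeft_of_iso hC hM) N
  have h1 := bijective_comp_of_distinguished _ hT' ((DerivedCategory.Q.obj (homCx K N M))⟦d⟧)
    (h0 d) (h0.shift d 1)
  have h2 := (h1.comp s.symm.homFromEquiv.bijective).comp
    (⟨Functor.map_injective _, Functor.map_surjective _⟩ : Function.Bijective
      ((shiftFunctor (DerivedCategory (ModuleCat.{v} (Env K A))) d).map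
        (X := DerivedCategory.Q.obj (dualComplex K A P))
        (Y := DerivedCategory.Q.obj (homCx K N M))))
  have h3 : Function.Bijective (fun x : DerivedCategory.Q.obj (dualComplex K A P) ⟶
      DerivedCategory.Q.obj (homCx K N M) => DerivedCategory.Q.map f ≫ s.hom ≫ x⟦d⟧') := h2
  simpa only [hf, Category.assoc, Iso.inv_hom_id_assoc] using h3

end Comparison

/-! ### The duality -/

section Duality

variable [HasDerivedCategory.{w₃} (ModuleCat.{v} (Env K A))]
  {L : Type v} [AddCommGroup L] [Module K L] (ι : K ≃ₗ[K] L)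
  {M N M' N' : CochainComplex (ModuleCat.{v} A) ℤ}

/-- If `M` has finite-dimensional total cohomology, then the dual of `Hom_K(M, N)` is isomorphic
to `Hom_K(N, M)` in the derived category of bimodules. -/
def dualHomIso (M N : CochainComplex (ModuleCat.{v} A) ℤ) (hM : Nonempty (FiniteHodge K M)) :
    DerivedCategory.Q.obj (dualCx K L (homBi K M N)) ≅ DerivedCategory.Q.obj (homCx K N M) :=
  have := quasiIso_kappa ι N hM.some
  have := quasiIso_homCxMap_evalDual (N := N) ι hM.some
  asIso (DerivedCategory.Q.map (kappa ι M N)) ≪≫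
    (asIso (DerivedCategory.Q.map (homCxMap K (𝟙 N) (evalDual K L M)))).symm

/-- The isomorphism between `D Hom_K(M, N)` and `Hom_K(N, M)` is natural in both arguments. -/
lemma dualHomIso_naturality (hM : Nonempty (FiniteHodge K M)) (hM' : Nonempty (FiniteHodge K M'))
    (f : M ⟶ M') (g : N' ⟶ N) :
    DerivedCategory.Q.map (dualCxMap K L (homBiMap f g)) ≫
      (dualHomIso ι M' N' hM').hom =
    (dualHomIso ι M N hM).hom ≫ DerivedCategory.Q.map (homCxMap K g f) := by
  have := quasiIso_homCxMap_evalDual (N := N') ι hM'.some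
  have h' : (dualHomIso ι M' N' hM').hom ≫
      DerivedCategory.Q.map (homCxMap K (𝟙 N') (evalDual K L M')) =
      DerivedCategory.Q.map (kappa ι M' N') := by simp [dualHomIso]
  have h : (dualHomIso ι M N hM).hom ≫
      DerivedCategory.Q.map (homCxMap K (𝟙 N) (evalDual K L M)) =
      DerivedCategory.Q.map (kappa ι M N) := by simp [dualHomIso]
  rw [← cancel_mono (DerivedCategory.Q.map (homCxMap K (𝟙 N') (evalDual K L M'))),
    Category.assoc, Category.assoc, h', ← Functor.map_comp, ← Functor.map_comp,
    kappa_naturality, Functor.map_comp, ← h, Category.assoc, ← Functor.map_comp]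
  rfl

variable (K) in
/-- Shifting commutes with `Hom_K(N, -)` in the derived category of bimodules. -/
def shiftHomIso (N M : CochainComplex (ModuleCat.{v} A) ℤ) (d : ℤ) :
    (DerivedCategory.Q.obj (homCx K N M))⟦d⟧ ≅ DerivedCategory.Q.obj (homCx K N (M⟦d⟧)) :=
  ((DerivedCategory.Q : CochainComplex (ModuleCat.{v} (Env K A)) ℤ ⥤ _).commShiftIso d).symm.app
    (homCx K N M) ≪≫ DerivedCategory.Q.mapIso (asIso (shiftMap K N M d))

lemma shiftHomIso_naturality (f : N' ⟶ N) (g : M ⟶ M') (d : ℤ) :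
    (DerivedCategory.Q.map (homCxMap K f g))⟦d⟧' ≫ (shiftHomIso K N' M' d).hom =
      (shiftHomIso K N M d).hom ≫ DerivedCategory.Q.map (homCxMap K f (g⟦d⟧')) := by
  have h := ((DerivedCategory.Q : CochainComplex (ModuleCat.{v} (Env K A)) ℤ ⥤ _).commShiftIso
    d).inv.naturality (homCxMap K f g)
  have h' := congrArg DerivedCategory.Q.map (shiftMap_naturality (K := K) f g d)
  rw [Functor.map_comp, Functor.map_comp] at h'
  have hs : ∀ N M : CochainComplex (ModuleCat.{v} A) ℤ, (shiftHomIso K N M d).hom =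
      ((DerivedCategory.Q : CochainComplex (ModuleCat.{v} (Env K A)) ℤ ⥤ _).commShiftIso d).inv.app
        (homCx K N M) ≫ DerivedCategory.Q.map (shiftMap K N M d) := fun _ _ => rfl
  rw [hs, hs, Category.assoc, ← h', ← Category.assoc, ← Category.assoc]
  exact congrArg (· ≫ _) h

variable [HasDerivedCategory.{w₁} (ModuleCat.{v} A)]

/-- Morphisms `N → M` in `D(A)` are the same as morphisms from `A` to `Hom_K(N, M)` in `D(Aᵉ)`,
naturally in both arguments. -/
lemma exists_natural_resUnit {P : CochainComplex (ModuleCat.{v} (Env K A)) ℤ}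
    (ε : P ⟶ (HomologicalComplex.single (ModuleCat.{v} (Env K A)) (ComplexShape.up ℤ) 0).obj
      (diagBimod K A)) [QuasiIso ε] (b : ℤ) [P.IsStrictlyLE b] [P.IsKProjective]
    (hP : ∀ i, Module.Projective (Env K A) (P.X i)) :
    ∃ E : ∀ (N M : CochainComplex (ModuleCat.{v} A) ℤ), M.IsKInjective →
      ((DerivedCategory.Q.obj N ⟶ DerivedCategory.Q.obj M) ≃ₗ[K]
        (DerivedCategory.Q.obj P ⟶ DerivedCategory.Q.obj (homCx K N M))),
      ∀ (N M N' M' : CochainComplex (ModuleCat.{v} A) ℤ) (hM : M.IsKInjective)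
        (hM' : M'.IsKInjective) (f : N' ⟶ N) (g : M ⟶ M') x,
        E N' M' hM' (DerivedCategory.Q.map f ≫ x ≫ DerivedCategory.Q.map g) =
          E N M hM x ≫ DerivedCategory.Q.map (homCxMap K f g) := by
  choose E hE using fun (N M : CochainComplex (ModuleCat.{v} A) ℤ) (_ : M.IsKInjective) =>
    exists_linearEquiv_resUnit N M ε b hP
  refine ⟨E, fun N M N' M' hM hM' f g x => ?_⟩
  obtain ⟨x, rfl⟩ := Q_map_surjective_of_isKInjective x
  rw [← Functor.map_comp, ← Functor.map_comp, hE, hE, resUnit_comp_right, resUnit_comp_left,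
    Category.assoc, homCxMap_comp, Functor.map_comp]
  rfl

/-- The duality for K-injective complexes. Here `S` is a class of complexes with finite-dimensional
cohomology and `θ` is a morphism `A → Ω_A[d]` that behaves like an isomorphism against the
bimodules `Hom_K(N, M)` with `M` in `S`. -/
lemma exists_duality_of_comparison (ι : K ≃ₗ[K] L) {P : CochainComplex (ModuleCat.{v} (Env K A)) ℤ}
    (ε : P ⟶ (HomologicalComplex.single (ModuleCat.{v} (Env K A)) (ComplexShape.up ℤ) 0).obj
      (diagBimod K A)) [QuasiIso ε] (b : ℤ) [P.IsStrictlyLE b] [P.IsKProjective]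
    [(dualComplex K A P).IsKProjective] (β : FiniteDualBasis P)
    (hP : ∀ i, Module.Projective (Env K A) (P.X i)) (d : ℤ)
    (θ : DerivedCategory.Q.obj P ⟶ (DerivedCategory.Q.obj (dualComplex K A P))⟦d⟧)
    (S : CochainComplex (ModuleCat.{v} A) ℤ → Prop)
    (hS : ∀ M, S M → M.IsKInjective ∧ Nonempty (FiniteHodge K M) ∧
      ∀ N, Function.Bijective (fun x : DerivedCategory.Q.obj (dualComplex K A P) ⟶
        DerivedCategory.Q.obj (homCx K N M) => θ ≫ x⟦d⟧')) :
    ∃ E : ∀ (M N : CochainComplex (ModuleCat.{v} A) ℤ), S M → N.IsKInjective →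
      (Module.Dual K (DerivedCategory.Q.obj M ⟶ DerivedCategory.Q.obj N) ≃ₗ[K]
        (DerivedCategory.Q.obj N ⟶ (DerivedCategory.Q.obj M)⟦d⟧)),
      ∀ (M M' N N' : CochainComplex (ModuleCat.{v} A) ℤ) (hM : S M) (hM' : S M')
        (hN : N.IsKInjective) (hN' : N'.IsKInjective) (f : M ⟶ M') (g : N' ⟶ N) φ,
        E M' N' hM' hN' (φ ∘ₗ Linear.rightComp K _ (DerivedCategory.Q.map g) ∘ₗ
          Linear.leftComp K _ (DerivedCategory.Q.map f)) =
        DerivedCategory.Q.map g ≫ E M N hM hN φ ≫ (DerivedCategory.Q.map f)⟦d⟧' := by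
  obtain ⟨E₁, hE₁⟩ := exists_natural_resUnit ε b hP
  obtain ⟨T, hT⟩ := exists_linearEquiv_dual K L β
  let s := (DerivedCategory.Q : CochainComplex (ModuleCat.{v} A) ℤ ⥤ _).commShiftIso d
  let B : ∀ (M N : CochainComplex (ModuleCat.{v} A) ℤ), N.IsKInjective →
      (Module.Dual K (DerivedCategory.Q.obj M ⟶ DerivedCategory.Q.obj N) ≃ₗ[K]
        ((DerivedCategory.Q.obj P ⟶ DerivedCategory.Q.obj (homBi K M N)) →ₗ[K] L)) :=
    fun M N hN => LinearEquiv.arrowCongr (E₁ M N hN) ι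
  -- the composite `D Hom(M, N) → Hom(Ω_A, D Hom_K(M, N)) → Hom(Ω_A, Hom_K(N, M))`
  let F : ∀ (M N : CochainComplex (ModuleCat.{v} A) ℤ), S M → N.IsKInjective →
      (Module.Dual K (DerivedCategory.Q.obj M ⟶ DerivedCategory.Q.obj N) ≃ₗ[K]
        (DerivedCategory.Q.obj (dualComplex K A P) ⟶ DerivedCategory.Q.obj (homCx K N M))) :=
    fun M N hM hN => (B M N hN).trans
      ((T (homBi K M N)).symm.trans
        (Linear.homCongr K (Iso.refl _) (dualHomIso ι M N (hS M hM).2.1)))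
  -- the composite `Hom(Ω_A, Hom_K(N, M)) → Hom(A, Hom_K(N, M)[d]) → Hom(N, M[d])`
  let G : ∀ (M N : CochainComplex (ModuleCat.{v} A) ℤ), S M →
      ((DerivedCategory.Q.obj (dualComplex K A P) ⟶ DerivedCategory.Q.obj (homCx K N M)) ≃ₗ[K]
        (DerivedCategory.Q.obj N ⟶ (DerivedCategory.Q.obj M)⟦d⟧)) :=
    fun M N hM => have := (hS M hM).1
      (LinearEquiv.ofBijective (Linear.leftComp K _ θ ∘ₗ
        (shiftFunctor (DerivedCategory (ModuleCat.{v} (Env K A))) d).mapLinearMap K)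
          ((hS M hM).2.2 N)).trans
      ((Linear.homCongr K (Iso.refl _) (shiftHomIso K N M d)).trans
        ((E₁ N (M⟦d⟧) inferInstance).symm.trans
          (Linear.homCongr K (Iso.refl _) (s.app M))))
  refine ⟨fun M N hM hN => (F M N hM hN).trans (G M N hM), ?_⟩
  intro M M' N N' hM hM' hN hN' f g φ
  have hF : F M' N' hM' hN' (φ ∘ₗ Linear.rightComp K _ (DerivedCategory.Q.map g) ∘ₗ
          Linear.leftComp K _ (DerivedCategory.Q.map f)) =
      F M N hM hN φ ≫ DerivedCategory.Q.map (homCxMap K g f) := by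
    have h1 : (T (homBi K M' N')).symm (B M' N' hN'
          (φ ∘ₗ Linear.rightComp K _ (DerivedCategory.Q.map g) ∘ₗ
            Linear.leftComp K _ (DerivedCategory.Q.map f))) =
        (T (homBi K M N)).symm (B M N hN φ) ≫
          DerivedCategory.Q.map (dualCxMap K L (homBiMap f g)) := by
      rw [LinearEquiv.symm_apply_eq]
      refine LinearMap.ext fun x => ?_
      rw [hT, LinearEquiv.apply_symm_apply]
      let y : DerivedCategory.Q.obj P ⟶ DerivedCategory.Q.obj (homCx K M' N') := x
      change ι (φ ((DerivedCategory.Q.map f ≫ (E₁ M' N' hN').symm y) ≫ DerivedCategory.Q.map g)) =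
        ι (φ ((E₁ M N hN).symm (y ≫ DerivedCategory.Q.map (homCxMap K f g))))
      refine congrArg (fun t => ι (φ t)) ((E₁ M N hN).injective ?_)
      rw [LinearEquiv.apply_symm_apply, Category.assoc, hE₁ _ _ _ _ hN' hN,
        LinearEquiv.apply_symm_apply]
    change (𝟙 _ ≫ (T (homBi K M' N')).symm (B M' N' hN' _)) ≫ _ =
      ((𝟙 _ ≫ (T (homBi K M N)).symm (B M N hN φ)) ≫ _) ≫ _
    rw [h1, Category.id_comp, Category.id_comp, Category.assoc, Category.assoc]
    exact congrArg (_ ≫ ·) (dualHomIso_naturality ι _ _ f g)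
  have hG : ∀ x, G M' N' hM' (x ≫ DerivedCategory.Q.map (homCxMap K g f)) =
      DerivedCategory.Q.map g ≫ G M N hM x ≫ (DerivedCategory.Q.map f)⟦d⟧' := by
    intro x
    have hMi := (hS M hM).1
    have hMi' := (hS M' hM').1
    change (𝟙 _ ≫ (E₁ N' (M'⟦d⟧) inferInstance).symm ((𝟙 _ ≫ θ ≫ (x ≫ _)⟦d⟧') ≫ _)) ≫ _ =
      _ ≫ ((𝟙 _ ≫ (E₁ N (M⟦d⟧) inferInstance).symm ((𝟙 _ ≫ θ ≫ x⟦d⟧') ≫ _)) ≫ _) ≫ _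
    have h1 : (E₁ N' (M'⟦d⟧) inferInstance).symm ((θ ≫ (x ≫
          DerivedCategory.Q.map (homCxMap K g f))⟦d⟧') ≫ (shiftHomIso K N' M' d).hom) =
        DerivedCategory.Q.map g ≫ (E₁ N (M⟦d⟧) inferInstance).symm
          ((θ ≫ x⟦d⟧') ≫ (shiftHomIso K N M d).hom) ≫ DerivedCategory.Q.map (f⟦d⟧') := by
      rw [LinearEquiv.symm_apply_eq, hE₁ _ _ _ _ inferInstance inferInstance,
        LinearEquiv.apply_symm_apply, Functor.map_comp]
      simp only [Category.assoc]
      rw [shiftHomIso_naturality]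
    have h2 := s.hom.naturality f
    rw [Category.id_comp, Category.id_comp, h1]
    simp only [Category.assoc, Category.id_comp]
    exact congrArg (fun t => _ ≫ _ ≫ t) h2
  exact (congrArg (G M' N' hM') hF).trans (hG _)

end Duality

section Representatives

variable [HasDerivedCategory.{w₁} (ModuleCat.{v} A)]

/-- Every object of `D(A)` is represented by a K-injective complex, namely by `Hom_A(P, N)` for a
bounded above projective resolution `P` of the bimodule `A`. -/
lemma exists_isKInjective_iso {P : CochainComplex (ModuleCat.{v} (Env K A)) ℤ}
    (ε : P ⟶ (HomologicalComplex.single (ModuleCat.{v} (Env K A)) (ComplexShape.up ℤ) 0).obj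
      (diagBimod K A)) [QuasiIso ε] (b : ℤ) [P.IsStrictlyLE b] [P.IsKProjective]
    (hP : ∀ i, Module.Projective (Env K A) (P.X i)) (X : DerivedCategory (ModuleCat.{v} A)) :
    ∃ I : CochainComplex (ModuleCat.{v} A) ℤ, I.IsKInjective ∧
      Nonempty (DerivedCategory.Q.obj I ≅ X) := by
  obtain ⟨Y, ⟨e⟩⟩ := (inferInstance : (DerivedCategory.Q :
    CochainComplex (ModuleCat.{v} A) ℤ ⥤ _).EssSurj).mem_essImage X
  have := quasiIso_coaug Y ε b hP
  exact ⟨rightHomCx P Y, rightHomCx_isKInjective P Y,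
    ⟨(asIso (DerivedCategory.Q.map (coaug Y ε))).symm ≪≫ e⟩⟩

/-- A duality that is natural for morphisms of K-injective complexes extends to `D(A)`. -/
lemma exists_duality_of_representatives (d : ℤ)
    (S : CochainComplex (ModuleCat.{v} A) ℤ → Prop)
    (E : ∀ (M N : CochainComplex (ModuleCat.{v} A) ℤ), S M → N.IsKInjective →
      (Module.Dual K (DerivedCategory.Q.obj M ⟶ DerivedCategory.Q.obj N) ≃ₗ[K]
        (DerivedCategory.Q.obj N ⟶ (DerivedCategory.Q.obj M)⟦d⟧)))
    (hE : ∀ (M M' N N' : CochainComplex (ModuleCat.{v} A) ℤ) (hM : S M) (hM' : S M')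
        (hN : N.IsKInjective) (hN' : N'.IsKInjective) (f : M ⟶ M') (g : N' ⟶ N) φ,
        E M' N' hM' hN' (φ ∘ₗ Linear.rightComp K _ (DerivedCategory.Q.map g) ∘ₗ
          Linear.leftComp K _ (DerivedCategory.Q.map f)) =
        DerivedCategory.Q.map g ≫ E M N hM hN φ ≫ (DerivedCategory.Q.map f)⟦d⟧')
    (S' : ObjectProperty (DerivedCategory (ModuleCat.{v} A)))
    (I : DerivedCategory (ModuleCat.{v} A) → CochainComplex (ModuleCat.{v} A) ℤ)
    (hI : ∀ X, (I X).IsKInjective) (j : ∀ X, DerivedCategory.Q.obj (I X) ≅ X)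
    (hS : ∀ X, S' X → S (I X)) :
    ∃ Φ : ∀ (M : S'.FullSubcategory) (N : DerivedCategory (ModuleCat.{v} A)),
        Module.Dual K (M.obj ⟶ N) ≃ₗ[K] (N⟦-d⟧ ⟶ M.obj),
      ∀ (M M' : S'.FullSubcategory) (N N' : DerivedCategory (ModuleCat.{v} A))
        (f : M.obj ⟶ M'.obj) (g : N' ⟶ N) (φ : Module.Dual K (M.obj ⟶ N)),
        Φ M' N' (φ ∘ₗ Linear.rightComp K M.obj g ∘ₗ Linear.leftComp K N' f) =
          g⟦-d⟧' ≫ Φ M N φ ≫ f := by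
  let D := DerivedCategory (ModuleCat.{v} A)
  let c : ∀ X : D, X⟦d⟧⟦-d⟧ ≅ X := fun X => (shiftFunctorCompIsoId D d (-d) (by simp)).app X
  let H : ∀ N M : D, (N ⟶ M⟦d⟧) ≃ₗ[K] (N⟦-d⟧ ⟶ M) := fun N M =>
    (LinearEquiv.ofBijective ((shiftFunctor D (-d)).mapLinearMap K : (N ⟶ M⟦d⟧) →ₗ[K] _)
      ⟨Functor.map_injective _, Functor.map_surjective _⟩).trans
      (Linear.homCongr K (Iso.refl _) (c M))
  have hH : ∀ (N N' M M' : D) (g : N' ⟶ N) (f : M ⟶ M') x,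
      H N' M' (g ≫ x ≫ f⟦d⟧') = g⟦-d⟧' ≫ H N M x ≫ f := by
    intro N N' M M' g f x
    change (𝟙 _ ≫ (g ≫ x ≫ f⟦d⟧')⟦-d⟧') ≫ (c M').hom = _ ≫ ((𝟙 _ ≫ x⟦-d⟧') ≫ (c M).hom) ≫ f
    simp only [Category.id_comp, Functor.map_comp, Category.assoc]
    exact congrArg (_ ≫ _ ≫ ·) ((shiftFunctorCompIsoId D d (-d) (by simp)).hom.naturality f)
  refine ⟨fun M N => (LinearEquiv.dualMap (Linear.homCongr K (j M.obj) (j N))).trans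
    ((E (I M.obj) (I N) (hS _ M.property) (hI _)).trans
      ((Linear.homCongr K (j N) ((shiftFunctor D d).mapIso (j M.obj))).trans (H N M.obj))), ?_⟩
  intro M M' N N' f g φ
  have := hI N
  have := hI M'.obj
  obtain ⟨f', hf⟩ := Q_map_surjective_of_isKInjective ((j M.obj).hom ≫ f ≫ (j M'.obj).inv)
  obtain ⟨g', hg⟩ := Q_map_surjective_of_isKInjective ((j N').hom ≫ g ≫ (j N).inv)
  have h1 := hE (I M.obj) (I M'.obj) (I N) (I N') (hS _ M.property) (hS _ M'.property) (hI _)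
    (hI _) f' g' (LinearEquiv.dualMap (Linear.homCongr K (j M.obj) (j N)) φ)
  have h2 : (LinearEquiv.dualMap (Linear.homCongr K (j M'.obj) (j N'))
      (φ ∘ₗ Linear.rightComp K M.obj g ∘ₗ Linear.leftComp K N' f)) =
      (LinearEquiv.dualMap (Linear.homCongr K (j M.obj) (j N)) φ) ∘ₗ
        Linear.rightComp K _ (DerivedCategory.Q.map g') ∘ₗ
          Linear.leftComp K _ (DerivedCategory.Q.map f') := by
    refine LinearMap.ext fun x => congrArg φ ?_
    change (f ≫ ((j M'.obj).inv ≫ x) ≫ (j N').hom) ≫ g =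
      ((j M.obj).inv ≫ ((DerivedCategory.Q.map f' ≫ x) ≫ DerivedCategory.Q.map g')) ≫ (j N).hom
    rw [hf, hg]
    simp
  refine Eq.trans ?_ (hH N N' M.obj M'.obj g f _)
  refine congrArg (H N' M'.obj) ?_
  refine (congrArg _ ((congrArg _ h2).trans h1)).trans ?_
  change ((j N').inv ≫ (_ ≫ _ ≫ _)) ≫ (j M'.obj).hom⟦d⟧' =
    g ≫ (((j N).inv ≫ _) ≫ (j M.obj).hom⟦d⟧') ≫ f⟦d⟧'
  rw [hf, hg]
  simp only [Category.assoc, Iso.inv_hom_id_assoc, ← Functor.map_comp, Iso.inv_hom_id,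
    Category.comp_id]
  rfl

/-- If `A` is trivial, then so are all the spaces of morphisms in `D(A)`. -/
lemma subsingleton_hom_of_subsingleton [Subsingleton A] (X Y : DerivedCategory (ModuleCat.{v} A)) :
    Subsingleton (X ⟶ Y) := by
  obtain ⟨X', ⟨e⟩⟩ := (inferInstance : (DerivedCategory.Q :
    CochainComplex (ModuleCat.{v} A) ℤ ⥤ _).EssSurj).mem_essImage X
  have h0 : 𝟙 X' = 0 := by
    ext i : 1
    refine ModuleCat.hom_ext (LinearMap.ext fun x => ?_)
    have := Module.subsingleton A (X'.X i)
    exact Subsingleton.elim _ _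
  have h1 : 𝟙 X = 0 := by
    rw [← e.inv_hom_id, ← Category.id_comp e.hom, ← CategoryTheory.Functor.map_id, h0,
      Functor.map_zero, Limits.zero_comp, Limits.comp_zero]
  refine subsingleton_of_forall_eq 0 fun f => ?_
  rw [← Category.id_comp f, h1, Limits.zero_comp]

end Representatives

section InternallyCY

variable [HasDerivedCategory.{w₁} (ModuleCat.{v} A)] [HasDerivedCategory.{w₂} (ModuleCat.{v} Aᵐᵒᵖ)]
  [HasDerivedCategory.{w₃} (ModuleCat.{v} (Env K A))]

/-- The internal Calabi-Yau duality over a nontrivial algebra. -/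
lemma IsBimoduleInternallyCY.exists_duality [Nontrivial A] {e : A} {d : ℕ}
    (hA : IsBimoduleInternallyCY K e d) :
    ∃ Φ : ∀ (M : (StabFD K e).FullSubcategory) (N : DerivedCategory (ModuleCat.{v} A)),
        Module.Dual K (M.obj ⟶ N) ≃ₗ[K] (N⟦-(d : ℤ)⟧ ⟶ M.obj),
      ∀ (M M' : (StabFD K e).FullSubcategory) (N N' : DerivedCategory (ModuleCat.{v} A))
        (f : M.obj ⟶ M'.obj) (g : N' ⟶ N) (φ : Module.Dual K (M.obj ⟶ N)),
        Φ M' N' (φ ∘ₗ Linear.rightComp K M.obj g ∘ₗ Linear.leftComp K N' f) =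
          g⟦-(d : ℤ)⟧' ≫ Φ M N φ ≫ f := by
  obtain ⟨P, ⟨a, ha⟩, ⟨b, hb⟩, hP, ⟨u⟩⟩ := hA.isPerfect
  obtain ⟨C, ψ, α, β, hT, hC, -⟩ := hA.exists_triangle
  have hP' : ∀ i, Projective (P.X i) := fun i =>
    (IsProjective.iff_projective (R := Env K A) (P.X i)).1 (hP i).2
  have hKP : P.IsKProjective := CochainComplex.isKProjective_of_projective P b
  have hKD := isKProjective_dualComplex P a hP
  obtain ⟨ε, hε⟩ : ∃ ε : P ⟶ (HomologicalComplex.single (ModuleCat.{v} (Env K A))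
      (ComplexShape.up ℤ) 0).obj (diagBimod K A), DerivedCategory.Q.map ε =
        u.hom ≫ (DerivedCategory.singleFunctorIsoCompQ _ 0).hom.app (diagBimod K A) :=
    Q_map_surjective_of_isKProjective _
  have hq : QuasiIso ε := by
    rw [← DerivedCategory.isIso_Q_map_iff_quasiIso, hε]
    exact inferInstanceAs (IsIso (u.hom ≫
      (DerivedCategory.singleFunctorIsoCompQ _ 0).hom.app (diagBimod K A)))
  obtain ⟨ω⟩ := nonempty_iso_invDual u
  obtain ⟨B⟩ := nonempty_finiteDualBasis P a b hP
  -- the image of `K` in `A` is a copy of the ground field in the universe of `A`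
  let ι : K ≃ₗ[K] LinearMap.range (Algebra.linearMap K A) :=
    LinearEquiv.ofInjective _ (algebraMap K A).injective
  choose I hI j using exists_isKInjective_iso ε b (fun i => (hP i).2)
  let S : CochainComplex (ModuleCat.{v} A) ℤ → Prop := fun M =>
    M.IsKInjective ∧ Nonempty (FiniteHodge K M) ∧
      RHomVanishes ((resLeft K A).obj C) (DerivedCategory.Q.obj M)
  obtain ⟨E, hE⟩ := exists_duality_of_comparison ι ε b B (fun i => (hP i).2) d
    (u.hom ≫ ψ ≫ ω.inv⟦(d : ℤ)⟧') S fun M hM => ⟨hM.1, hM.2.1, fun N =>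
      have := hM.1
      bijective_comp_shift d u ω ψ α β hT M hM.2.2 N⟩
  refine exists_duality_of_representatives d S E hE (StabFD K e) I hI (fun X => (j X).some)
    fun X hX => ⟨hI X, nonempty_finiteHodge_of_stabFD _ (j X).some.symm hX, fun n => ?_⟩
  exact (((shiftFunctor _ n).mapIso (j X).some).homToEquiv).subsingleton_congr.2 (hC X hX n)

end InternallyCY

end Enveloping

end

end BimodCY

theorem mainTheorem5 {K : Type u} [Field K] {A : Type v} [Ring A] [Algebra K A]
    [HasDerivedCategory.{w₁} (ModuleCat.{v} A)] [HasDerivedCategory.{w₂} (ModuleCat.{v} Aᵐᵒᵖ)]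
    [HasDerivedCategory.{w₃} (ModuleCat.{v} (BimodCY.Env K A))]
    (e : A) (he : IsIdempotentElem e) (d : ℕ)
    (hA : BimodCY.IsBimoduleInternallyCY K e d) :
    ∃ Φ : ∀ (M : (BimodCY.StabFD K e).FullSubcategory) (N : DerivedCategory (ModuleCat.{v} A)),
        Module.Dual K (M.obj ⟶ N) ≃ₗ[K] (N⟦-(d : ℤ)⟧ ⟶ M.obj),
      ∀ (M M' : (BimodCY.StabFD K e).FullSubcategory)
        (N N' : DerivedCategory (ModuleCat.{v} A)) (f : M.obj ⟶ M'.obj) (g : N' ⟶ N)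
        (φ : Module.Dual K (M.obj ⟶ N)),
        Φ M' N' (φ ∘ₗ Linear.rightComp K M.obj g ∘ₗ Linear.leftComp K N' f) =
          g⟦-(d : ℤ)⟧' ≫ Φ M N φ ≫ f := by
  cases subsingleton_or_nontrivial A
  · have := BimodCY.subsingleton_hom_of_subsingleton (A := A)
    have h : ∀ X Y : DerivedCategory (ModuleCat.{v} A), Subsingleton (Module.Dual K (X ⟶ Y)) :=
      fun X Y => ⟨fun a b => LinearMap.ext fun x => by
        rw [Subsingleton.elim x 0, map_zero, map_zero]⟩
    exact ⟨fun M N => 0, fun _ _ _ _ _ _ _ => Subsingleton.elim _ _⟩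
  · exact hA.exists_duality
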